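/- **Setting.** An SSP instance $M$ has a finite set of $S$ non-goal states, $A$ actions, an absorbing cost-free goal $g$, costs $c(s,a)\ge 0$, transition laws $P(\cdot\mid s,a)$ on the states together with $g$, and an initial state $s_{\mathrm{init}}$. A (randomized Markov, possibly non-stationary) policy $\pi$ has value $V^\pi(s)\in[0,\infty]$, the expected total cost from $s$, and expected hitting time $T^\pi(s)\in[0,\infty]$ of $g$. A stationary policy is proper if $T^\pi(s)<\infty$ for all $s$. Put $V^\star(s)=\inf\{V^\pi(s):\pi \text{ stationary and proper}\}$ and $B_\star=B_\star(M)=\max_s V^\star(s)$. A proper $\pi$ is optimal if $V^\pi=V^\star$. A policy is $\epsilon$-optimal if $V^\pi(s_{\mathrm{init}})\le V^\star(s_{\mathrm{init}})+\epsilon$. With $c_{\min}=\min_{s,a}c(s,a)$, put $T_\ddagger=B_\star/c_{\min}$ ($=\infty$ if $c_{\min}=0$ and $B_\star>0$). A best-policy identification (BPI) algorithm interacts with $M$ starting at $s_{\mathrm{init}}$: in each step (one sample) it plays an action in the current state and observes the next state; on reaching $g$ it is returned to $s_{\mathrm{init}}$. Its choices may be randomized and depend on the history, on the costs $c$, on $s_{\mathrm{init}}$,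 and on all parameters below. At some time it may stop and output a policy. It is $(\epsilon,\delta)$-correct with sample complexity $n(\cdot)$ on a class of instances if for every $M$ in the class, with probability at least $1-\delta$, it stops after at most $n(M)\in\mathbb N\cup\{\infty\}$ samples (finitely many, if $n(M)=\infty$) and outputs an $\epsilon$-optimal policy. For $c_{\min}\ge 0$, $B,J\ge 0$ and $\overline T\in[0,\infty]$ let $\mathcal C(S,A,c_{\min},B,J,\overline T)$ be the class of SSP instances with $S$ states and $A$ actions such that: some action $a_\dagger$ satisfies $c(s,a_\dagger)=J$ and $P(g\mid s,a_\dagger)=1$ for all $s$, while all other actions have costs in $[0,1]$; the minimum cost is $c_{\min}$; $B/2\le B_\star\le 2B$; and there is an optimal proper policy $\pi^\star$ with $T^{\pi^\star}(s)\le\overline T$ for all $s$. **Theorem.** There is a universal constant $\kappa>0$ such that the following holds. Let $S\ge 4$, $A\ge 4$, $B\ge 2$, $J\ge 3B$, $c_{\min}\ge 0$, $\overline T\in[0,\infty]$, $\epsilon\in(0,\frac1{32})$, $\delta\in(0,\frac1{2e^4})$, and suppose that $$\max\{B,\ \log_{A-1}S+1\}\le\min\{B/c_{\min},\ \overline T/2\},\qquad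 J-N\le\tfrac12(A-1)^{N}\quad\text{with } N=\min\{\lfloor B\rfloor,S-3\}.$$ Then for every BPI algorithm that is $(\epsilon,\delta)$-correct with sample complexity $n(\cdot)$ on $\mathcal C(S,A,c_{\min},B,J,\overline T)$ there is an instance $M$ in this class with $$n(M)\ \ge\ \kappa\left(\min\{T_\ddagger,\overline T\}\,\frac{B_\star^2SA}{\epsilon^2}\ln\frac1\delta+\frac J\epsilon\right),$$ where $B_\star=B_\star(M)$ and $T_\ddagger=B_\star(M)/c_{\min}$; in particular $n(M)=\infty$ if $\min\{T_\ddagger,\overline T\}=\infty$. -/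

import Mathlib

open scoped ENNReal NNReal

noncomputable section

/-- A stochastic shortest path (SSP) problem with `S` non-goal states, `A` actions, and a
distinguished initial state. The goal `g` is `none : Option (Fin S)`; it is absorbing and free. -/
structure SSP (S A : ℕ) where
  /-- the cost `c(s, a)` -/
  cost : Fin S → Fin A → ℝ≥0
  /-- the law of the next state after taking action `a` in state `s` -/
  trans : Fin S → Fin A → PMF (Option (Fin S))
  /-- the initial state -/
  init : Fin S

/-- A stationary (randomized) policy: a distribution over actions for every state. -/
abbrev StationaryPolicy (S A : ℕ) : Type := Fin S → stdSimplex ℝ (Fin A)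

/-- A Markov (randomized, possibly non-stationary) policy: a distribution over actions for every
time step and state. -/
abbrev MarkovPolicy (S A : ℕ) : Type := ℕ → Fin S → stdSimplex ℝ (Fin A)

namespace SSP

variable {S A : ℕ} (M : SSP S A)

/-- `M.occ π s t x` is the probability that the process which starts in `s` at time `0` and follows
`π` is in the non-goal state `x` at time `t`. -/
def occ (π : MarkovPolicy S A) (s : Fin S) : ℕ → Fin S → ℝ≥0∞
  | 0, x => if x = s then 1 else 0
  | t + 1, y => ∑ x, ∑ a, occ π s t x * ENNReal.ofReal (π t x a) * M.trans x a (some y)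

/-- The value function `V^π(s)`: the expected total cost of following `π` from `s`. -/
def value (π : MarkovPolicy S A) (s : Fin S) : ℝ≥0∞ :=
  ∑' t, ∑ x, ∑ a, M.occ π s t x * ENNReal.ofReal (π t x a) * (M.cost x a : ℝ≥0∞)

/-- The expected hitting time `T^π(s)` of the goal from `s` under `π`, as the sum over `t` of the
probabilities that the goal has not been reached by time `t`. -/
def hittingTime (π : MarkovPolicy S A) (s : Fin S) : ℝ≥0∞ :=
  ∑' t, ∑ x, M.occ π s t x

/-- A stationary policy is proper if it reaches the goal in finite expected time from every state
(for a finite state space: if it reaches the goal almost surely from every state). -/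
def IsProper (π : StationaryPolicy S A) : Prop :=
  ∀ s, M.hittingTime (fun _ => π) s < ⊤

/-- The optimal value function `V⋆`: the least expected total cost over proper policies. -/
def optValue (s : Fin S) : ℝ≥0∞ :=
  ⨅ (π : StationaryPolicy S A) (_ : M.IsProper π), M.value (fun _ => π) s

/-- An optimal proper policy. -/
def IsOptimalProper (π : StationaryPolicy S A) : Prop :=
  M.IsProper π ∧ ∀ s, M.value (fun _ => π) s = M.optValue s

/-- `B⋆`, the largest optimal expected cost over all states. -/
def Bstar : ℝ≥0∞ := ⨆ s, M.optValue s

/-- `ε`-optimality of a policy, from the initial state. -/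
def IsEpsOptimal (ε : ℝ) (π : MarkovPolicy S A) : Prop :=
  M.value π M.init ≤ M.optValue M.init + ENNReal.ofReal ε

/-- The goal can be reached from any state at fixed cost `J`: some action leads from every state
directly to the goal at cost `J`. All other actions have costs in `[0, 1]`. -/
def HasTerminalAction (J : ℝ≥0) : Prop :=
  ∃ a₀ : Fin A, (∀ s, M.cost s a₀ = J ∧ M.trans s a₀ = PMF.pure none) ∧
    ∀ s a, a ≠ a₀ → M.cost s a ≤ 1

/-- The SSP instances with a terminal action of cost `J`, minimum cost exactly `cmin`, `B⋆` within
a factor two of `B`, and an optimal proper policy whose hitting time is at most `Tbar` from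
every state. -/
structure HasParameters (cmin B J : ℝ≥0) (Tbar : ℝ≥0∞) : Prop where
  terminal : M.HasTerminalAction J
  minCost : IsLeast {c | ∃ s a, M.cost s a = c} cmin
  le_Bstar : (B : ℝ≥0∞) / 2 ≤ M.Bstar
  Bstar_le : M.Bstar ≤ 2 * (B : ℝ≥0∞)
  hitting : ∃ π, M.IsOptimalProper π ∧ ∀ s, M.hittingTime (fun _ => π) s ≤ Tbar

end SSP

/-- An interaction history: the list of the actions taken and the states that they led to,
the most recent one first. -/
abbrev History (S A : ℕ) : Type := List (Fin A × Option (Fin S))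

/-- A randomized algorithm for best-policy identification. It draws a random seed `ω` once. Then,
given the (known) costs, the initial state, the seed and the history so far, it
either plays an action or stops and outputs a policy. -/
structure BPIAlgorithm (S A : ℕ) (Ω : Type*) [MeasurableSpace Ω] where
  /-- the law of the random seed -/
  seedLaw : MeasureTheory.Measure Ω
  isProbabilityMeasure_seedLaw : MeasureTheory.IsProbabilityMeasure seedLaw
  /-- the next action, or the output policy -/
  decide : (Fin S → Fin A → ℝ≥0) → Fin S → Ω → History S A → Fin A ⊕ MarkovPolicy S A
  measurable_decide : ∀ c s h, Measurable fun ω => decide c s ω h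

namespace SSP

variable {S A : ℕ} (M : SSP S A)

/-- The state that the learner is in after a history: the last state reached, and the initial state
at the beginning and whenever the goal has just been reached. -/
def currentState : History S A → Fin S
  | [] => M.init
  | (_, some s) :: _ => s
  | (_, none) :: _ => M.init

/-- The law of the history after `n` rounds of interaction of the (deterministic) learner `d`
with `M`, one sample per round; nothing happens any more once the learner has stopped. -/
def run (d : History S A → Fin A ⊕ MarkovPolicy S A) : ℕ → PMF (History S A)
  | 0 => PMF.pure []
  | n + 1 => (run d n).bind fun h =>
      match d h with
      | Sum.inl a => (M.trans (M.currentState h) a).map fun s => (a, s) :: h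
      | Sum.inr _ => PMF.pure h

/-- The probability that the algorithm, run on `M`, stops after at most `n` samples and outputs an
`ε`-optimal policy. (The inner quantity is nondecreasing in `k`, so that the supremum is its
value at `k = n` for finite `n`, and its limit for `n = ⊤`.) -/
def successProb {Ω : Type*} [MeasurableSpace Ω] (alg : BPIAlgorithm S A Ω) (ε : ℝ) (n : ℕ∞) :
    ℝ≥0∞ :=
  ⨆ (k : ℕ) (_ : (k : ℕ∞) ≤ n),
    ∫⁻ ω, (M.run (alg.decide M.cost M.init ω) k).toOuterMeasure
      {h | ∃ π, alg.decide M.cost M.init ω h = Sum.inr π ∧ M.IsEpsOptimal ε π} ∂alg.seedLaw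

end SSP

/-- The algorithm is `(ε, δ)`-correct with sample complexity `n` on the class `C` of instances:
on every `M` in `C`, with probability at least `1 - δ`, it stops after at most `n M` samples and
outputs an `ε`-optimal policy. -/
def BPIAlgorithm.IsCorrect {S A : ℕ} {Ω : Type*} [MeasurableSpace Ω] (alg : BPIAlgorithm S A Ω)
    (ε δ : ℝ) (C : Set (SSP S A)) (n : SSP S A → ℕ∞) : Prop :=
  ∀ M ∈ C, ENNReal.ofReal (1 - δ) ≤ M.successProb alg ε (n M)

end

/-! Every bound compares a base instance M₀ with alternatives that share its costs and initial
state, so only samples can tell them apart. The mechanism is `card_mul_le_of_isCorrect`. Put n₀ =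
n(M₀). On M₀ a correct learner stops within n₀ samples with probability at least 1 - δ. If no policy
is ε-optimal for more than g of the K alternatives, then the probabilities of stopping with an
output that is bad for alternative k sum over k to at least K(1 - δ) - g. If each of them is at most
β_k plus c times its analogue under alternative k, where it is at most δ, then K(1 - δ) ≤ g + ∑ β_k
+ cKδ.

Put T = min(B / cmin, Tbar / 2). If T = ∞, a free action that loops in the initial state of M₀ is
changed to leave with a tiny probability ρ, either to a trap of cost B or to the goal. No policy is
good for both changes (`two_le_value_add_value`), and n₀ samples miss a ρ of order 1 / n₀. Hence
n(M₀) = ∞.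

The term J / ε comes from a combination lock that is entered only with probability p = 7ε / J, and
never in M₀. The lock opens at cost at most B to those who know its code. A policy that does not
know it can afford about J - N trials before the terminal action is the better choice, while there
are (A - 1)^N codes. So every policy pays an excess above pJ / 7 = ε for at least a third of the
codes (`card_le_of_lock_isEpsOptimal`), and seeing the lock takes about J / ε samples.

The main term comes from a tree whose leaves each cost B, paid at rate B / T with exit probability 1
/ T per step. Alternative k raises the exit probability at one leaf-action pair by the factor 1 + η,
η = 4ε / B. A good policy must play that pair T / 2 times on average
(`half_le_total_of_isEpsOptimal`), out of at most T leaf plays in all, so it is good for at most two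
alternatives. One play of the pair carries information of order η² / T, so about T / η² · ln(1 / δ)
plays of each of order SA pairs are needed. This is made precise by a second-moment change of
measure (`stopMass_le_of_likelihood`), with the likelihood ratio controlled only on histories that
play the pair rarely; the others are handled by Markov's inequality.

A sum is at most twice its larger term, so the instance that witnesses the larger term serves for
both. -/

noncomputable section

/-! ### Bellman inequalities and verification of optimal policies -/

open Filter Topology

/-- The law that puts mass `p` (capped at `1`) on `x` and the remaining mass on `y`. -/
def twoPoint {α : Type*} [Fintype α] [DecidableEq α] (p : ℝ≥0) (x y : α) : PMF α :=
  PMF.ofFintype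
    (fun o => ((if o = x then min p 1 else 0 : ℝ≥0) : ℝ≥0∞) + ((if o = y then 1 - min p 1 else 0 : ℝ≥0) : ℝ≥0∞))
    (by
      rw [Finset.sum_add_distrib, ← ENNReal.ofNNReal_finsetSum, ← ENNReal.ofNNReal_finsetSum]
      simp only [Finset.sum_ite_eq', Finset.mem_univ, if_true]
      rw [← ENNReal.coe_add, add_tsub_cancel_of_le (min_le_right p 1), ENNReal.coe_one])

theorem twoPoint_apply {α : Type*} [Fintype α] [DecidableEq α] (p : ℝ≥0) (x y o : α) :
    twoPoint p x y o =
      ((if o = x then min p 1 else 0 : ℝ≥0) : ℝ≥0∞) + ((if o = y then 1 - min p 1 else 0 : ℝ≥0) : ℝ≥0∞) :=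
  rfl

theorem toReal_twoPoint {α : Type*} [Fintype α] [DecidableEq α] {p : ℝ≥0} (hp : p ≤ 1)
    (x y o : α) :
    (twoPoint p x y o).toReal = (if o = x then (p : ℝ) else 0) + (if o = y then 1 - (p : ℝ) else 0) := by
  rw [twoPoint_apply, min_eq_left hp, ENNReal.toReal_add ENNReal.coe_ne_top ENNReal.coe_ne_top]
  have h : (((1 - p : ℝ≥0) : ℝ≥0∞)).toReal = 1 - (p : ℝ) := by
    rw [ENNReal.coe_toReal, NNReal.coe_sub hp, NNReal.coe_one]
  split_ifs <;> simp only [h, ENNReal.coe_toReal, NNReal.coe_zero]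

/-- The deterministic stationary policy that plays `f x` in state `x`. -/
def detPolicy {S A : ℕ} (f : Fin S → Fin A) : StationaryPolicy S A :=
  fun x => ⟨Pi.single (f x) 1, single_mem_stdSimplex ℝ (f x)⟩

theorem sum_detPolicy {S A : ℕ} (f : Fin S → Fin A) (x : Fin S) (F : Fin A → ℝ≥0∞) :
    ∑ a, ENNReal.ofReal (detPolicy f x a) * F a = F (f x) := by
  rw [Finset.sum_eq_single (f x)]
  · have : detPolicy f x (f x) = 1 := by
      change (Pi.single (f x) (1 : ℝ) : Fin A → ℝ) (f x) = 1
      simp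
    simp [this]
  · intro a _ ha
    have : detPolicy f x a = 0 := by
      change (Pi.single (f x) (1 : ℝ) : Fin A → ℝ) a = 0
      simp [ha]
    simp [this]
  · simp

theorem sum_ofReal_stdSimplex {A : ℕ} (q : stdSimplex ℝ (Fin A)) :
    ∑ a, ENNReal.ofReal (q a) = 1 := by
  rw [← ENNReal.ofReal_sum_of_nonneg fun a _ => stdSimplex.zero_le q a, stdSimplex.sum_eq_one,
    ENNReal.ofReal_one]

theorem sum_stdSimplex_mul_le {A : ℕ} (q : stdSimplex ℝ (Fin A)) {F : Fin A → ℝ≥0∞} {C : ℝ≥0∞}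
    (h : ∀ a, F a ≤ C) : ∑ a, ENNReal.ofReal (q a) * F a ≤ C := by
  calc ∑ a, ENNReal.ofReal (q a) * F a ≤ ∑ a, ENNReal.ofReal (q a) * C := by
        gcongr with a; exact h a
    _ = C := by rw [← Finset.sum_mul, sum_ofReal_stdSimplex, one_mul]

namespace SSP

variable {S A : ℕ} (M : SSP S A)

/-- The expected value of `φ` at the next state, where `φ` vanishes at the goal. -/
def nextE (x : Fin S) (a : Fin A) (φ : Fin S → ℝ≥0∞) : ℝ≥0∞ :=
  ∑ y, M.trans x a (some y) * φ y

/-- Real-valued version of `nextE`. -/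
def nextR (x : Fin S) (a : Fin A) (φ : Fin S → ℝ) : ℝ :=
  ∑ y, (M.trans x a (some y)).toReal * φ y

/-- The expected total reward of `π` from `s` for the rewards `r`. -/
def total (π : MarkovPolicy S A) (s : Fin S) (r : Fin S → Fin A → ℝ≥0∞) : ℝ≥0∞ :=
  ∑' t, ∑ x, ∑ a, M.occ π s t x * ENNReal.ofReal (π t x a) * r x a

/-- The expected reward of `π` from `s` before time `n` for the rewards `r`. -/
def partialTotal (π : MarkovPolicy S A) (s : Fin S) (r : Fin S → Fin A → ℝ≥0∞) (n : ℕ) : ℝ≥0∞ :=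
  ∑ t ∈ Finset.range n, ∑ x, ∑ a, M.occ π s t x * ENNReal.ofReal (π t x a) * r x a

theorem value_eq_total (π : MarkovPolicy S A) (s : Fin S) :
    M.value π s = M.total π s fun x a => (M.cost x a : ℝ≥0∞) := rfl

theorem partialTotal_le_total (π : MarkovPolicy S A) (s : Fin S) (r : Fin S → Fin A → ℝ≥0∞)
    (n : ℕ) : M.partialTotal π s r n ≤ M.total π s r :=
  ENNReal.sum_le_tsum _

theorem total_le_of_partialTotal_le {π : MarkovPolicy S A} {s : Fin S}
    {r : Fin S → Fin A → ℝ≥0∞} {C : ℝ≥0∞} (h : ∀ n, M.partialTotal π s r n ≤ C) :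
    M.total π s r ≤ C := by
  unfold total
  rw [ENNReal.tsum_eq_iSup_nat]
  exact iSup_le h

theorem hittingTime_eq_total (π : MarkovPolicy S A) (s : Fin S) :
    M.hittingTime π s = M.total π s fun _ _ => 1 := by
  unfold hittingTime total
  congr 1; ext t
  refine Finset.sum_congr rfl fun x _ => ?_
  simp only [mul_one, ← Finset.mul_sum, sum_ofReal_stdSimplex]

theorem sum_occ_zero (π : MarkovPolicy S A) (s : Fin S) (φ : Fin S → ℝ≥0∞) :
    ∑ x, M.occ π s 0 x * φ x = φ s := by
  simp [occ]

theorem sum_occ_succ (π : MarkovPolicy S A) (s : Fin S) (t : ℕ) (φ : Fin S → ℝ≥0∞) :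
    ∑ y, M.occ π s (t + 1) y * φ y =
      ∑ x, M.occ π s t x * ∑ a, ENNReal.ofReal (π t x a) * M.nextE x a φ := by
  simp only [occ, nextE, Finset.sum_mul, Finset.mul_sum]
  rw [Finset.sum_comm]
  refine Finset.sum_congr rfl fun x _ => ?_
  rw [Finset.sum_comm]
  refine Finset.sum_congr rfl fun a _ => Finset.sum_congr rfl fun y _ => ?_
  ring

theorem partialTotal_succ (π : MarkovPolicy S A) (s : Fin S) (r : Fin S → Fin A → ℝ≥0∞) (n : ℕ) :
    M.partialTotal π s r (n + 1) = M.partialTotal π s r n +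
      ∑ x, M.occ π s n x * ∑ a, ENNReal.ofReal (π n x a) * r x a := by
  simp only [partialTotal, Finset.sum_range_succ, Finset.mul_sum, mul_assoc]

/-- Telescoping: one step trades the expected `w` at the current state for the reward plus the
expected `w` at the next one, and never gains. -/
theorem partialTotal_add_le {π : MarkovPolicy S A} {r : Fin S → Fin A → ℝ≥0∞} {w : Fin S → ℝ≥0∞}
    (h : ∀ t x, ∑ a, ENNReal.ofReal (π t x a) * (r x a + M.nextE x a w) ≤ w x) (s : Fin S) (n : ℕ) :
    M.partialTotal π s r n + ∑ x, M.occ π s n x * w x ≤ w s := by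
  induction n with
  | zero => rw [sum_occ_zero]; simp [partialTotal]
  | succ n ih =>
    rw [partialTotal_succ, sum_occ_succ, add_assoc, ← Finset.sum_add_distrib]
    refine le_trans ?_ ih
    gcongr with x
    rw [← mul_add, ← Finset.sum_add_distrib]
    simp only [← mul_add]
    gcongr
    exact h n x

/-- A solution of the Bellman inequality bounds the total reward from above. -/
theorem total_le_of_bellman {π : MarkovPolicy S A} {r : Fin S → Fin A → ℝ≥0∞} {w : Fin S → ℝ≥0∞}
    (h : ∀ t x, ∑ a, ENNReal.ofReal (π t x a) * (r x a + M.nextE x a w) ≤ w x) (s : Fin S) :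
    M.total π s r ≤ w s :=
  M.total_le_of_partialTotal_le fun n => le_self_add.trans (M.partialTotal_add_le h s n)

/-- The same telescoping from below. The potential may depend on time; the lock needs this. -/
theorem le_partialTotal_add {π : MarkovPolicy S A} {r g e : Fin S → Fin A → ℝ≥0∞}
    {φ : ℕ → Fin S → ℝ≥0∞}
    (h : ∀ t x, φ t x + ∑ a, ENNReal.ofReal (π t x a) * g x a ≤
      ∑ a, ENNReal.ofReal (π t x a) * (r x a + e x a + M.nextE x a (φ (t + 1))))
    (s : Fin S) (n : ℕ) :
    φ 0 s + M.partialTotal π s g n ≤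
      M.partialTotal π s r n + M.partialTotal π s e n + ∑ x, M.occ π s n x * φ n x := by
  induction n with
  | zero => rw [sum_occ_zero]; simp [partialTotal]
  | succ n ih =>
    rw [partialTotal_succ, partialTotal_succ, partialTotal_succ, sum_occ_succ]
    calc φ 0 s + (M.partialTotal π s g n +
          ∑ x, M.occ π s n x * ∑ a, ENNReal.ofReal (π n x a) * g x a)
        ≤ M.partialTotal π s r n + M.partialTotal π s e n + ∑ x, M.occ π s n x * φ n x +
          ∑ x, M.occ π s n x * ∑ a, ENNReal.ofReal (π n x a) * g x a := by
          rw [← add_assoc]; gcongr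
      _ = M.partialTotal π s r n + M.partialTotal π s e n +
          ∑ x, M.occ π s n x * (φ n x + ∑ a, ENNReal.ofReal (π n x a) * g x a) := by
          rw [add_assoc, ← Finset.sum_add_distrib]; simp only [mul_add]
      _ ≤ M.partialTotal π s r n + M.partialTotal π s e n + ∑ x, M.occ π s n x *
          ∑ a, ENNReal.ofReal (π n x a) * (r x a + e x a + M.nextE x a (φ (n + 1))) := by
          gcongr with x; exact h n x
      _ = _ := by
          simp only [mul_add, Finset.sum_add_distrib]; ring

/-- The survival probabilities are the terms of a convergent series, and `φ` is bounded on the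
finite state space. -/
theorem tendsto_sum_occ_mul {π : MarkovPolicy S A} {s : Fin S} (hT : M.hittingTime π s < ⊤)
    {φ : Fin S → ℝ≥0∞} (hφ : ∀ x, φ x ≠ ⊤) :
    Tendsto (fun n => ∑ x, M.occ π s n x * φ x) atTop (𝓝 0) := by
  have h1 : Tendsto (fun n => ∑ x, M.occ π s n x) atTop (𝓝 0) :=
    ENNReal.tendsto_atTop_zero_of_tsum_ne_top hT.ne
  have hC : ∑ x, φ x ≠ ⊤ := ENNReal.sum_ne_top.2 fun x _ => hφ x
  have h2 : Tendsto (fun n => (∑ x, M.occ π s n x) * ∑ x, φ x) atTop (𝓝 0) := by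
    simpa using ENNReal.Tendsto.mul_const h1 (Or.inr hC)
  refine tendsto_of_tendsto_of_tendsto_of_le_of_le tendsto_const_nhds h2 (fun _ => zero_le)
    fun n => ?_
  simp only
  rw [Finset.sum_mul]
  gcongr with x
  exact Finset.single_le_sum (f := φ) (fun _ _ => zero_le) (Finset.mem_univ x)

/-- A solution of the reverse Bellman inequality, with surplus `g` and deficit `e`, bounds the
total reward from below when the goal is reached in finite expected time. -/
theorem le_total_of_bellman {π : MarkovPolicy S A} {r g e : Fin S → Fin A → ℝ≥0∞}
    {φ : Fin S → ℝ≥0∞} {s : Fin S} (hT : M.hittingTime π s < ⊤) (hφ : ∀ x, φ x ≠ ⊤)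
    (h : ∀ x a, φ x + g x a ≤ r x a + e x a + M.nextE x a φ) :
    φ s + M.total π s g ≤ M.total π s r + M.total π s e := by
  have h' : ∀ (t : ℕ) x, φ x + ∑ a, ENNReal.ofReal (π t x a) * g x a ≤
      ∑ a, ENNReal.ofReal (π t x a) * (r x a + e x a + M.nextE x a φ) := by
    intro t x
    calc φ x + ∑ a, ENNReal.ofReal (π t x a) * g x a
        = ∑ a, ENNReal.ofReal (π t x a) * (φ x + g x a) := by
          simp only [mul_add, Finset.sum_add_distrib]
          rw [← Finset.sum_mul, sum_ofReal_stdSimplex, one_mul]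
      _ ≤ _ := Finset.sum_le_sum fun a _ => mul_le_mul_right (h x a) _
  have key : ∀ n, φ s + M.partialTotal π s g n ≤
      M.total π s r + M.total π s e + ∑ x, M.occ π s n x * φ x := fun n =>
    (M.le_partialTotal_add (φ := fun _ => φ) h' s n).trans (by
      gcongr <;> exact M.partialTotal_le_total _ _ _ _)
  have hg : Tendsto (fun n => φ s + M.partialTotal π s g n) atTop (𝓝 (φ s + M.total π s g)) :=
    tendsto_const_nhds.add (ENNReal.tendsto_nat_tsum _)
  have hr : Tendsto (fun n => M.total π s r + M.total π s e + ∑ x, M.occ π s n x * φ x) atTop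
      (𝓝 (M.total π s r + M.total π s e + 0)) :=
    tendsto_const_nhds.add (M.tendsto_sum_occ_mul hT hφ)
  rw [add_zero] at hr
  exact le_of_tendsto_of_tendsto' hg hr key

theorem nextE_ofReal (x : Fin S) (a : Fin A) {φ : Fin S → ℝ} (hφ : ∀ y, 0 ≤ φ y) :
    M.nextE x a (fun y => ENNReal.ofReal (φ y)) = ENNReal.ofReal (M.nextR x a φ) := by
  unfold nextE nextR
  rw [ENNReal.ofReal_sum_of_nonneg fun y _ => mul_nonneg ENNReal.toReal_nonneg (hφ y)]
  refine Finset.sum_congr rfl fun y _ => ?_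
  rw [ENNReal.ofReal_mul ENNReal.toReal_nonneg, ENNReal.ofReal_toReal (PMF.apply_ne_top _ _)]

theorem nextR_nonneg (x : Fin S) (a : Fin A) {φ : Fin S → ℝ} (hφ : ∀ y, 0 ≤ φ y) :
    0 ≤ M.nextR x a φ :=
  Finset.sum_nonneg fun y _ => mul_nonneg ENNReal.toReal_nonneg (hφ y)

theorem nextR_of_trans_eq_twoPoint {x : Fin S} {a : Fin A} {p : ℝ≥0} (hp : p ≤ 1)
    {o o' : Option (Fin S)} (h : M.trans x a = twoPoint p o o') (φ : Fin S → ℝ) :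
    M.nextR x a φ = p * o.elim 0 φ + (1 - p) * o'.elim 0 φ := by
  unfold nextR
  simp only [h, toReal_twoPoint hp, add_mul, Finset.sum_add_distrib]
  congr 1
  · cases o <;> simp
  · cases o' <;> simp

theorem nextR_of_trans_eq_pure {x : Fin S} {a : Fin A} {o : Option (Fin S)}
    (h : M.trans x a = PMF.pure o) (φ : Fin S → ℝ) :
    M.nextR x a φ = o.elim 0 φ := by
  unfold nextR
  simp only [h, PMF.pure_apply]
  cases o
  · simp
  · rename_i z
    rw [Finset.sum_eq_single z]
    · simp
    · intro y _ hy; simp [hy]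
    · simp

/-- With the inequality for all actions the bound covers every policy. `le_total_of_bellman` can
then be applied to whatever the learner outputs. -/
theorem hittingTime_le_of_bellman {u : Fin S → ℝ} (hu : ∀ x, 0 ≤ u x)
    (h : ∀ x a, 1 + M.nextR x a u ≤ u x) (π : MarkovPolicy S A) (s : Fin S) :
    M.hittingTime π s ≤ ENNReal.ofReal (u s) := by
  rw [hittingTime_eq_total]
  refine M.total_le_of_bellman (w := fun x => ENNReal.ofReal (u x)) (fun t x => ?_) s
  refine sum_stdSimplex_mul_le _ fun a => ?_
  rw [M.nextE_ofReal x a hu, ← ENNReal.ofReal_one,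
    ← ENNReal.ofReal_add zero_le_one (M.nextR_nonneg x a hu)]
  exact ENNReal.ofReal_le_ofReal (h x a)

/-- Verification theorem: a deterministic policy that solves the Bellman equation with value `w`
and has expected hitting times at most `u` is optimal among proper policies. -/
theorem isOptimalProper_of_bellman (f : Fin S → Fin A) {w u : Fin S → ℝ}
    (hw : ∀ x, 0 ≤ w x) (hu : ∀ x, 0 ≤ u x)
    (hle : ∀ x a, w x ≤ M.cost x a + M.nextR x a w)
    (hge : ∀ x, M.cost x (f x) + M.nextR x (f x) w ≤ w x)
    (ht : ∀ x, 1 + M.nextR x (f x) u ≤ u x) :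
    M.IsOptimalProper (detPolicy f) ∧ (∀ s, M.optValue s = ENNReal.ofReal (w s)) ∧
      ∀ s, M.hittingTime (fun _ => detPolicy f) s ≤ ENNReal.ofReal (u s) := by
  have hhit : ∀ s, M.hittingTime (fun _ => detPolicy f) s ≤ ENNReal.ofReal (u s) := by
    intro s
    rw [hittingTime_eq_total]
    refine M.total_le_of_bellman (w := fun x => ENNReal.ofReal (u x)) (fun t x => ?_) s
    rw [sum_detPolicy, M.nextE_ofReal x _ hu, ← ENNReal.ofReal_one,
      ← ENNReal.ofReal_add zero_le_one (M.nextR_nonneg x _ hu)]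
    exact ENNReal.ofReal_le_ofReal (ht x)
  have hprop : M.IsProper (detPolicy f) := fun s => (hhit s).trans_lt ENNReal.ofReal_lt_top
  -- Properness of the competitor removes the remainder term of the telescoped inequality in the
  -- limit; a policy that avoids the goal for free could beat `w`.
  have hlow : ∀ π, M.IsProper π → ∀ s, ENNReal.ofReal (w s) ≤ M.value (fun _ => π) s := by
    intro π hπ s
    have := M.le_total_of_bellman (g := fun _ _ => 0) (e := fun _ _ => 0)
      (r := fun x a => (M.cost x a : ℝ≥0∞)) (φ := fun x => ENNReal.ofReal (w x)) (hπ s)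
      (fun _ => ENNReal.ofReal_ne_top) (fun x a => by
        rw [M.nextE_ofReal x a hw, add_zero, add_zero, ← ENNReal.ofReal_coe_nnreal,
          ← ENNReal.ofReal_add (NNReal.coe_nonneg _) (M.nextR_nonneg x a hw)]
        exact ENNReal.ofReal_le_ofReal (hle x a))
    have h0 : M.total (fun _ => π) s (fun _ _ => 0) = 0 := by simp [total]
    rwa [h0, add_zero, add_zero] at this
  have hup : ∀ s, M.value (fun _ => detPolicy f) s ≤ ENNReal.ofReal (w s) := by
    intro s
    rw [value_eq_total]
    refine M.total_le_of_bellman (w := fun x => ENNReal.ofReal (w x)) (fun t x => ?_) s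
    rw [sum_detPolicy, M.nextE_ofReal x _ hw, ← ENNReal.ofReal_coe_nnreal,
      ← ENNReal.ofReal_add (NNReal.coe_nonneg _) (M.nextR_nonneg x _ hw)]
    exact ENNReal.ofReal_le_ofReal (hge x)
  have hopt : ∀ s, M.optValue s = ENNReal.ofReal (w s) := fun s =>
    le_antisymm ((iInf₂_le _ hprop).trans (hup s)) (le_iInf₂ fun π hπ => hlow π hπ s)
  exact ⟨⟨hprop, fun s => (le_antisymm (hup s) (hlow _ hprop s)).trans (hopt s).symm⟩, hopt, hhit⟩

/-- Membership in the class of instances from a solution of the Bellman equation. -/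
theorem hasParameters_of_bellman {cmin B J : ℝ≥0} {Tbar : ℝ≥0∞} (hterm : M.HasTerminalAction J)
    (hmin : IsLeast {c | ∃ s a, M.cost s a = c} cmin) (f : Fin S → Fin A) {w u : Fin S → ℝ}
    (hw : ∀ x, 0 ≤ w x) (hu : ∀ x, 0 ≤ u x)
    (hle : ∀ x a, w x ≤ M.cost x a + M.nextR x a w)
    (hge : ∀ x, M.cost x (f x) + M.nextR x (f x) w ≤ w x)
    (ht : ∀ x, 1 + M.nextR x (f x) u ≤ u x)
    (hBw : ∃ x, (B : ℝ) / 2 ≤ w x) (hwB : ∀ x, w x ≤ 2 * B)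
    (huT : ∀ x, ENNReal.ofReal (u x) ≤ Tbar) :
    M.HasParameters cmin B J Tbar ∧ ∀ s, M.optValue s = ENNReal.ofReal (w s) := by
  obtain ⟨h1, h2, h3⟩ := M.isOptimalProper_of_bellman f hw hu hle hge ht
  refine ⟨⟨hterm, hmin, ?_, ?_, _, h1, fun s => (h3 s).trans (huT s)⟩, h2⟩
  · obtain ⟨x, hx⟩ := hBw
    refine le_trans ?_ (le_iSup _ x)
    rw [h2, ← ENNReal.ofReal_coe_nnreal, ← ENNReal.ofReal_ofNat,
      ← ENNReal.ofReal_div_of_pos (by norm_num)]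
    exact ENNReal.ofReal_le_ofReal hx
  · refine iSup_le fun x => ?_
    rw [h2, ← ENNReal.ofReal_coe_nnreal, ← ENNReal.ofReal_ofNat,
      ← ENNReal.ofReal_mul (by norm_num)]
    exact ENNReal.ofReal_le_ofReal (hwB x)

end SSP
end

/-! ### Laws of histories, averaging over alternatives, change of measure -/

noncomputable section

theorem PMF.tsum_bind_mul {α β : Type*} (p : PMF α) (q : α → PMF β) (f : β → ℝ≥0∞) :
    ∑' y, (p.bind q) y * f y = ∑' x, p x * ∑' y, q x y * f y := by
  simp only [PMF.bind_apply, ← ENNReal.tsum_mul_right, ← ENNReal.tsum_mul_left, mul_assoc]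
  exact ENNReal.tsum_comm

theorem PMF.tsum_pure_mul {α : Type*} (x : α) (f : α → ℝ≥0∞) :
    ∑' y, (PMF.pure x) y * f y = f x := by
  rw [tsum_eq_single x]
  · simp
  · intro y hy; simp [hy]

theorem PMF.tsum_map_mul {α β : Type*} (p : PMF α) (g : α → β) (f : β → ℝ≥0∞) :
    ∑' y, (p.map g) y * f y = ∑' x, p x * f (g x) := by
  simp only [PMF.map, PMF.tsum_bind_mul, Function.comp, PMF.tsum_pure_mul]

theorem PMF.tsum_mul_le {α : Type*} (p : PMF α) {f : α → ℝ≥0∞} {C : ℝ≥0∞} (h : ∀ x, f x ≤ C) :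
    ∑' x, p x * f x ≤ C := by
  calc ∑' x, p x * f x ≤ ∑' x, p x * C := ENNReal.tsum_le_tsum fun x => by gcongr; exact h x
    _ = C := by rw [ENNReal.tsum_mul_right, PMF.tsum_coe, one_mul]

namespace SSP

variable {S A : ℕ} (M : SSP S A)

/-- The law of the next history of the learner `d`. -/
def stepLaw (d : History S A → Fin A ⊕ MarkovPolicy S A) (h : History S A) : PMF (History S A) :=
  match d h with
  | Sum.inl a => (M.trans (M.currentState h) a).map fun s => (a, s) :: h
  | Sum.inr _ => PMF.pure h

theorem run_succ (d : History S A → Fin A ⊕ MarkovPolicy S A) (n : ℕ) :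
    M.run d (n + 1) = (M.run d n).bind (M.stepLaw d) := rfl

theorem stepLaw_inl {d : History S A → Fin A ⊕ MarkovPolicy S A} {h : History S A} {a : Fin A}
    (hd : d h = Sum.inl a) :
    M.stepLaw d h = (M.trans (M.currentState h) a).map fun s => (a, s) :: h := by
  simp [stepLaw, hd]

theorem stepLaw_inr {d : History S A → Fin A ⊕ MarkovPolicy S A} {h : History S A}
    {π : MarkovPolicy S A} (hd : d h = Sum.inr π) : M.stepLaw d h = PMF.pure h := by
  simp [stepLaw, hd]

theorem currentState_congr {M M' : SSP S A} (hi : M.init = M'.init) (h : History S A) :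
    M.currentState h = M'.currentState h := by
  rcases h with _ | ⟨⟨a, _ | s⟩, h⟩ <;> simp [currentState, hi]

theorem currentState_mem_of_run_ne_zero {R : Set (Fin S)} (hinit : M.init ∈ R)
    (hR : ∀ x ∈ R, ∀ a y, M.trans x a (some y) ≠ 0 → y ∈ R)
    (d : History S A → Fin A ⊕ MarkovPolicy S A) (n : ℕ) :
    ∀ h, M.run d n h ≠ 0 → M.currentState h ∈ R := by
  induction n with
  | zero =>
    intro h hh
    have : h = [] := by simpa [run] using hh
    rw [this]; exact hinit
  | succ n ih =>
    intro h' hh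
    rw [run_succ, ← PMF.mem_support_iff, PMF.mem_support_bind_iff] at hh
    obtain ⟨h, h1, h2⟩ := hh
    have hx := ih h ((PMF.mem_support_iff _ _).1 h1)
    rcases hd : d h with a | π
    · rw [stepLaw_inl M hd, PMF.mem_support_map_iff] at h2
      obtain ⟨s, hs, rfl⟩ := h2
      rcases s with _ | y
      · exact hinit
      · exact hR _ hx a y ((PMF.mem_support_iff _ _).1 hs)
    · rw [stepLaw_inr M hd, PMF.mem_support_pure_iff] at h2
      rwa [h2]

/-- If the transition probabilities of `M'` are at least `θ` times those of `M` on a set of states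
that `M` does not leave, then so are the probabilities of histories of length `n`, up to `θ ^ n`. -/
theorem pow_mul_run_le_run {M M' : SSP S A} (hi : M.init = M'.init) {R : Set (Fin S)}
    (hinit : M.init ∈ R) (hR : ∀ x ∈ R, ∀ a y, M.trans x a (some y) ≠ 0 → y ∈ R)
    {θ : ℝ≥0∞} (hθ : θ ≤ 1) (hdom : ∀ x ∈ R, ∀ a o, θ * M.trans x a o ≤ M'.trans x a o)
    (d : History S A → Fin A ⊕ MarkovPolicy S A) (n : ℕ) (h' : History S A) :
    θ ^ n * M.run d n h' ≤ M'.run d n h' := by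
  induction n generalizing h' with
  | zero => rw [pow_zero, one_mul]; exact le_rfl
  | succ n ih =>
    rw [run_succ, run_succ, PMF.bind_apply, PMF.bind_apply, ← ENNReal.tsum_mul_left]
    refine ENNReal.tsum_le_tsum fun h => ?_
    by_cases h0 : M.run d n h = 0
    · simp [h0]
    have hx := M.currentState_mem_of_run_ne_zero hinit hR d n h h0
    have hstep : θ * M.stepLaw d h h' ≤ M'.stepLaw d h h' := by
      rcases hd : d h with a | π
      · rw [stepLaw_inl M hd, stepLaw_inl M' hd, PMF.map_apply, PMF.map_apply,
          ← ENNReal.tsum_mul_left, ← currentState_congr hi]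
        refine ENNReal.tsum_le_tsum fun s => ?_
        split_ifs
        · exact hdom _ hx a s
        · simp
      · rw [stepLaw_inr M hd, stepLaw_inr M' hd]
        exact mul_le_of_le_one_left' hθ
    calc θ ^ (n + 1) * (M.run d n h * M.stepLaw d h h')
        = (θ ^ n * M.run d n h) * (θ * M.stepLaw d h h') := by ring
      _ ≤ _ := mul_le_mul' (ih h) hstep

open Classical in
/-- The indicator of having stopped with an output in `G`. -/
def stopInd (d : History S A → Fin A ⊕ MarkovPolicy S A) (G : Set (MarkovPolicy S A))
    (h : History S A) : ℝ≥0∞ :=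
  if ∃ π, d h = Sum.inr π ∧ π ∈ G then 1 else 0

/-- The probability of having stopped within `n` samples with an output in `G`. -/
def stopMass (d : History S A → Fin A ⊕ MarkovPolicy S A) (n : ℕ) (G : Set (MarkovPolicy S A)) :
    ℝ≥0∞ :=
  ∑' h, M.run d n h * stopInd d G h

theorem toOuterMeasure_run_eq_stopMass (d : History S A → Fin A ⊕ MarkovPolicy S A) (n : ℕ)
    (G : Set (MarkovPolicy S A)) :
    (M.run d n).toOuterMeasure {h | ∃ π, d h = Sum.inr π ∧ π ∈ G} = M.stopMass d n G := by
  classical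
  rw [PMF.toOuterMeasure_apply, stopMass]
  refine tsum_congr fun h => ?_
  simp [Set.indicator_apply, stopInd]

theorem stopMass_mono (d : History S A → Fin A ⊕ MarkovPolicy S A) (G : Set (MarkovPolicy S A)) :
    Monotone fun n => M.stopMass d n G := by
  refine monotone_nat_of_le_succ fun n => ?_
  simp only [stopMass]
  rw [run_succ, PMF.tsum_bind_mul]
  refine ENNReal.tsum_le_tsum fun h => ?_
  gcongr
  rcases hd : d h with a | π
  · simp [stopInd, hd]
  · rw [stepLaw_inr M hd, PMF.tsum_pure_mul]

theorem stopInd_add_compl (d : History S A → Fin A ⊕ MarkovPolicy S A) (G : Set (MarkovPolicy S A))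
    (h : History S A) : stopInd d G h + stopInd d Gᶜ h = stopInd d Set.univ h := by
  rcases hd : d h with a | π
  · simp [stopInd, hd]
  · by_cases hG : π ∈ G <;> simp [stopInd, hd, hG]

theorem stopInd_le_one (d : History S A → Fin A ⊕ MarkovPolicy S A) (G : Set (MarkovPolicy S A))
    (h : History S A) : stopInd d G h ≤ 1 := by
  unfold stopInd; split_ifs <;> simp

theorem stopMass_add_compl (d : History S A → Fin A ⊕ MarkovPolicy S A) (n : ℕ)
    (G : Set (MarkovPolicy S A)) :
    M.stopMass d n G + M.stopMass d n Gᶜ = M.stopMass d n Set.univ := by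
  simp only [stopMass]
  rw [← ENNReal.tsum_add]
  simp only [← mul_add, stopInd_add_compl]

theorem stopMass_le_one (d : History S A → Fin A ⊕ MarkovPolicy S A) (n : ℕ)
    (G : Set (MarkovPolicy S A)) : M.stopMass d n G ≤ 1 :=
  PMF.tsum_mul_le _ (stopInd_le_one d G)

theorem stopMass_le_univ (d : History S A → Fin A ⊕ MarkovPolicy S A) (n : ℕ)
    (G : Set (MarkovPolicy S A)) : M.stopMass d n G ≤ M.stopMass d n Set.univ :=
  le_self_add.trans (M.stopMass_add_compl d n G).le

/-- An output is never revised, so both events grow with time and stay disjoint. Correctness on an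
alternative can thus be used without any limit on its samples. -/
theorem stopMass_compl_add_iSup_le_one (d : History S A → Fin A ⊕ MarkovPolicy S A) (n : ℕ)
    (G : Set (MarkovPolicy S A)) :
    M.stopMass d n Gᶜ + ⨆ j, M.stopMass d j G ≤ 1 := by
  rw [ENNReal.add_iSup]
  refine iSup_le fun j => ?_
  calc M.stopMass d n Gᶜ + M.stopMass d j G
      ≤ M.stopMass d (max n j) Gᶜ + M.stopMass d (max n j) G :=
        add_le_add (M.stopMass_mono d _ (le_max_left n j)) (M.stopMass_mono d _ (le_max_right n j))
    _ = M.stopMass d (max n j) Set.univ := by rw [add_comm, stopMass_add_compl]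
    _ ≤ 1 := M.stopMass_le_one _ _ _

/-- History by history: the one output counts for at most `g` indices. -/
theorem sum_stopMass_le {K : Type*} [Fintype K] (G : K → Set (MarkovPolicy S A)) {g : ℝ≥0∞}
    (hg : ∀ (π : MarkovPolicy S A) (s : Finset K), (∀ k ∈ s, π ∈ G k) → (s.card : ℝ≥0∞) ≤ g)
    (d : History S A → Fin A ⊕ MarkovPolicy S A) (n : ℕ) :
    ∑ k, M.stopMass d n (G k) ≤ g := by
  classical
  simp only [stopMass]
  rw [← Summable.tsum_finsetSum fun _ _ => ENNReal.summable]
  simp only [← Finset.mul_sum]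
  refine PMF.tsum_mul_le _ fun h => ?_
  rcases hd : d h with a | π
  · simp [stopInd, hd]
  · have := hg π (Finset.univ.filter fun k => π ∈ G k) (by simp)
    simpa [stopInd, hd, Finset.sum_ite] using this

/-- Averaging over alternatives: if `M₀` has the same costs as the alternatives `M₁ k`, no policy is
good for many alternatives, and bad outputs are not much less likely under `M₁ k` than under `M₀`,
then correctness bounds the failure probability from below. -/
theorem card_mul_le_of_isCorrect {K : Type*} [Fintype K] {Ω : Type*} [MeasurableSpace Ω]
    (alg : BPIAlgorithm S A Ω) {M₀ : SSP S A} {M₁ : K → SSP S A}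
    (hc : ∀ k, (M₁ k).cost = M₀.cost) (hi : ∀ k, (M₁ k).init = M₀.init) {ε : ℝ} {q : ℝ≥0∞} {n₀ : ℕ}
    {n : K → ℕ∞} (h₀ : q ≤ M₀.successProb alg ε n₀)
    (h₁ : ∀ k, q ≤ (M₁ k).successProb alg ε (n k)) {c g β : ℝ≥0∞}
    (hg : ∀ (π : MarkovPolicy S A) (s : Finset K), (∀ k ∈ s, (M₁ k).IsEpsOptimal ε π) →
      (s.card : ℝ≥0∞) ≤ g)
    (hβ : ∀ d, ∃ β' : K → ℝ≥0∞, ∑ k, β' k ≤ β ∧ ∀ k,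
      M₀.stopMass d n₀ {π | (M₁ k).IsEpsOptimal ε π}ᶜ ≤
        β' k + c * (M₁ k).stopMass d n₀ {π | (M₁ k).IsEpsOptimal ε π}ᶜ) :
    Fintype.card K * q + c * (Fintype.card K * q) ≤ g + β + c * Fintype.card K := by
  set G : K → Set (MarkovPolicy S A) := fun k => {π | (M₁ k).IsEpsOptimal ε π} with hG
  have := alg.isProbabilityMeasure_seedLaw
  let D : Ω → History S A → Fin A ⊕ MarkovPolicy S A := fun ω => alg.decide M₀.cost M₀.init ω
  -- From the base instance only timely stopping is kept; whether the output is good there plays no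
  -- role.
  have i₀ : q ≤ ∫⁻ ω, M₀.stopMass (D ω) n₀ Set.univ ∂alg.seedLaw := by
    refine h₀.trans (iSup₂_le fun j hj => ?_)
    refine MeasureTheory.lintegral_mono fun ω => ?_
    refine (M₀.toOuterMeasure_run_eq_stopMass (D ω) j {π | M₀.IsEpsOptimal ε π}).le.trans ?_
    exact (M₀.stopMass_le_univ _ _ _).trans (M₀.stopMass_mono _ _ (by exact_mod_cast hj))
  have i₁ : ∀ k, q ≤ ∫⁻ ω, ⨆ j, (M₁ k).stopMass (D ω) j (G k) ∂alg.seedLaw := by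
    intro k
    refine (h₁ k).trans (iSup₂_le fun j _ => ?_)
    refine MeasureTheory.lintegral_mono fun ω => ?_
    rw [hc, hi]
    refine ((M₁ k).toOuterMeasure_run_eq_stopMass (D ω) j (G k)).le.trans ?_
    exact le_iSup (fun j => (M₁ k).stopMass (D ω) j (G k)) j
  have pointwise : ∀ ω, Fintype.card K * M₀.stopMass (D ω) n₀ Set.univ +
      c * ∑ k, ⨆ j, (M₁ k).stopMass (D ω) j (G k) ≤ g + β + c * Fintype.card K := by
    intro ω
    obtain ⟨β', hβ1, hβ2⟩ := hβ (D ω)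
    have e1 : Fintype.card K * M₀.stopMass (D ω) n₀ Set.univ =
        ∑ k, M₀.stopMass (D ω) n₀ (G k) + ∑ k, M₀.stopMass (D ω) n₀ (G k)ᶜ := by
      rw [← Finset.sum_add_distrib]
      simp [stopMass_add_compl]
    have e2 : (c * Fintype.card K : ℝ≥0∞) = c * ∑ _k : K, 1 := by simp
    rw [e1, e2]
    calc ∑ k, M₀.stopMass (D ω) n₀ (G k) + ∑ k, M₀.stopMass (D ω) n₀ (G k)ᶜ +
          c * ∑ k, ⨆ j, (M₁ k).stopMass (D ω) j (G k)
        ≤ g + ∑ k, (β' k + c * (M₁ k).stopMass (D ω) n₀ (G k)ᶜ) +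
          c * ∑ k, ⨆ j, (M₁ k).stopMass (D ω) j (G k) := by
          gcongr with k
          · exact M₀.sum_stopMass_le G hg _ _
          · exact hβ2 k
      _ = g + ∑ k, β' k + c * ∑ k, ((M₁ k).stopMass (D ω) n₀ (G k)ᶜ +
          ⨆ j, (M₁ k).stopMass (D ω) j (G k)) := by
          simp only [Finset.sum_add_distrib, mul_add, Finset.mul_sum]; ring
      _ ≤ g + β + c * ∑ _k : K, 1 := by
          gcongr with k
          exact (M₁ k).stopMass_compl_add_iSup_le_one _ _ _
  -- Only superadditivity of the lower integral is used, here and below. It holds without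
  -- measurability of these functions of the seed.
  have sum_le : ∀ s : Finset K, ∑ k ∈ s, ∫⁻ ω, ⨆ j, (M₁ k).stopMass (D ω) j (G k) ∂alg.seedLaw ≤
      ∫⁻ ω, ∑ k ∈ s, ⨆ j, (M₁ k).stopMass (D ω) j (G k) ∂alg.seedLaw := by
    classical
    intro s
    induction s using Finset.induction_on with
    | empty => simp
    | insert k s hk ih =>
      simp only [Finset.sum_insert hk]
      exact (add_le_add_right ih _).trans (MeasureTheory.le_lintegral_add _ _)
  calc Fintype.card K * q + c * (Fintype.card K * q)
      = Fintype.card K * q + c * ∑ _k : K, q := by simp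
    _ ≤ Fintype.card K * ∫⁻ ω, M₀.stopMass (D ω) n₀ Set.univ ∂alg.seedLaw +
        c * ∑ k, ∫⁻ ω, ⨆ j, (M₁ k).stopMass (D ω) j (G k) ∂alg.seedLaw := by
        gcongr with k
        exact i₁ k
    _ ≤ ∫⁻ ω, Fintype.card K * M₀.stopMass (D ω) n₀ Set.univ ∂alg.seedLaw +
        ∫⁻ ω, c * ∑ k, ⨆ j, (M₁ k).stopMass (D ω) j (G k) ∂alg.seedLaw := by
        refine add_le_add (MeasureTheory.lintegral_const_mul_le _ _) ?_
        refine le_trans ?_ (MeasureTheory.lintegral_const_mul_le _ _)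
        gcongr
        exact sum_le Finset.univ
    _ ≤ ∫⁻ _ω, (g + β + c * Fintype.card K) ∂alg.seedLaw :=
        (MeasureTheory.le_lintegral_add _ _).trans (MeasureTheory.lintegral_mono pointwise)
    _ = g + β + c * Fintype.card K := by simp

open Classical in
/-- The number of times that the pair `k` was played in a history. -/
def playCount (k : Fin S × Fin A) : History S A → ℕ
  | [] => 0
  | (a, _) :: h => playCount k h + if (M.currentState h, a) = k then 1 else 0

open Classical in
/-- The likelihood ratio of a history for two instances whose transition laws differ at the pair `k`
by the factor `ℓ` only. -/
def likelihood (k : Fin S × Fin A) (ℓ : Option (Fin S) → ℝ≥0) : History S A → ℝ≥0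
  | [] => 1
  | (a, s) :: h => likelihood k ℓ h * if (M.currentState h, a) = k then ℓ s else 1

/-- The learner's choices are the same on both sides and cancel; the transition laws contribute a
factor `ℓ` at each play of `k` and nothing elsewhere. -/
theorem run_eq_likelihood_mul_run {M M' : SSP S A} (hi : M.init = M'.init) {k : Fin S × Fin A}
    {ℓ : Option (Fin S) → ℝ≥0} (hk : ∀ o, M.trans k.1 k.2 o = ℓ o * M'.trans k.1 k.2 o)
    (hne : ∀ x a, (x, a) ≠ k → M.trans x a = M'.trans x a)
    (d : History S A → Fin A ⊕ MarkovPolicy S A) (n : ℕ) (h' : History S A) :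
    M.run d n h' = M.likelihood k ℓ h' * M'.run d n h' := by
  induction n generalizing h' with
  | zero =>
    by_cases h0 : h' = []
    · simp [run, h0, likelihood]
    · simp [run, h0]
  | succ n ih =>
    rw [run_succ, run_succ, PMF.bind_apply, PMF.bind_apply, ← ENNReal.tsum_mul_left]
    refine tsum_congr fun h => ?_
    rw [ih h]
    have key : M.likelihood k ℓ h * M.stepLaw d h h' = M.likelihood k ℓ h' * M'.stepLaw d h h' := by
      rcases hd : d h with a | π
      · rw [stepLaw_inl M hd, stepLaw_inl M' hd, PMF.map_apply, PMF.map_apply,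
          ← ENNReal.tsum_mul_left, ← ENNReal.tsum_mul_left, ← currentState_congr hi]
        refine tsum_congr fun s => ?_
        split_ifs with hs
        · rw [hs]
          by_cases hx : (M.currentState h, a) = k
          · subst hx
            simp [likelihood, hk s, mul_assoc]
          · rw [hne _ _ hx]
            simp [likelihood, hx]
        · simp
      · rw [stepLaw_inr M hd, stepLaw_inr M' hd]
        by_cases hh : h' = h
        · rw [hh]
        · simp [hh]
    calc _ = M'.run d n h * (M.likelihood k ℓ h * M.stepLaw d h h') := by ring
      _ = _ := by rw [key]; ring

/-- Supermartingale bound with drift `e` per sample. A learner that has stopped stays put, which is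
harmless. -/
theorem tsum_run_mul_le_of_step {f : History S A → ℝ≥0∞} (d : History S A → Fin A ⊕ MarkovPolicy S A)
    {e : ℝ≥0∞} (hstep : ∀ h a, ∑' o, M.trans (M.currentState h) a o * f ((a, o) :: h) ≤ f h + e)
    (n : ℕ) : ∑' h, M.run d n h * f h ≤ f [] + n * e := by
  induction n with
  | zero => simp only [run]; rw [PMF.tsum_pure_mul]; simp
  | succ n ih =>
    rw [run_succ, PMF.tsum_bind_mul]
    calc ∑' h, M.run d n h * ∑' h', M.stepLaw d h h' * f h'
        ≤ ∑' h, M.run d n h * (f h + e) := by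
          refine ENNReal.tsum_le_tsum fun h => ?_
          gcongr
          rcases hd : d h with a | π
          · rw [stepLaw_inl M hd, PMF.tsum_map_mul]
            exact hstep h a
          · rw [stepLaw_inr M hd, PMF.tsum_pure_mul]
            exact le_self_add
      _ = ∑' h, M.run d n h * f h + e := by
          simp only [mul_add]
          rw [ENNReal.tsum_add, ENNReal.tsum_mul_right, PMF.tsum_coe, one_mul]
      _ ≤ f [] + n * e + e := by gcongr
      _ = f [] + (n + 1 : ℕ) * e := by push_cast; ring

/-- Histories are drawn from the numerator law, under which a likelihood ratio tends to grow.
Discounting each play of `k` by `r`, the inverse of a bound on the one-step mean, gives a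
supermartingale; its mean encodes a second moment under the other law. -/
theorem tsum_run_mul_likelihood_le_one {k : Fin S × Fin A} {ℓ : Option (Fin S) → ℝ≥0} {r : ℝ≥0∞}
    (hr : ∑' o, M.trans k.1 k.2 o * (ℓ o * r) ≤ 1)
    (d : History S A → Fin A ⊕ MarkovPolicy S A) (n : ℕ) :
    ∑' h, M.run d n h * (M.likelihood k ℓ h * r ^ M.playCount k h) ≤ 1 := by
  have := M.tsum_run_mul_le_of_step (f := fun h => M.likelihood k ℓ h * r ^ M.playCount k h) d
    (e := 0) (fun h a => ?_) n
  · simpa [likelihood, playCount] using this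
  · rw [add_zero]
    by_cases hx : (M.currentState h, a) = k
    · subst hx
      calc _ = ∑' o, M.likelihood (M.currentState h, a) ℓ h *
              r ^ M.playCount (M.currentState h, a) h *
              (M.trans (M.currentState h) a o * (ℓ o * r)) := by
            refine tsum_congr fun o => ?_
            simp only [likelihood, playCount, if_true, ENNReal.coe_mul, pow_succ]
            ring
        _ ≤ _ := by
            rw [ENNReal.tsum_mul_left]
            exact mul_le_of_le_one_right' hr
    · refine PMF.tsum_mul_le _ fun o => ?_
      simp [likelihood, playCount, hx]

/-- A sample plays one pair only, and by injectivity this pair belongs to at most one index. -/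
theorem sum_tsum_run_mul_playCount_le {K : Type*} [Fintype K] {pr : K → Fin S × Fin A}
    (hpr : Function.Injective pr) (d : History S A → Fin A ⊕ MarkovPolicy S A) (n : ℕ) :
    ∑ k, ∑' h, M.run d n h * M.playCount (pr k) h ≤ n := by
  classical
  rw [← Summable.tsum_finsetSum fun _ _ => ENNReal.summable]
  simp only [← Finset.mul_sum]
  have := M.tsum_run_mul_le_of_step (f := fun h => ∑ k, (M.playCount (pr k) h : ℝ≥0∞)) d
    (e := 1) (fun h a => ?_) n
  · simpa [playCount] using this
  · refine PMF.tsum_mul_le _ fun o => ?_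
    simp only [playCount, Nat.cast_add, Finset.sum_add_distrib]
    gcongr
    rw [← Nat.cast_sum, ← Nat.cast_one (R := ℝ≥0∞)]
    refine Nat.cast_le.2 ?_
    simp only [Finset.sum_boole, Nat.cast_id]
    refine Finset.card_le_one.2 fun k hk k' hk' => hpr ?_
    simp only [Finset.mem_filter, Finset.mem_univ, true_and] at hk hk'
    rw [← hk, ← hk']

/-- Change of measure: bad outputs under `M` are not much more likely than under `M'`, unless the
pair `k` in which the instances differ is played more than `m` times. -/
theorem stopMass_le_of_likelihood {M M' : SSP S A} (hi : M.init = M'.init) {k : Fin S × Fin A}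
    {ℓ : Option (Fin S) → ℝ≥0} (hk : ∀ o, M.trans k.1 k.2 o = ℓ o * M'.trans k.1 k.2 o)
    (hne : ∀ x a, (x, a) ≠ k → M.trans x a = M'.trans x a) {r : ℝ≥0∞}
    (hr : ∑' o, M.trans k.1 k.2 o * (ℓ o * r) ≤ 1) {α β R m : ℝ≥0∞} (hm : m ≠ 0) (hm' : m ≠ ⊤)
    (hαβ : ∀ L : ℝ≥0, (L : ℝ≥0∞) ≤ α * L * L + β)
    (hR : ∀ j : ℕ, (j : ℝ≥0∞) ≤ m → 1 ≤ R * r ^ j)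
    (d : History S A → Fin A ⊕ MarkovPolicy S A) (n : ℕ) (G : Set (MarkovPolicy S A)) :
    M.stopMass d n G ≤ α * R + (∑' h, M.run d n h * M.playCount k h) / m +
      β * M'.stopMass d n G := by
  have point : ∀ h, M.run d n h * stopInd d G h ≤
      α * R * (M.run d n h * (M.likelihood k ℓ h * r ^ M.playCount k h)) +
      M.run d n h * M.playCount k h * m⁻¹ + β * (M'.run d n h * stopInd d G h) := by
    intro h
    by_cases hG : stopInd d G h = 0
    · simp [hG]
    have hG1 : stopInd d G h = 1 := by
      unfold stopInd at hG ⊢; split_ifs at hG ⊢ <;> simp_all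
    rw [hG1, mul_one, mul_one]
    rcases le_or_gt (M.playCount k h : ℝ≥0∞) m with hle | hlt
    -- Few plays: of the two factors in the square, one turns the law under `M'` back into the law
    -- under `M`, and the other has bounded discounted mean.
    · calc M.run d n h = M.likelihood k ℓ h * M'.run d n h :=
            run_eq_likelihood_mul_run hi hk hne d n h
        _ ≤ (α * M.likelihood k ℓ h * M.likelihood k ℓ h + β) * M'.run d n h := by
            gcongr; exact hαβ _
        _ = α * (1 * ((M.likelihood k ℓ h * M'.run d n h) * M.likelihood k ℓ h)) +
            β * M'.run d n h := by ring
        _ ≤ α * (R * r ^ M.playCount k h * (M.run d n h * M.likelihood k ℓ h)) +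
            β * M'.run d n h := by
            rw [← run_eq_likelihood_mul_run hi hk hne d n h]
            gcongr
            exact hR _ hle
        _ = α * R * (M.run d n h * (M.likelihood k ℓ h * r ^ M.playCount k h)) +
            β * M'.run d n h := by ring
        _ ≤ _ := by gcongr; exact le_self_add
    -- Many plays: Markov's inequality for the play count.
    · calc M.run d n h = M.run d n h * 1 := (mul_one _).symm
        _ ≤ M.run d n h * (M.playCount k h * m⁻¹) := by
            gcongr
            rw [← ENNReal.mul_inv_cancel hm hm']
            gcongr
        _ = M.run d n h * M.playCount k h * m⁻¹ := by ring
        _ ≤ _ := le_add_right le_add_self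
  calc M.stopMass d n G ≤ ∑' h, (α * R * (M.run d n h * (M.likelihood k ℓ h * r ^ M.playCount k h)) +
      M.run d n h * M.playCount k h * m⁻¹ + β * (M'.run d n h * stopInd d G h)) :=
        ENNReal.tsum_le_tsum point
    _ = α * R * ∑' h, (M.run d n h * (M.likelihood k ℓ h * r ^ M.playCount k h)) +
        (∑' h, M.run d n h * M.playCount k h) / m + β * M'.stopMass d n G := by
        rw [ENNReal.tsum_add, ENNReal.tsum_add, ENNReal.tsum_mul_left, ENNReal.tsum_mul_left,
          ENNReal.tsum_mul_right, ENNReal.div_eq_inv_mul, mul_comm m⁻¹]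
        rfl
    _ ≤ _ := by
        gcongr ?_ + _ + _
        exact mul_le_of_le_one_right' (M.tsum_run_mul_likelihood_le_one hr d n)

end SSP
end

/-! ### Rare exits from a free loop: infinite sample complexity -/

noncomputable section

theorem twoPoint_zero {α : Type*} [Fintype α] [DecidableEq α] (x y : α) :
    twoPoint 0 x y = PMF.pure y := by
  ext o
  rw [twoPoint_apply, PMF.pure_apply]
  split_ifs <;> simp_all

theorem one_sub_mul_pure_le_twoPoint {α : Type*} [Fintype α] [DecidableEq α] {p : ℝ≥0} (hp : p ≤ 1)
    (x y o : α) : ((1 - p : ℝ≥0) : ℝ≥0∞) * PMF.pure y o ≤ twoPoint p x y o := by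
  rw [twoPoint_apply, min_eq_left hp, PMF.pure_apply]
  by_cases h : o = y
  · simp [h]
  · simp [h]

theorem IsLeast.of_le_of_mem {S A : ℕ} {M : SSP S A} {c : ℝ≥0} (h : ∀ x a, c ≤ M.cost x a)
    (x : Fin S) (a : Fin A) (hx : M.cost x a = c) : IsLeast {c | ∃ s a, M.cost s a = c} c :=
  ⟨⟨x, a, hx⟩, by rintro _ ⟨s, a, rfl⟩; exact h s a⟩

theorem delta_lt {δ : ℝ} (hδ : δ < 1 / (2 * Real.exp 4)) : δ < 1 / 12 := by
  refine hδ.trans_le ?_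
  have := Real.add_one_le_exp (4 : ℝ)
  have h2 : (1 + 4 / 2 : ℝ) ^ 2 ≤ Real.exp 4 := by
    have h := Real.add_one_le_exp (2 : ℝ)
    have : Real.exp 4 = Real.exp 2 ^ 2 := by rw [← Real.exp_nat_mul]; norm_num
    rw [this]; gcongr; linarith
  gcongr
  linarith

namespace SSP

variable {S A : ℕ}

theorem occ_le_occ {M M' : SSP S A} (h : ∀ x a y, M.trans x a (some y) ≤ M'.trans x a (some y))
    (π : MarkovPolicy S A) (s : Fin S) (t : ℕ) (x : Fin S) : M.occ π s t x ≤ M'.occ π s t x := by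
  induction t generalizing x with
  | zero => exact le_rfl
  | succ t ih =>
    simp only [occ]
    gcongr with y _ a
    · exact ih y
    · exact h y a x

/-- Reward is collected at non-goal states only, so it suffices to compare the transitions into
these. -/
theorem total_le_total {M M' : SSP S A} (h : ∀ x a y, M.trans x a (some y) ≤ M'.trans x a (some y))
    (π : MarkovPolicy S A) (s : Fin S) (r : Fin S → Fin A → ℝ≥0∞) :
    M.total π s r ≤ M'.total π s r := by
  refine ENNReal.tsum_le_tsum fun t => ?_
  gcongr with x _ a
  exact occ_le_occ h π s t x

/-- By Bernoulli's inequality (1 - p)^n ≥ 1 - np ≥ 1/2, so each history keeps at least half of its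
probability. -/
theorem stopMass_le_two_mul {M M' : SSP S A} (hi : M.init = M'.init) {R : Set (Fin S)}
    (hinit : M.init ∈ R) (hR : ∀ x ∈ R, ∀ a y, M.trans x a (some y) ≠ 0 → y ∈ R)
    {p : ℝ≥0} {n : ℕ} (hp : p ≤ 1) (hn : (n : ℝ) * p ≤ 1 / 2)
    (hdom : ∀ x ∈ R, ∀ a o, ((1 - p : ℝ≥0) : ℝ≥0∞) * M.trans x a o ≤ M'.trans x a o)
    (d : History S A → Fin A ⊕ MarkovPolicy S A) (G : Set (MarkovPolicy S A)) :
    M.stopMass d n G ≤ 2 * M'.stopMass d n G := by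
  have hθ : (1 : ℝ≥0∞) ≤ 2 * ((1 - p : ℝ≥0) : ℝ≥0∞) ^ n := by
    have h1 : (1 : ℝ≥0) ≤ 2 * (1 - p) ^ n := by
      rw [← NNReal.coe_le_coe]
      push_cast [NNReal.coe_sub hp]
      have := one_add_mul_le_pow (a := -(p : ℝ)) (by have : (p : ℝ) ≤ 1 := by exact_mod_cast hp
                                                     linarith) n
      rw [← sub_eq_add_neg] at this
      linarith
    exact_mod_cast h1
  unfold stopMass
  rw [← ENNReal.tsum_mul_left]
  refine ENNReal.tsum_le_tsum fun h => ?_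
  rw [← mul_assoc]
  gcongr
  calc M.run d n h ≤ (2 * ((1 - p : ℝ≥0) : ℝ≥0∞) ^ n) * M.run d n h := le_mul_of_one_le_left' hθ
    _ = 2 * (((1 - p : ℝ≥0) : ℝ≥0∞) ^ n * M.run d n h) := by ring
    _ ≤ _ := by
      gcongr
      exact pow_mul_run_le_run hi hinit hR (by exact_mod_cast tsub_le_self) hdom d n h

/-- In the initial state `0`, action `1` is free and leads to `o` with probability `ρ`, and otherwise
nowhere; actions other than `0` and `1` lead to the goal at cost one. In all other
states it takes `B` steps of cost one on average to reach the goal. -/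
def loopInstance (s b : ℕ) (B J ρ : ℝ≥0) (o : Option (Fin (s + 4))) : SSP (s + 4) (b + 4) where
  cost x a := if a = 0 then J else if x = 0 ∧ a = 1 then 0 else 1
  trans x a :=
    if a = 0 then PMF.pure none
    else if x = 0 then if a = 1 then twoPoint ρ o (some 0) else PMF.pure none
    else twoPoint B⁻¹ none (some x)
  init := 0

section loopInstance

variable {s b : ℕ} {B J ρ : ℝ≥0} {o : Option (Fin (s + 4))}

theorem loopInstance_cost_terminal (x : Fin (s + 4)) :
    (loopInstance s b B J ρ o).cost x 0 = J := by simp [loopInstance]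

theorem loopInstance_cost_loop : (loopInstance s b B J ρ o).cost 0 1 = 0 := by simp [loopInstance]

theorem loopInstance_cost_exit {a : Fin (b + 4)} (h0 : a ≠ 0) (h1 : a ≠ 1) (x : Fin (s + 4)) :
    (loopInstance s b B J ρ o).cost x a = 1 := by simp [loopInstance, h0, h1]

theorem loopInstance_cost_slow {a : Fin (b + 4)} (h0 : a ≠ 0) {x : Fin (s + 4)} (hx : x ≠ 0) :
    (loopInstance s b B J ρ o).cost x a = 1 := by simp [loopInstance, h0, hx]

theorem loopInstance_nextR_terminal (x : Fin (s + 4)) (φ : Fin (s + 4) → ℝ) :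
    (loopInstance s b B J ρ o).nextR x 0 φ = 0 :=
  nextR_of_trans_eq_pure _ (o := none) (by simp [loopInstance]) φ

theorem loopInstance_nextR_loop (hρ : ρ ≤ 1) (φ : Fin (s + 4) → ℝ) :
    (loopInstance s b B J ρ o).nextR 0 1 φ = ρ * o.elim 0 φ + (1 - ρ) * φ 0 :=
  nextR_of_trans_eq_twoPoint _ (o := o) (o' := some 0) hρ (by simp [loopInstance]) φ

theorem loopInstance_nextR_exit {a : Fin (b + 4)} (h0 : a ≠ 0) (h1 : a ≠ 1)
    (φ : Fin (s + 4) → ℝ) : (loopInstance s b B J ρ o).nextR 0 a φ = 0 :=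
  nextR_of_trans_eq_pure _ (o := none) (by simp [loopInstance, h0, h1]) φ

theorem loopInstance_nextR_slow (hB : 1 ≤ B) {a : Fin (b + 4)} (h0 : a ≠ 0) {x : Fin (s + 4)}
    (hx : x ≠ 0) (φ : Fin (s + 4) → ℝ) :
    (loopInstance s b B J ρ o).nextR x a φ = (1 - (B : ℝ)⁻¹) * φ x := by
  have := nextR_of_trans_eq_twoPoint (loopInstance s b B J ρ o) (o := none) (o' := some x)
    (x := x) (a := a) (inv_le_one_of_one_le₀ hB) (by simp [loopInstance, h0, hx]) φ
  simpa using this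

theorem loopInstance_hasTerminalAction : (loopInstance s b B J ρ o).HasTerminalAction J := by
  refine ⟨0, fun x => by simp [loopInstance], fun x a ha => ?_⟩
  simp only [loopInstance, ha, if_false]
  split_ifs <;> simp

theorem loopInstance_isLeast :
    IsLeast {c | ∃ x a, (loopInstance s b B J ρ o).cost x a = c} 0 :=
  IsLeast.of_le_of_mem (fun _ _ => zero_le) 0 1 loopInstance_cost_loop

/-- Leaving through action `2` at cost one beats the trap of cost B. The case `ρ = 0` is included
and serves as the base instance. The slow states keep `Bstar` at B. -/
theorem loopInstance_hasParameters_of_trap (hB : 2 ≤ B) (hJ : 3 * B ≤ J) (hρ : ρ ≤ 1) :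
    (loopInstance s b B J ρ (some 1)).HasParameters 0 B J ⊤ ∧
      (loopInstance s b B J ρ (some 1)).optValue 0 = 1 := by
  have hB' : (2 : ℝ) ≤ B := by exact_mod_cast hB
  have hJ' : 3 * (B : ℝ) ≤ J := by exact_mod_cast hJ
  have hρ' : (ρ : ℝ) ≤ 1 := by exact_mod_cast hρ
  have hB1 : (1 : ℝ≥0) ≤ B := le_trans (by norm_num) hB
  have e : (B : ℝ)⁻¹ * B = 1 := inv_mul_cancel₀ (by linarith)
  have h2 : (2 : Fin (b + 4)) ≠ 0 := by simp [Fin.ext_iff, Nat.mod_eq_of_lt]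
  have h21 : (2 : Fin (b + 4)) ≠ 1 := by simp [Fin.ext_iff, Nat.mod_eq_of_lt]
  have h := hasParameters_of_bellman (loopInstance s b B J ρ (some 1)) (cmin := 0) (B := B)
    (Tbar := ⊤) loopInstance_hasTerminalAction loopInstance_isLeast (fun _ => 2)
    (w := fun x => if x = 0 then 1 else B) (u := fun x => if x = 0 then 1 else B)
    (fun x => by split_ifs <;> linarith) (fun x => by split_ifs <;> linarith)
    (fun x a => ?_) (fun x => ?_) (fun x => ?_) ⟨1, ?_⟩
    (fun x => by split_ifs <;> linarith) (fun _ => le_top)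
  · refine ⟨h.1, ?_⟩
    rw [h.2]; simp
  · by_cases ha : a = 0
    · subst ha
      rw [loopInstance_cost_terminal, loopInstance_nextR_terminal]
      split_ifs <;> linarith
    by_cases hx : x = 0
    · subst hx
      by_cases h1 : a = 1
      · subst h1
        rw [loopInstance_cost_loop, loopInstance_nextR_loop hρ]
        simp only [Option.elim, if_true, Fin.one_eq_zero_iff, if_neg (show ¬ (s + 4 = 1) by omega),
          NNReal.coe_zero]
        nlinarith [ρ.coe_nonneg]
      · rw [loopInstance_cost_exit ha h1, loopInstance_nextR_exit ha h1]
        simp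
    · rw [loopInstance_cost_slow ha hx, loopInstance_nextR_slow hB1 ha hx]
      simp only [hx, if_false, NNReal.coe_one]
      linarith
  · by_cases hx : x = 0
    · subst hx
      rw [loopInstance_cost_exit h2 h21, loopInstance_nextR_exit h2 h21]
      simp
    · rw [loopInstance_cost_slow h2 hx, loopInstance_nextR_slow hB1 h2 hx]
      simp only [hx, if_false, NNReal.coe_one]
      linarith
  · by_cases hx : x = 0
    · subst hx
      rw [loopInstance_nextR_exit h2 h21]
      simp
    · rw [loopInstance_nextR_slow hB1 h2 hx]
      simp only [hx, if_false]
      linarith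
  · simp only [Fin.one_eq_zero_iff, if_neg (show ¬ (s + 4 = 1) by omega)]
    linarith

theorem loopInstance_hasParameters_of_goal (hB : 2 ≤ B) (hJ : 3 * B ≤ J) (hρ : ρ ≤ 1)
    (hρ0 : 0 < ρ) :
    (loopInstance s b B J ρ none).HasParameters 0 B J ⊤ ∧
      (loopInstance s b B J ρ none).optValue 0 = 0 := by
  have hB' : (2 : ℝ) ≤ B := by exact_mod_cast hB
  have hJ' : 3 * (B : ℝ) ≤ J := by exact_mod_cast hJ
  have hρ0' : 0 < (ρ : ℝ) := by exact_mod_cast hρ0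
  have hB1 : (1 : ℝ≥0) ≤ B := le_trans (by norm_num) hB
  have e : (B : ℝ)⁻¹ * B = 1 := inv_mul_cancel₀ (by linarith)
  have e2 : (ρ : ℝ) * (ρ : ℝ)⁻¹ = 1 := mul_inv_cancel₀ hρ0'.ne'
  have h1 : (1 : Fin (b + 4)) ≠ 0 := by simp
  have h := hasParameters_of_bellman (loopInstance s b B J ρ none) (cmin := 0) (B := B)
    (Tbar := ⊤) loopInstance_hasTerminalAction loopInstance_isLeast (fun _ => 1)
    (w := fun x => if x = 0 then 0 else B) (u := fun x => if x = 0 then (ρ : ℝ)⁻¹ else B)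
    (fun x => by split_ifs <;> linarith)
    (fun x => by split_ifs <;> positivity)
    (fun x a => ?_) (fun x => ?_) (fun x => ?_) ⟨1, ?_⟩
    (fun x => by split_ifs <;> linarith) (fun _ => le_top)
  · refine ⟨h.1, ?_⟩
    rw [h.2]; simp
  · by_cases hx : x = 0
    · subst hx
      simp only [if_true]
      exact add_nonneg (NNReal.coe_nonneg _)
        (nextR_nonneg _ _ _ fun x => by split_ifs <;> linarith)
    by_cases ha : a = 0
    · subst ha
      rw [loopInstance_cost_terminal, loopInstance_nextR_terminal]
      split_ifs; linarith
    · rw [loopInstance_cost_slow ha hx, loopInstance_nextR_slow hB1 ha hx]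
      simp only [hx, if_false, NNReal.coe_one]
      linarith
  · by_cases hx : x = 0
    · subst hx
      rw [loopInstance_cost_loop, loopInstance_nextR_loop hρ]
      simp
    · rw [loopInstance_cost_slow h1 hx, loopInstance_nextR_slow hB1 h1 hx]
      simp only [hx, if_false, NNReal.coe_one]
      linarith
  · by_cases hx : x = 0
    · subst hx
      rw [loopInstance_nextR_loop hρ]
      simp only [Option.elim, if_true]
      linarith
    · rw [loopInstance_nextR_slow hB1 h1 hx]
      simp only [hx, if_false]
      linarith
  · simp only [Fin.one_eq_zero_iff, if_neg (show ¬ (s + 4 = 1) by omega)]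
    linarith

/-- With ρ > 0 no action can be repeated forever, so even the worst policy needs about 1 / ρ + B
steps. -/
theorem loopInstance_hittingTime_lt_top (hB : 1 ≤ B) (hρ : ρ ≤ 1) (hρ0 : 0 < ρ)
    (ho : o ≠ some 0) (π : MarkovPolicy (s + 4) (b + 4)) (x : Fin (s + 4)) :
    (loopInstance s b B J ρ o).hittingTime π x < ⊤ := by
  have hB' : (1 : ℝ) ≤ B := by exact_mod_cast hB
  have hρ' : (ρ : ℝ) ≤ 1 := by exact_mod_cast hρ
  have hρ0' : 0 < (ρ : ℝ) := by exact_mod_cast hρ0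
  have e : (B : ℝ)⁻¹ * B = 1 := inv_mul_cancel₀ (by linarith)
  have e2 : (ρ : ℝ) * (ρ : ℝ)⁻¹ = 1 := mul_inv_cancel₀ hρ0'.ne'
  have e3 : 0 < (ρ : ℝ)⁻¹ := inv_pos.2 hρ0'
  refine lt_of_le_of_lt (hittingTime_le_of_bellman _
    (u := fun x => if x = 0 then (ρ : ℝ)⁻¹ + B else B) (fun x => by split_ifs <;> positivity)
    (fun x a => ?_) π x) ENNReal.ofReal_lt_top
  by_cases ha : a = 0
  · subst ha
    rw [loopInstance_nextR_terminal]
    split_ifs <;> linarith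
  by_cases hx : x = 0
  · subst hx
    by_cases h1 : a = 1
    · subst h1
      rw [loopInstance_nextR_loop hρ]
      have : o.elim 0 (fun x => if x = 0 then (ρ : ℝ)⁻¹ + B else B) ≤ B := by
        rcases o with _ | x
        · simp
        · have : x ≠ 0 := fun h => ho (by rw [h])
          simp [this]
      simp only [if_true]
      nlinarith
    · rw [loopInstance_nextR_exit ha h1]
      simp only [if_true]; linarith
  · rw [loopInstance_nextR_slow hB ha hx]
    simp only [hx, if_false]
    linarith

/-- No policy has both a small cost when the free action leads to a trap and a small cost when it
leads to the goal. -/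
theorem two_le_value_add_value (hB : 2 ≤ B) (hJ : 3 * B ≤ J) (hρ : ρ ≤ 1) (hρ0 : 0 < ρ)
    (π : MarkovPolicy (s + 4) (b + 4)) :
    2 ≤ (loopInstance s b B J ρ (some 1)).value π 0 + (loopInstance s b B J ρ none).value π 0 := by
  have hB' : (2 : ℝ) ≤ B := by exact_mod_cast hB
  have hJ' : 3 * (B : ℝ) ≤ J := by exact_mod_cast hJ
  have hρ' : (ρ : ℝ) ≤ 1 := by exact_mod_cast hρ
  have hB1 : (1 : ℝ≥0) ≤ B := le_trans (by norm_num) hB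
  have e : (B : ℝ)⁻¹ * B = 1 := inv_mul_cancel₀ (by linarith)
  -- `g` is the chance that a step leaves through the free action. Against the potential `φ` such an
  -- exit loses at least B - 1 ≥ 1 in the trap instance and gains 1 in the goal instance. The two
  -- effects cancel in the sum, which leaves 2 φ(0) = 2.
  set g : Fin (s + 4) → Fin (b + 4) → ℝ := fun x a => if x = 0 ∧ a = 1 then ρ else 0 with hg
  set φ : Fin (s + 4) → ℝ := fun x => if x = 0 then 1 else B with hφ
  have hg0 : ∀ x a, 0 ≤ g x a := fun x a => by simp only [hg]; split_ifs <;> simp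
  have hφ0 : ∀ x, 0 ≤ φ x := fun x => by simp only [hφ]; split_ifs <;> linarith
  have i1 := le_total_of_bellman (loopInstance s b B J ρ (some 1)) (π := π) (s := 0)
    (g := fun x a => ENNReal.ofReal (g x a)) (e := fun _ _ => 0)
    (r := fun x a => ((loopInstance s b B J ρ (some 1)).cost x a : ℝ≥0∞))
    (φ := fun x => ENNReal.ofReal (φ x))
    (loopInstance_hittingTime_lt_top hB1 hρ hρ0 (by simp) π 0) (fun _ => ENNReal.ofReal_ne_top)
    (fun x a => by
      rw [nextE_ofReal _ x a hφ0, add_zero, ← ENNReal.ofReal_coe_nnreal,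
        ← ENNReal.ofReal_add (hφ0 x) (hg0 x a),
        ← ENNReal.ofReal_add (NNReal.coe_nonneg _) (nextR_nonneg _ x a hφ0)]
      apply ENNReal.ofReal_le_ofReal
      by_cases ha : a = 0
      · subst ha
        rw [loopInstance_cost_terminal, loopInstance_nextR_terminal]
        simp only [hφ, hg, Fin.zero_eq_one_iff, if_neg (show ¬ (x = 0 ∧ b + 4 = 1) by omega)]
        split_ifs <;> linarith
      by_cases hx : x = 0
      · subst hx
        by_cases h1 : a = 1
        · subst h1
          rw [loopInstance_cost_loop, loopInstance_nextR_loop hρ]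
          simp only [hφ, hg, Option.elim, if_true, Fin.one_eq_zero_iff,
            if_neg (show ¬ (s + 4 = 1) by omega), NNReal.coe_zero, and_self]
          nlinarith [ρ.coe_nonneg]
        · rw [loopInstance_cost_exit ha h1, loopInstance_nextR_exit ha h1]
          simp [hφ, hg, h1]
      · rw [loopInstance_cost_slow ha hx, loopInstance_nextR_slow hB1 ha hx]
        simp only [hφ, hg, hx, if_false, NNReal.coe_one, false_and]
        linarith)
  have i2 := le_total_of_bellman (loopInstance s b B J ρ none) (π := π) (s := 0)
    (g := fun _ _ => 0) (e := fun x a => ENNReal.ofReal (g x a))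
    (r := fun x a => ((loopInstance s b B J ρ none).cost x a : ℝ≥0∞))
    (φ := fun x => ENNReal.ofReal (φ x))
    (loopInstance_hittingTime_lt_top hB1 hρ hρ0 (by simp) π 0) (fun _ => ENNReal.ofReal_ne_top)
    (fun x a => by
      rw [nextE_ofReal _ x a hφ0, add_zero, ← ENNReal.ofReal_coe_nnreal,
        ← ENNReal.ofReal_add (NNReal.coe_nonneg _) (hg0 x a),
        ← ENNReal.ofReal_add (add_nonneg (NNReal.coe_nonneg _) (hg0 x a)) (nextR_nonneg _ x a hφ0)]
      apply ENNReal.ofReal_le_ofReal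
      by_cases ha : a = 0
      · subst ha
        rw [loopInstance_cost_terminal, loopInstance_nextR_terminal]
        have := hg0 x 0
        simp only [hφ]
        split_ifs <;> linarith
      by_cases hx : x = 0
      · subst hx
        by_cases h1 : a = 1
        · subst h1
          rw [loopInstance_cost_loop, loopInstance_nextR_loop hρ]
          simp [hφ, hg]
        · rw [loopInstance_cost_exit ha h1, loopInstance_nextR_exit ha h1]
          simp [hφ, hg, h1]
      · rw [loopInstance_cost_slow ha hx, loopInstance_nextR_slow hB1 ha hx]
        simp only [hφ, hg, hx, if_false, NNReal.coe_one, false_and]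
        linarith)
  have h0 : (loopInstance s b B J ρ none).total π 0 (fun _ _ => 0) = 0 := by simp [total]
  have h0' : (loopInstance s b B J ρ (some 1)).total π 0 (fun _ _ => 0) = 0 := by simp [total]
  have hφ1 : ENNReal.ofReal (φ 0) = 1 := by simp [hφ]
  rw [h0, hφ1, add_zero] at i2
  rw [h0', hφ1, add_zero] at i1
  have hmono : (loopInstance s b B J ρ none).total π 0 (fun x a => ENNReal.ofReal (g x a)) ≤
      (loopInstance s b B J ρ (some 1)).total π 0 (fun x a => ENNReal.ofReal (g x a)) := by
    refine total_le_total (fun x a y => ?_) π 0 _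
    simp only [loopInstance]
    split_ifs <;> first | exact le_rfl | skip
    rw [twoPoint_apply, twoPoint_apply]
    gcongr
    simp
  rw [value_eq_total, value_eq_total]
  calc (2 : ℝ≥0∞) = 1 + 1 := by norm_num
    _ ≤ 1 + ((loopInstance s b B J ρ none).total π 0 (fun x a =>
          ((loopInstance s b B J ρ none).cost x a : ℝ≥0∞)) +
        (loopInstance s b B J ρ none).total π 0 (fun x a => ENNReal.ofReal (g x a))) := by gcongr
    _ ≤ (1 + (loopInstance s b B J ρ (some 1)).total π 0 (fun x a => ENNReal.ofReal (g x a))) +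
        (loopInstance s b B J ρ none).total π 0 (fun x a =>
          ((loopInstance s b B J ρ none).cost x a : ℝ≥0∞)) := by
        rw [add_comm (total _ _ _ _) (total _ _ _ _), ← add_assoc]; gcongr
    _ ≤ _ := by gcongr

end loopInstance

/-- Without a positive minimum cost and without a bound on hitting times, no finite number of samples
suffices on all instances. -/
theorem exists_sampleComplexity_eq_top {B J : ℝ≥0} {ε δ : ℝ} (hS : 4 ≤ S) (hA : 4 ≤ A) (hB : 2 ≤ B)
    (hJ : 3 * B ≤ J) (hε0 : 0 < ε) (hε : ε < 1 / 32) (hδ : δ < 1 / 12)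
    {Ω : Type*} [MeasurableSpace Ω] {alg : BPIAlgorithm S A Ω} {n : SSP S A → ℕ∞}
    (hn : alg.IsCorrect ε δ {M | M.HasParameters 0 B J ⊤} n) :
    ∃ M : SSP S A, M.HasParameters 0 B J ⊤ ∧ n M = ⊤ := by
  obtain ⟨s, rfl⟩ := Nat.exists_eq_add_of_le' hS
  obtain ⟨b, rfl⟩ := Nat.exists_eq_add_of_le' hA
  set M₀ := loopInstance s b B J 0 (some 1) with hM₀
  have hP₀ := (loopInstance_hasParameters_of_trap (s := s) (b := b) hB hJ (zero_le_one)).1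
  refine ⟨M₀, hP₀, ?_⟩
  by_contra htop
  obtain ⟨n₀, hn₀⟩ := ENat.ne_top_iff_exists.1 htop
  -- Chosen so that n₀ ρ ≤ 1/2; the added one covers n₀ = 0.
  obtain ⟨ρ, hρ⟩ : ∃ ρ : ℝ≥0, ρ = (2 * (n₀ + 1 : ℝ≥0))⁻¹ := ⟨_, rfl⟩
  have hρ0 : 0 < ρ := by rw [hρ]; positivity
  have hρn : (n₀ : ℝ) * ρ ≤ 1 / 2 := by
    rw [hρ]; push_cast
    rw [← div_eq_mul_inv, div_le_div_iff₀ (by positivity) (by norm_num)]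
    linarith
  have hρ1 : ρ ≤ 1 := by
    rw [hρ]
    refine inv_le_one_of_one_le₀ ?_
    have : (0 : ℝ≥0) ≤ n₀ := zero_le
    calc (1 : ℝ≥0) ≤ 2 * (0 + 1) := by norm_num
      _ ≤ _ := by gcongr
  set o : Bool → Option (Fin (s + 4)) := fun k => if k then some 1 else none with ho
  have hmem : ∀ k, (loopInstance s b B J ρ (o k)).HasParameters 0 B J ⊤ := by
    intro k
    cases k
    · exact (loopInstance_hasParameters_of_goal hB hJ hρ1 hρ0).1
    · exact (loopInstance_hasParameters_of_trap hB hJ hρ1).1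
  have key := card_mul_le_of_isCorrect alg (M₀ := M₀) (M₁ := fun k => loopInstance s b B J ρ (o k))
    (fun _ => rfl) (fun _ => rfl) (by rw [hn₀]; exact hn M₀ hP₀) (fun k => hn _ (hmem k))
    (c := 2) (g := 1) (β := 0) (fun π t ht => ?_) (fun d => ⟨fun _ => 0, by simp, fun k => ?_⟩)
  -- The averaged inequality reads 6(1 - δ) ≤ 5, against δ < 1/12.
  · rw [Fintype.card_bool, ENNReal.ofReal_eq_coe_nnreal (by linarith : 0 ≤ 1 - δ)] at key
    have key' : (2 : ℝ) * (1 - δ) + 2 * (2 * (1 - δ)) ≤ 1 + 0 + 2 * 2 := by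
      exact_mod_cast key
    linarith
  · have : t.card ≤ 1 := by
      by_contra hcard
      have htu : t = Finset.univ := by
        rw [← Finset.card_eq_iff_eq_univ, Fintype.card_bool]
        have := Finset.card_le_univ t
        rw [Fintype.card_bool] at this
        omega
      have v1 := ht true (by simp [htu])
      have v2 := ht false (by simp [htu])
      have w1 := (loopInstance_hasParameters_of_trap (s := s) (b := b) hB hJ hρ1).2
      have w2 := (loopInstance_hasParameters_of_goal (s := s) (b := b) hB hJ hρ1 hρ0).2
      have v3 := two_le_value_add_value (s := s) (b := b) hB hJ hρ1 hρ0 π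
      change (loopInstance s b B J ρ (some 1)).value π 0 ≤
        (loopInstance s b B J ρ (some 1)).optValue 0 + _ at v1
      change (loopInstance s b B J ρ none).value π 0 ≤
        (loopInstance s b B J ρ none).optValue 0 + _ at v2
      rw [w1] at v1
      rw [w2] at v2
      -- The optimal values are 1 and 0, so a policy good for both instances would give 2 ≤ 1 + 2ε.
      have v4 := v3.trans (add_le_add v1 v2)
      rw [ENNReal.ofReal_eq_coe_nnreal hε0.le] at v4
      have v5 : (2 : ℝ) ≤ (1 + ε) + (0 + ε) := by exact_mod_cast v4
      linarith
    exact_mod_cast this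
  · rw [zero_add]
    refine stopMass_le_two_mul (M := M₀) (M' := loopInstance s b B J ρ (o k)) rfl (R := Set.univ) (Set.mem_univ _) (fun _ _ _ _ _ => Set.mem_univ _)
      hρ1 hρn (fun x _ a z => ?_) d _
    have h1 : ((1 - ρ : ℝ≥0) : ℝ≥0∞) ≤ 1 := by exact_mod_cast tsub_le_self
    simp only [hM₀, loopInstance]
    split_ifs
    · exact mul_le_of_le_one_left' h1
    · rw [twoPoint_zero]
      exact one_sub_mul_pure_le_twoPoint hρ1 _ _ _
    · exact mul_le_of_le_one_left' h1
    · exact mul_le_of_le_one_left' h1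

end SSP
end

/-! ### The combination lock and its optimal values -/

noncomputable section

namespace SSP

/-- The state with index `i`. -/
def stateOf (s i : ℕ) : Fin (s + 4) := Fin.ofNat (s + 4) i

theorem stateOf_val {s i : ℕ} (h : i < s + 4) : (stateOf s i).val = i := by
  simp [stateOf, Nat.mod_eq_of_lt h]

theorem stateOf_coe {s : ℕ} (x : Fin (s + 4)) : stateOf s x.val = x :=
  Fin.ext (stateOf_val x.isLt)

/-- `a` is the action that the code `c` prescribes in the state with index `i`. -/
def IsRight {N b : ℕ} (c : Fin N → Fin (b + 3)) (i : ℕ) (a : Fin (b + 4)) : Prop :=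
  ∃ h : i - 1 < N, a = (c ⟨i - 1, h⟩).succ

open Classical in
/-- A combination lock: the initial state `0` leads with probability `p` to the state `1`, from where
the goal is reached through `2, …, N` by the actions that the code `c` prescribes, while any other
action leads back to `1`. From state `N + 1` it takes `B` steps on average to reach
the goal, and from the remaining states one step of cost `cmin`. -/
def lockInstance (s b N : ℕ) (cmin B J p : ℝ≥0) (c : Fin N → Fin (b + 3)) : SSP (s + 4) (b + 4) where
  cost x a := if a = 0 then J else if x.val ≤ N + 1 then 1 else cmin
  trans x a :=
    if a = 0 then PMF.pure none
    else if x.val = 0 then twoPoint p (some (stateOf s 1)) none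
    else if x.val ≤ N then
      PMF.pure (if IsRight c x.val a then (if x.val = N then none else some (stateOf s (x.val + 1)))
        else some (stateOf s 1))
    else if x.val = N + 1 then twoPoint B⁻¹ none (some x)
    else PMF.pure none
  init := 0

section lockInstance

variable {s b N : ℕ} {cmin B J p : ℝ≥0} {c : Fin N → Fin (b + 3)}

local notation "L" => lockInstance s b N cmin B J p c

theorem lockInstance_cost_terminal (x : Fin (s + 4)) : (L).cost x 0 = J := by
  simp [lockInstance]

theorem lockInstance_cost_unit {x : Fin (s + 4)} (hx : x.val ≤ N + 1) {a : Fin (b + 4)}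
    (ha : a ≠ 0) : (L).cost x a = 1 := by
  simp [lockInstance, ha, hx]

theorem lockInstance_cost_cheap {x : Fin (s + 4)} (hx : N + 1 < x.val) {a : Fin (b + 4)}
    (ha : a ≠ 0) : (L).cost x a = cmin := by
  simp [lockInstance, ha, not_le.2 hx]

theorem lockInstance_nextR_terminal (x : Fin (s + 4)) (φ : Fin (s + 4) → ℝ) :
    (L).nextR x 0 φ = 0 :=
  nextR_of_trans_eq_pure _ (o := none) (by simp [lockInstance]) φ

theorem lockInstance_nextR_init (hp : p ≤ 1) {x : Fin (s + 4)} (hx : x.val = 0) {a : Fin (b + 4)}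
    (ha : a ≠ 0) (φ : Fin (s + 4) → ℝ) : (L).nextR x a φ = p * φ (stateOf s 1) := by
  have := nextR_of_trans_eq_twoPoint (L) (x := x) (a := a) (o := some (stateOf s 1)) (o' := none) hp
    (by simp only [lockInstance]; rw [if_neg ha, if_pos hx]) φ
  simpa using this

theorem lockInstance_nextR_right {x : Fin (s + 4)} (hx : x.val ≠ 0) (hN : x.val < N)
    {a : Fin (b + 4)} (ha : IsRight c x.val a) (φ : Fin (s + 4) → ℝ) :
    (L).nextR x a φ = φ (stateOf s (x.val + 1)) := by
  have h0 : a ≠ 0 := by obtain ⟨h, rfl⟩ := ha; exact Fin.succ_ne_zero _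
  exact nextR_of_trans_eq_pure _ (o := some (stateOf s (x.val + 1)))
    (by simp only [lockInstance]; rw [if_neg h0, if_neg hx, if_pos hN.le, if_pos ha, if_neg hN.ne]) φ

theorem lockInstance_nextR_last {x : Fin (s + 4)} (hx : x.val ≠ 0) (hN : x.val = N)
    {a : Fin (b + 4)} (ha : IsRight c x.val a) (φ : Fin (s + 4) → ℝ) :
    (L).nextR x a φ = 0 := by
  have h0 : a ≠ 0 := by obtain ⟨h, rfl⟩ := ha; exact Fin.succ_ne_zero _
  exact nextR_of_trans_eq_pure _ (o := none)
    (by simp only [lockInstance]; rw [if_neg h0, if_neg hx, if_pos hN.le, if_pos ha, if_pos hN]) φ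

theorem lockInstance_nextR_wrong {x : Fin (s + 4)} (hx : x.val ≠ 0) (hN : x.val ≤ N)
    {a : Fin (b + 4)} (h0 : a ≠ 0) (ha : ¬ IsRight c x.val a) (φ : Fin (s + 4) → ℝ) :
    (L).nextR x a φ = φ (stateOf s 1) :=
  nextR_of_trans_eq_pure _ (o := some (stateOf s 1))
    (by simp only [lockInstance]; rw [if_neg h0, if_neg hx, if_pos hN, if_neg ha]) φ

theorem lockInstance_nextR_slow (hB : 1 ≤ B) {x : Fin (s + 4)} (hx : x.val = N + 1)
    {a : Fin (b + 4)} (ha : a ≠ 0) (φ : Fin (s + 4) → ℝ) :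
    (L).nextR x a φ = (1 - (B : ℝ)⁻¹) * φ x := by
  have := nextR_of_trans_eq_twoPoint (L) (x := x) (a := a) (o := none) (o' := some x)
    (inv_le_one_of_one_le₀ hB)
    (by simp only [lockInstance]
        rw [if_neg ha, if_neg (by omega), if_neg (by omega), if_pos hx]) φ
  simpa using this

theorem lockInstance_nextR_cheap {x : Fin (s + 4)} (hx : N + 1 < x.val) {a : Fin (b + 4)}
    (ha : a ≠ 0) (φ : Fin (s + 4) → ℝ) : (L).nextR x a φ = 0 :=
  nextR_of_trans_eq_pure _ (o := none)
    (by simp only [lockInstance]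
        rw [if_neg ha, if_neg (by omega), if_neg (by omega), if_neg (by omega)]) φ

/-- The optimal value in the lock, by state index. -/
def lockValue (N : ℕ) (cmin B p : ℝ) (i : ℕ) : ℝ :=
  if i = 0 then 1 + p * N else if i ≤ N then (N : ℝ) + 1 - i else if i = N + 1 then B else cmin

theorem lockValue_zero {cmin B p : ℝ} : lockValue N cmin B p 0 = 1 + p * N := by simp [lockValue]

theorem lockValue_lock {cmin B p : ℝ} {i : ℕ} (h0 : i ≠ 0) (hi : i ≤ N) :
    lockValue N cmin B p i = (N : ℝ) + 1 - i := by simp [lockValue, h0, hi]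

theorem lockValue_slow {cmin B p : ℝ} : lockValue N cmin B p (N + 1) = B := by
  simp [lockValue]

theorem lockValue_cheap {cmin B p : ℝ} {i : ℕ} (hi : N + 1 < i) :
    lockValue N cmin B p i = cmin := by
  simp only [lockValue]; rw [if_neg (by omega), if_neg (by omega), if_neg (by omega)]

open Classical in
theorem lockInstance_hasParameters (hN1 : 1 ≤ N) (hNs : N ≤ s + 1) (hNB : (N : ℝ) ≤ B) (hB : 2 ≤ B)
    (hJ : 3 * B ≤ J) (hp : p ≤ 1) (hc : cmin ≤ 1) {Tbar : ℝ≥0∞}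
    (hT : ENNReal.ofReal (2 * B) ≤ Tbar) :
    (L).HasParameters cmin B J Tbar ∧
      (L).optValue 0 = ENNReal.ofReal (1 + p * N) := by
  have hB' : (2 : ℝ) ≤ B := by exact_mod_cast hB
  have hJ' : 3 * (B : ℝ) ≤ J := by exact_mod_cast hJ
  have hp' : (p : ℝ) ≤ 1 := by exact_mod_cast hp
  have hp0 : (0 : ℝ) ≤ p := p.coe_nonneg
  have hc' : (cmin : ℝ) ≤ 1 := by exact_mod_cast hc
  have hc0 : (0 : ℝ) ≤ cmin := cmin.coe_nonneg
  have hN1' : (1 : ℝ) ≤ N := by exact_mod_cast hN1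
  have hB1 : (1 : ℝ≥0) ≤ B := le_trans (by norm_num) hB
  have hJ1 : (1 : ℝ≥0) ≤ J := by
    rw [← NNReal.coe_le_coe, NNReal.coe_one]; linarith
  have hpN : (p : ℝ) * N ≤ N := mul_le_of_le_one_left (by linarith) hp'
  have hpN0 : 0 ≤ (p : ℝ) * N := by positivity
  have e : (B : ℝ)⁻¹ * B = 1 := inv_mul_cancel₀ (by linarith)
  have v1 : (stateOf s 1).val = 1 := stateOf_val (by omega)
  have hwbound : ∀ {cm q : ℝ}, 0 ≤ cm → cm ≤ 1 → 0 ≤ q → q ≤ 1 → ∀ i,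
      0 ≤ lockValue N cm B q i ∧ lockValue N cm B q i ≤ 2 * B := by
    intro cm q h1 h2 h3 h4 i
    have h5 : q * N ≤ N := mul_le_of_le_one_left (by linarith) h4
    have h6 : 0 ≤ q * N := by positivity
    rcases Nat.eq_zero_or_pos i with rfl | h0
    · rw [lockValue_zero]; constructor <;> linarith
    rcases le_or_gt i N with h | h
    · rw [lockValue_lock h0.ne' h]
      have h7 : (i : ℝ) ≤ N := by exact_mod_cast h
      have h8 : (1 : ℝ) ≤ i := by exact_mod_cast h0
      constructor <;> linarith
    rcases eq_or_lt_of_le (Nat.succ_le_of_lt h) with h | h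
    · rw [← h, Nat.succ_eq_add_one, lockValue_slow]; constructor <;> linarith
    · rw [lockValue_cheap h]; constructor <;> linarith
  have hcases : ∀ x : Fin (s + 4), x.val = 0 ∨ (x.val ≠ 0 ∧ x.val < N) ∨ (x.val ≠ 0 ∧ x.val = N) ∨
      x.val = N + 1 ∨ N + 1 < x.val := fun x => by omega
  set f : Fin (s + 4) → Fin (b + 4) := fun x =>
    if h : x.val - 1 < N then (c ⟨x.val - 1, h⟩).succ else 1 with hf
  have hf0 : ∀ x, f x ≠ 0 := by
    intro x; simp only [hf]; split_ifs
    · exact Fin.succ_ne_zero _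
    · simp
  have hfR : ∀ x : Fin (s + 4), x.val ≠ 0 → x.val ≤ N → IsRight c x.val (f x) := by
    intro x h0 hx
    have h : x.val - 1 < N := by omega
    exact ⟨h, by simp only [hf, h, dif_pos]⟩
  have hterm : (L).HasTerminalAction J := by
    refine ⟨0, fun x => by simp [lockInstance], fun x a ha => ?_⟩
    simp only [lockInstance, ha, if_false]
    split_ifs
    · exact le_rfl
    · exact hc
  have hleast : IsLeast {c' | ∃ x a, (L).cost x a = c'} cmin := by
    -- State N + 2 exists because N ≤ S - 3; it is there only to attain the minimum cost.
    refine IsLeast.of_le_of_mem (fun x a => ?_) (stateOf s (N + 2)) 1 ?_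
    · simp only [lockInstance]
      split_ifs
      · exact hc.trans hJ1
      · exact hc
      · exact le_rfl
    · exact lockInstance_cost_cheap (by rw [stateOf_val (by omega)]; omega) (by simp)
  -- With unit step costs and certain entry into the lock, `lockValue` bounds the hitting times.
  have h := hasParameters_of_bellman (L) (Tbar := Tbar) (B := B) hterm hleast f
    (w := fun x => lockValue N cmin B p x.val) (u := fun x => lockValue N 1 B 1 x.val)
    (fun x => (hwbound hc0 hc' hp0 hp' _).1) (fun x => (hwbound zero_le_one le_rfl zero_le_one le_rfl _).1)
    (fun x a => ?_) (fun x => ?_) (fun x => ?_) ⟨stateOf s (N + 1), ?_⟩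
    (fun x => (hwbound hc0 hc' hp0 hp' _).2)
    (fun x => le_trans (ENNReal.ofReal_le_ofReal (hwbound zero_le_one le_rfl zero_le_one le_rfl _).2) hT)
  · refine ⟨h.1, ?_⟩
    rw [h.2]
    simp [lockValue_zero]
  · by_cases ha : a = 0
    · subst ha
      rw [lockInstance_cost_terminal, lockInstance_nextR_terminal]
      have := (hwbound hc0 hc' hp0 hp' x.val).2
      linarith
    rcases hcases x with hx | ⟨h0, hx⟩ | ⟨h0, hx⟩ | hx | hx
    · rw [lockInstance_cost_unit (by omega) ha, lockInstance_nextR_init hp hx ha, hx, v1,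
        lockValue_zero, lockValue_lock one_ne_zero hN1]
      push_cast
      linarith
    · by_cases hr : IsRight c x.val a
      · rw [lockInstance_cost_unit (by omega) ha, lockInstance_nextR_right h0 hx hr,
          lockValue_lock h0 hx.le, stateOf_val (by omega), lockValue_lock (by omega) hx]
        push_cast
        linarith
      · rw [lockInstance_cost_unit (by omega) ha, lockInstance_nextR_wrong h0 hx.le ha hr,
          lockValue_lock h0 hx.le, v1, lockValue_lock one_ne_zero hN1]
        push_cast
        linarith [(Nat.cast_nonneg x.val : (0 : ℝ) ≤ x.val)]
    · by_cases hr : IsRight c x.val a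
      · rw [lockInstance_cost_unit (by omega) ha, lockInstance_nextR_last h0 hx hr,
          lockValue_lock h0 hx.le, hx]
        push_cast
        linarith
      · rw [lockInstance_cost_unit (by omega) ha, lockInstance_nextR_wrong h0 hx.le ha hr,
          lockValue_lock h0 hx.le, v1, lockValue_lock one_ne_zero hN1]
        push_cast
        linarith [(Nat.cast_nonneg x.val : (0 : ℝ) ≤ x.val)]
    · rw [lockInstance_cost_unit (by omega) ha, lockInstance_nextR_slow hB1 hx ha, hx,
        lockValue_slow]
      push_cast
      linarith
    · rw [lockInstance_cost_cheap hx ha, lockInstance_nextR_cheap hx ha, lockValue_cheap hx]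
      linarith
  · rcases hcases x with hx | ⟨h0, hx⟩ | ⟨h0, hx⟩ | hx | hx
    · rw [lockInstance_cost_unit (by omega) (hf0 x), lockInstance_nextR_init hp hx (hf0 x), hx, v1,
        lockValue_zero, lockValue_lock one_ne_zero hN1]
      push_cast
      linarith
    · rw [lockInstance_cost_unit (by omega) (hf0 x),
        lockInstance_nextR_right h0 hx (hfR x h0 hx.le),
        lockValue_lock h0 hx.le, stateOf_val (by omega), lockValue_lock (by omega) hx]
      push_cast
      linarith
    · rw [lockInstance_cost_unit (by omega) (hf0 x),
        lockInstance_nextR_last h0 hx (hfR x h0 hx.le), lockValue_lock h0 hx.le, hx]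
      push_cast
      linarith
    · rw [lockInstance_cost_unit (by omega) (hf0 x), lockInstance_nextR_slow hB1 hx (hf0 x), hx,
        lockValue_slow]
      push_cast
      linarith
    · rw [lockInstance_cost_cheap hx (hf0 x), lockInstance_nextR_cheap hx (hf0 x),
        lockValue_cheap hx]
      linarith
  · rcases hcases x with hx | ⟨h0, hx⟩ | ⟨h0, hx⟩ | hx | hx
    · rw [lockInstance_nextR_init hp hx (hf0 x), hx, v1,
        lockValue_zero, lockValue_lock one_ne_zero hN1]
      push_cast
      linarith
    · rw [lockInstance_nextR_right h0 hx (hfR x h0 hx.le),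
        lockValue_lock h0 hx.le, stateOf_val (by omega), lockValue_lock (by omega) hx]
      push_cast
      linarith
    · rw [lockInstance_nextR_last h0 hx (hfR x h0 hx.le), lockValue_lock h0 hx.le, hx]
      linarith
    · rw [lockInstance_nextR_slow hB1 hx (hf0 x), hx, lockValue_slow]
      linarith
    · rw [lockInstance_nextR_cheap hx (hf0 x), lockValue_cheap hx]
      linarith
  · rw [stateOf_val (by omega), lockValue_slow]
    linarith

end lockInstance

end SSP
end

/-! ### Cost of a policy that must guess the code -/

noncomputable section

namespace SSP

/-- A potential that vanishes from a fixed time on leaves no remainder, so nothing is assumed about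
reaching the goal. The inequality is averaged over the actions of `π` because the lock's potential
depends on `π` itself. -/
theorem le_value_of_potential {S A : ℕ} (M : SSP S A) {π : MarkovPolicy S A} {φ : ℕ → Fin S → ℝ}
    (hφ : ∀ t x, 0 ≤ φ t x)
    (h : ∀ t x, φ t x ≤ ∑ a, π t x a * (M.cost x a + M.nextR x a (φ (t + 1)))) {n : ℕ}
    (hn : ∀ x, φ n x = 0) (s : Fin S) : ENNReal.ofReal (φ 0 s) ≤ M.value π s := by
  have := M.le_partialTotal_add (π := π) (r := fun x a => (M.cost x a : ℝ≥0∞)) (g := fun _ _ => 0)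
    (e := fun _ _ => 0) (φ := fun t x => ENNReal.ofReal (φ t x)) (fun t x => ?_) s n
  · simp only [hn] at this
    have h0 : M.partialTotal π s (fun _ _ => 0) n = 0 := by simp [partialTotal]
    simp only [h0, ENNReal.ofReal_zero, mul_zero, Finset.sum_const_zero, add_zero] at this
    exact this.trans (M.partialTotal_le_total _ _ _ _)
  · have hnn : ∀ a, 0 ≤ (M.cost x a : ℝ) + M.nextR x a (φ (t + 1)) := fun a =>
      add_nonneg (NNReal.coe_nonneg _) (M.nextR_nonneg x a (hφ _))
    calc ENNReal.ofReal (φ t x) + ∑ a, ENNReal.ofReal (π t x a) * 0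
        = ENNReal.ofReal (φ t x) := by simp
      _ ≤ ENNReal.ofReal (∑ a, π t x a * (M.cost x a + M.nextR x a (φ (t + 1)))) :=
          ENNReal.ofReal_le_ofReal (h t x)
      _ = _ := by
          rw [ENNReal.ofReal_sum_of_nonneg fun a _ =>
            mul_nonneg (stdSimplex.zero_le _ _) (hnn a)]
          refine Finset.sum_congr rfl fun a _ => ?_
          rw [ENNReal.ofReal_mul (stdSimplex.zero_le _ _),
            ENNReal.ofReal_add (NNReal.coe_nonneg _) (M.nextR_nonneg x a (hφ _)),
            M.nextE_ofReal x a (hφ _), ENNReal.ofReal_coe_nnreal, add_zero]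

section lock

variable {s b N : ℕ} (π : MarkovPolicy (s + 4) (b + 4)) (c : Fin N → Fin (b + 3)) (Jn : ℕ)

/-- The probability that `π` follows the code in the `j`-th state of the lock at time `t`. -/
def rightProb (t j : ℕ) : ℝ :=
  if h : j < N then π t (stateOf s (j + 1)) (c ⟨j, h⟩).succ else 0

/-- The probability that `π`, from the `i`-th state of the lock at time `t`, follows the code up to
the goal. -/
def trialProb (t i : ℕ) : ℝ := ∏ j ∈ Finset.Ico i N, rightProb π c (t + (j - i)) j

/-- The savings, compared to cost `Jn`, of opening the lock in a trial that starts at time `t` or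
later, if the first possible time is `1`. -/
def lateGain (t : ℕ) : ℝ :=
  ∑ t' ∈ Finset.Ico t (Jn + 1), trialProb π c t' 0 * max 0 ((Jn : ℝ) + 1 - t' - N)

/-- A lower bound for the remaining cost in the `i`-th state of the lock at time `t`. -/
def trialPotential (t i : ℕ) : ℝ :=
  (Jn : ℝ) + 1 - t - trialProb π c t i * max 0 ((Jn : ℝ) + 1 - t - N + i) - lateGain π c Jn (t + 1)

/-- A lower bound for the remaining cost at time `t`. -/
def lockPotential (p : ℝ) (t : ℕ) (x : Fin (s + 4)) : ℝ :=
  if t = 0 then if x.val = 0 then 1 + p * max 0 (trialPotential π c Jn 1 0) else 0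
  else if x.val ≠ 0 ∧ x.val ≤ N then max 0 (trialPotential π c Jn t (x.val - 1)) else 0

variable {π c Jn}

theorem rightProb_nonneg (t j : ℕ) : 0 ≤ rightProb π c t j := by
  unfold rightProb; split_ifs
  · exact stdSimplex.zero_le _ _
  · exact le_rfl

theorem trialProb_nonneg (t i : ℕ) : 0 ≤ trialProb π c t i :=
  Finset.prod_nonneg fun _ _ => rightProb_nonneg _ _

theorem trialProb_self (t : ℕ) : trialProb π c t N = 1 := by simp [trialProb]

theorem trialProb_eq_mul {i : ℕ} (hi : i < N) (t : ℕ) :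
    trialProb π c t i = rightProb π c t i * trialProb π c (t + 1) (i + 1) := by
  unfold trialProb
  rw [Finset.prod_eq_prod_Ico_succ_bot hi, Nat.sub_self, add_zero]
  congr 1
  refine Finset.prod_congr rfl fun j hj => ?_
  have := (Finset.mem_Ico.1 hj).1
  rw [show t + (j - i) = t + 1 + (j - (i + 1)) by omega]

theorem lateGain_nonneg (t : ℕ) : 0 ≤ lateGain π c Jn t :=
  Finset.sum_nonneg fun _ _ => mul_nonneg (trialProb_nonneg _ _) (le_max_left _ _)

theorem lateGain_eq_add (t : ℕ) : lateGain π c Jn t =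
    trialProb π c t 0 * max 0 ((Jn : ℝ) + 1 - t - N) + lateGain π c Jn (t + 1) := by
  unfold lateGain
  rcases Nat.lt_or_ge t (Jn + 1) with h | h
  · rw [Finset.sum_eq_sum_Ico_succ_bot h]
  · rw [Finset.Ico_eq_empty_of_le h, Finset.Ico_eq_empty_of_le (by omega)]
    have : (Jn : ℝ) + 1 ≤ t := by exact_mod_cast h
    rw [max_eq_left (by linarith [(Nat.cast_nonneg N : (0 : ℝ) ≤ N)])]
    simp

/-- In the first state a trial starts now, so its savings are exactly the term of index `t` of
`lateGain`. -/
theorem trialPotential_zero (t : ℕ) : trialPotential π c Jn t 0 =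
    (Jn : ℝ) + 1 - t - lateGain π c Jn t := by
  rw [lateGain_eq_add, trialPotential]
  push_cast
  rw [add_zero]
  ring

theorem lockPotential_nonneg {p : ℝ} (hp : 0 ≤ p) (t : ℕ) (x : Fin (s + 4)) :
    0 ≤ lockPotential π c Jn p t x := by
  unfold lockPotential
  split_ifs
  · positivity
  · exact le_rfl
  · exact le_max_left _ _
  · exact le_rfl

theorem trialPotential_le (t i : ℕ) : trialPotential π c Jn t i ≤ (Jn : ℝ) + 1 - t := by
  have := lateGain_nonneg (π := π) (c := c) (Jn := Jn) (t + 1)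
  have := mul_nonneg (trialProb_nonneg (π := π) (c := c) t i)
    (le_max_left 0 ((Jn : ℝ) + 1 - t - N + i))
  unfold trialPotential
  linarith

theorem lockPotential_of_lock {p : ℝ} {t : ℕ} (ht : t ≠ 0) {x : Fin (s + 4)} (h0 : x.val ≠ 0)
    (hx : x.val ≤ N) :
    lockPotential π c Jn p t x = max 0 (trialPotential π c Jn t (x.val - 1)) := by
  rw [lockPotential, if_neg ht, if_pos ⟨h0, hx⟩]

/-- A wrong action costs one step and returns to the start, where only trials from `t + 1` on can
help; the right action continues the current trial; the terminal action costs at least Jn ≥ Jn + 1 -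
t. Summing the savings over all start times is a union bound, so the potential may only be too low.
-/
theorem trialPotential_le_sum {cmin B J p : ℝ≥0} (hJn : (Jn : ℝ) ≤ J) (hN1 : 1 ≤ N)
    (hNs : N ≤ s + 1) {t : ℕ} (ht : t ≠ 0) {x : Fin (s + 4)} (h0 : x.val ≠ 0) (hx : x.val ≤ N) :
    trialPotential π c Jn t (x.val - 1) ≤
      ∑ a, π t x a * ((lockInstance s b N cmin B J p c).cost x a +
        (lockInstance s b N cmin B J p c).nextR x a (lockPotential π c Jn p (t + 1))) := by
  obtain ⟨i, hi⟩ : ∃ i, x.val = i + 1 := ⟨x.val - 1, by omega⟩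
  have hiN : i < N := by omega
  have hxs : stateOf s (i + 1) = x := by rw [← hi, stateOf_coe]
  set E : ℝ := (Jn : ℝ) + 1 - t - lateGain π c Jn (t + 1) with hE
  set G : ℝ := trialProb π c (t + 1) (i + 1) * max 0 ((Jn : ℝ) + 1 - t - N + i) with hG
  have hG0 : 0 ≤ G := mul_nonneg (trialProb_nonneg _ _) (le_max_left _ _)
  have v1 : (stateOf s 1).val = 1 := stateOf_val (by omega)
  have hgain := lateGain_nonneg (π := π) (c := c) (Jn := Jn) (t + 1)
  have ht1 : (1 : ℝ) ≤ t := by exact_mod_cast Nat.one_le_iff_ne_zero.2 ht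
  have hpt : trialPotential π c Jn t (x.val - 1) = E - rightProb π c t i * G := by
    rw [show x.val - 1 = i by omega, trialPotential, trialProb_eq_mul hiN, hE, hG]
    ring
  have hright : ∀ a, IsRight c x.val a ↔ a = (c ⟨i, hiN⟩).succ := by
    intro a
    have : x.val - 1 = i := by omega
    simp only [IsRight, this]
    exact ⟨fun ⟨_, h⟩ => h, fun h => ⟨hiN, h⟩⟩
  have haction : ∀ a, E - (if a = (c ⟨i, hiN⟩).succ then G else 0) ≤
      (lockInstance s b N cmin B J p c).cost x a +
        (lockInstance s b N cmin B J p c).nextR x a (lockPotential π c Jn p (t + 1)) := by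
    intro a
    by_cases ha : a = 0
    · subst ha
      rw [lockInstance_cost_terminal, lockInstance_nextR_terminal,
        if_neg (Fin.succ_ne_zero _).symm]
      linarith
    rw [lockInstance_cost_unit (by omega) ha, NNReal.coe_one]
    by_cases hr : IsRight c x.val a
    · rw [if_pos ((hright a).1 hr)]
      rcases Nat.lt_or_ge x.val N with hlt | hge
      · rw [lockInstance_nextR_right h0 hlt hr]
        have hv : (stateOf s (x.val + 1)).val = x.val + 1 := stateOf_val (by omega)
        rw [lockPotential_of_lock (show t + 1 ≠ 0 by omega) (by omega) (by omega), hv]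
        refine le_trans ?_ (add_le_add_right (le_max_right 0 _) 1)
        rw [show x.val + 1 - 1 = i + 1 by omega, trialPotential]
        rw [hE, hG]
        have h1 := mul_nonneg (trialProb_nonneg (π := π) (c := c) (t + 1) 0)
          (le_max_left 0 ((Jn : ℝ) + 1 - (t + 1 : ℕ) - N))
        -- The current trial began at time t - i. Following the code does not change this, hence not
        -- its savings.
        have h2 : (Jn : ℝ) + 1 - (t + 1 : ℕ) - N + (i + 1 : ℕ) = (Jn : ℝ) + 1 - t - N + i := by
          push_cast; ring
        rw [h2]
        rw [lateGain_eq_add (t + 1)]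
        push_cast at h1 ⊢
        linarith
      · have hxN : x.val = N := le_antisymm hx hge
        rw [lockInstance_nextR_last h0 hxN hr, hE, hG, show i + 1 = N by omega, trialProb_self]
        have : (N : ℝ) = i + 1 := by exact_mod_cast (show N = i + 1 by omega)
        have := le_max_right 0 ((Jn : ℝ) + 1 - t - N + i)
        linarith
    · rw [if_neg fun h => hr ((hright a).2 h), lockInstance_nextR_wrong h0 hx ha hr,
        lockPotential_of_lock (show t + 1 ≠ 0 by omega) (by omega) (by omega), v1,
        trialPotential_zero, hE]
      have := le_max_right 0 ((Jn : ℝ) + 1 - (t + 1 : ℕ) - lateGain π c Jn (t + 1))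
      push_cast at this ⊢
      linarith
  have hsum : E - rightProb π c t i * G =
      ∑ a, π t x a * (E - (if a = (c ⟨i, hiN⟩).succ then G else 0)) := by
    simp only [mul_sub, Finset.sum_sub_distrib, mul_ite, mul_zero, Finset.sum_ite_eq',
      Finset.mem_univ, if_true]
    rw [← Finset.sum_mul, stdSimplex.sum_eq_one, one_mul, rightProb, dif_pos hiN, hxs]
  rw [hpt, hsum]
  exact Finset.sum_le_sum fun a _ => mul_le_mul_of_nonneg_left (haction a) (stdSimplex.zero_le _ _)

/-- Time starts at 1 in the lock, since the initial state takes one step. At time Jn + 1 the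
potential has run out. The conditions on p and J make the terminal action no better in the initial
state, as J ≥ 1 + J / 2. -/
theorem lock_le_value {cmin B J p : ℝ≥0} (hJn : (Jn : ℝ) ≤ J) (hN1 : 1 ≤ N)
    (hNs : N ≤ s + 1) (hp : (p : ℝ) ≤ 1 / 2) (hJ : 2 ≤ J) :
    ENNReal.ofReal (1 + p * ((Jn : ℝ) - lateGain π c Jn 1)) ≤
      (lockInstance s b N cmin B J p c).value π 0 := by
  have hJ' : (2 : ℝ) ≤ J := by exact_mod_cast hJ
  have hp0 : (0 : ℝ) ≤ p := p.coe_nonneg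
  have hp1 : p ≤ 1 := by rw [← NNReal.coe_le_coe, NNReal.coe_one]; linarith
  have v1 : (stateOf s 1).val = 1 := stateOf_val (by omega)
  have key := le_value_of_potential (lockInstance s b N cmin B J p c) (π := π)
    (φ := lockPotential π c Jn p) (lockPotential_nonneg hp0) (fun t x => ?_) (n := Jn + 1)
    (fun x => ?_) 0
  · refine le_trans (ENNReal.ofReal_le_ofReal ?_) key
    rw [lockPotential, if_pos rfl, if_pos (by simp)]
    have := le_max_right 0 (trialPotential π c Jn 1 0)
    rw [trialPotential_zero] at this ⊢
    push_cast at this ⊢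
    gcongr
    linarith
  · have hnn : 0 ≤ ∑ a, π t x a * ((lockInstance s b N cmin B J p c).cost x a +
        (lockInstance s b N cmin B J p c).nextR x a (lockPotential π c Jn p (t + 1))) :=
      Finset.sum_nonneg fun a _ => mul_nonneg (stdSimplex.zero_le _ _)
        (add_nonneg (NNReal.coe_nonneg _) (nextR_nonneg _ _ _ (lockPotential_nonneg hp0 _)))
    rw [lockPotential]
    split_ifs with ht hx hx
    · subst ht
      have hE : ∀ a, 1 + p * max 0 (trialPotential π c Jn 1 0) ≤
          (lockInstance s b N cmin B J p c).cost x a +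
            (lockInstance s b N cmin B J p c).nextR x a (lockPotential π c Jn p (0 + 1)) := by
        intro a
        by_cases ha : a = 0
        · subst ha
          rw [lockInstance_cost_terminal, lockInstance_nextR_terminal]
          have h1 : max 0 (trialPotential π c Jn 1 0) ≤ J := by
            refine max_le (by linarith) ((trialPotential_le 1 0).trans ?_)
            push_cast; linarith
          have h2 : p * max 0 (trialPotential π c Jn 1 0) ≤ 1 / 2 * (J : ℝ) := by gcongr
          linarith
        · rw [lockInstance_cost_unit (by omega) ha, lockInstance_nextR_init hp1 hx ha,
            lockPotential_of_lock (by omega) (by omega) (by omega), v1]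
          simp
      calc 1 + p * max 0 (trialPotential π c Jn 1 0)
          = ∑ a, π 0 x a * (1 + p * max 0 (trialPotential π c Jn 1 0)) := by
            rw [← Finset.sum_mul, stdSimplex.sum_eq_one, one_mul]
        _ ≤ _ := Finset.sum_le_sum fun a _ =>
            mul_le_mul_of_nonneg_left (hE a) (stdSimplex.zero_le _ _)
    · exact hnn
    · exact max_le hnn (trialPotential_le_sum hJn hN1 hNs ht hx.1 hx.2)
    · exact hnn
  · rw [lockPotential, if_neg (Nat.succ_ne_zero _)]
    split_ifs
    · refine max_eq_left ((trialPotential_le _ _).trans ?_)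
      push_cast; linarith
    · rfl

/-- A trial that starts after time Jn - N is too late to save anything, and none saves more than Jn
- N. -/
theorem lateGain_le (hN : N ≤ Jn) :
    lateGain π c Jn 1 ≤ ((Jn : ℝ) - N) * ∑ t ∈ Finset.Ico 1 (Jn - N + 1), trialProb π c t 0 := by
  have hN' : (N : ℝ) ≤ Jn := by exact_mod_cast hN
  unfold lateGain
  have hsub : Finset.Ico 1 (Jn - N + 1) ⊆ Finset.Ico 1 (Jn + 1) :=
    Finset.Ico_subset_Ico le_rfl (by omega)
  rw [← Finset.sum_subset hsub, Finset.mul_sum]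
  · refine Finset.sum_le_sum fun t ht => ?_
    rw [mul_comm]
    refine mul_le_mul_of_nonneg_right (max_le (by linarith) ?_) (trialProb_nonneg _ _)
    have : (1 : ℝ) ≤ t := by exact_mod_cast (Finset.mem_Ico.1 ht).1
    linarith
  · intro t h1 h2
    have : Jn - N + 1 ≤ t := by
      simp only [Finset.mem_Ico] at h1 h2; omega
    have : (Jn : ℝ) - N + 1 ≤ t := by
      rw [← Nat.cast_sub hN]; exact_mod_cast this
    rw [max_eq_left (by linarith), mul_zero]

variable (π) in
-- Summing the product over all codes factorizes into one sum over actions per lock state; each is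
-- at most one because the terminal action is not part of a code.
theorem sum_trialProb_le_one (t : ℕ) : ∑ c : Fin N → Fin (b + 3), trialProb π c t 0 ≤ 1 := by
  have h : ∀ c : Fin N → Fin (b + 3), trialProb π c t 0 =
      ∏ j : Fin N, π (t + j) (stateOf s (j + 1)) (c j).succ := by
    intro c
    rw [trialProb, Nat.Ico_zero_eq_range, Finset.prod_range]
    refine Finset.prod_congr rfl fun j _ => ?_
    simp [rightProb]
  simp only [h]
  have := Finset.prod_univ_sum (fun _ : Fin N => (Finset.univ : Finset (Fin (b + 3))))
    (fun j a => π (t + j) (stateOf s (j + 1)) a.succ)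
  rw [Fintype.piFinset_univ] at this
  rw [← this]
  refine Finset.prod_le_one (fun j _ => Finset.sum_nonneg fun a _ => stdSimplex.zero_le _ _)
    fun j _ => ?_
  have h1 := stdSimplex.sum_eq_one (π (t + j) (stateOf s (j + 1)))
  rw [Fin.sum_univ_succ] at h1
  have h2 := stdSimplex.zero_le (π (t + j) (stateOf s (j + 1))) 0
  linarith

end lock

end SSP
end

/-! ### The bound that is linear in J -/

noncomputable section

namespace SSP

open Classical in
theorem lockInstance_trans_init {s b N : ℕ} {cmin B J p : ℝ≥0} {c : Fin N → Fin (b + 3)}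
    (a : Fin (b + 4)) : (lockInstance s b N cmin B J p c).trans 0 a =
      if a = 0 then PMF.pure none else twoPoint p (some (stateOf s 1)) none := by
  simp [lockInstance]

/-- A set of codes for which a single policy is nearly optimal contains at most two thirds of all codes. -/
theorem card_le_of_lock_isEpsOptimal {s b N : ℕ} {cmin B J p : ℝ≥0} {ε : ℝ} (hN1 : 1 ≤ N)
    (hNs : N ≤ s + 1) (hNB : (N : ℝ) ≤ B) (hB : 2 ≤ B) (hJ : 3 * B ≤ J) (hp : (p : ℝ) ≤ 1 / 2)
    (hpε : (p : ℝ) * J = 7 * ε) (hε : 0 < ε) (hc : cmin ≤ 1)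
    (hJN : (J : ℝ) - N ≤ ((b : ℝ) + 3) ^ N / 2) (π : MarkovPolicy (s + 4) (b + 4))
    (t : Finset (Fin N → Fin (b + 3)))
    (ht : ∀ c ∈ t, (lockInstance s b N cmin B J p c).IsEpsOptimal ε π) :
    (t.card : ℝ) ≤ 2 / 3 * ((b : ℝ) + 3) ^ N := by
  have hB' : (2 : ℝ) ≤ B := by exact_mod_cast hB
  have hJ' : 3 * (B : ℝ) ≤ J := by exact_mod_cast hJ
  have hp1 : p ≤ 1 := by rw [← NNReal.coe_le_coe, NNReal.coe_one]; linarith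
  have hp0 : (0 : ℝ) < p := by
    by_contra h
    have : (p : ℝ) = 0 := le_antisymm (not_lt.1 h) p.coe_nonneg
    rw [this, zero_mul] at hpε
    linarith
  obtain ⟨Jn, hJn⟩ : ∃ Jn, Jn = ⌊(J : ℝ)⌋₊ := ⟨_, rfl⟩
  have hJle : (Jn : ℝ) ≤ J := by rw [hJn]; exact Nat.floor_le J.coe_nonneg
  have hJlt : (J : ℝ) < Jn + 1 := by rw [hJn]; exact Nat.lt_floor_add_one _
  have hJ6 : (6 : ℝ) ≤ Jn := by
    have : 6 ≤ Jn := by rw [hJn]; exact Nat.le_floor (by push_cast; linarith)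
    exact_mod_cast this
  have hJ3 : 3 * (N : ℝ) ≤ Jn := by
    have : 3 * N ≤ Jn := by rw [hJn]; exact Nat.le_floor (by push_cast; linarith)
    exact_mod_cast this
  have hNJ : N ≤ Jn := by
    have : (N : ℝ) ≤ Jn := by linarith [(Nat.cast_nonneg N : (0 : ℝ) ≤ N)]
    exact_mod_cast this
  have hD : 0 < (Jn : ℝ) - N := by linarith
  -- Otherwise the excess over the optimum exceeds p (Jn - N) / 4. Since N ≤ Jn / 3 and J < Jn + 1 ≤
  -- 7 Jn / 6, this is at least p J / 7 = ε.
  have hlow : ∀ c ∈ t, 3 / 4 ≤ ∑ i ∈ Finset.Ico 1 (Jn - N + 1), trialProb π c i 0 := by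
    intro c hct
    have h1 := ht c hct
    have h2 := (lockInstance_hasParameters (s := s) (c := c) hN1 hNs hNB hB hJ hp1 hc le_rfl).2
    have h3 := lock_le_value (s := s) (π := π) (c := c) (cmin := cmin) (B := B) hJle hN1 hNs hp
      (by rw [← NNReal.coe_le_coe]; push_cast; linarith)
    change (lockInstance s b N cmin B J p c).value π 0 ≤
      (lockInstance s b N cmin B J p c).optValue 0 + _ at h1
    rw [h2, ← ENNReal.ofReal_add (by positivity) hε.le] at h1
    have h4 := (ENNReal.ofReal_le_ofReal_iff (by positivity)).1 (h3.trans h1)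
    have h5 := lateGain_le (π := π) (c := c) hNJ
    by_contra! h6
    have h7 := mul_lt_mul_of_pos_left h6 hD
    have h8 : ((Jn : ℝ) - N) / 4 < Jn - lateGain π c Jn 1 - N := by linarith
    have h9 : (J : ℝ) / 7 ≤ ((Jn : ℝ) - N) / 4 := by linarith
    have h10 := mul_lt_mul_of_pos_left (h9.trans_lt h8) hp0
    have h11 : (p : ℝ) * (J / 7) = ε := by rw [mul_div_assoc', hpε]; ring
    nlinarith
  -- Double counting: each of the Jn - N start times serves codes of total weight at most one. With
  -- J - N at most half the number of codes, two thirds result.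
  have h1 : (t.card : ℝ) * (3 / 4) ≤ (Jn : ℝ) - N := by
    calc (t.card : ℝ) * (3 / 4) = ∑ _c ∈ t, (3 / 4 : ℝ) := by simp
      _ ≤ ∑ c ∈ t, ∑ i ∈ Finset.Ico 1 (Jn - N + 1), trialProb π c i 0 := Finset.sum_le_sum hlow
      _ ≤ ∑ c, ∑ i ∈ Finset.Ico 1 (Jn - N + 1), trialProb π c i 0 :=
          Finset.sum_le_univ_sum_of_nonneg fun c =>
            Finset.sum_nonneg fun i _ => trialProb_nonneg _ _
      _ = ∑ i ∈ Finset.Ico 1 (Jn - N + 1), ∑ c, trialProb π c i 0 := Finset.sum_comm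
      _ ≤ ∑ _i ∈ Finset.Ico 1 (Jn - N + 1), (1 : ℝ) :=
          Finset.sum_le_sum fun i _ => sum_trialProb_le_one π i
      _ = (Jn : ℝ) - N := by simp [Nat.cast_sub hNJ]
  linarith

/-- A lower bound on the sample complexity that is linear in the cost of the terminal action. -/
theorem exists_div_le_sampleComplexity {S A : ℕ} {cmin B J : ℝ≥0} {Tbar : ℝ≥0∞} {ε δ : ℝ}
    (hS : 4 ≤ S) (hA : 4 ≤ A) (hB : 2 ≤ B) (hJ : 3 * B ≤ J)
    (hJN : (J : ℝ) - (min ⌊B⌋₊ (S - 3) : ℕ) ≤ ((A : ℝ) - 1) ^ (min ⌊B⌋₊ (S - 3)) / 2)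
    (hc : cmin ≤ 1) (hT : ENNReal.ofReal (2 * B) ≤ Tbar) (hε0 : 0 < ε) (hε : ε < 1 / 32)
    (hδ : δ < 1 / 12) {Ω : Type*} [MeasurableSpace Ω] {alg : BPIAlgorithm S A Ω}
    {n : SSP S A → ℕ∞} (hn : alg.IsCorrect ε δ {M | M.HasParameters cmin B J Tbar} n) :
    ∃ M : SSP S A, M.HasParameters cmin B J Tbar ∧
      (J : ℝ≥0∞) / ENNReal.ofReal ε ≤ 14 * ((n M : ℕ∞) : ℝ≥0∞) := by
  obtain ⟨s, rfl⟩ := Nat.exists_eq_add_of_le' hS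
  obtain ⟨b, rfl⟩ := Nat.exists_eq_add_of_le' hA
  obtain ⟨N, hN⟩ : ∃ N, N = min ⌊B⌋₊ (s + 4 - 3) := ⟨_, rfl⟩
  rw [← hN, show (((b + 4 : ℕ) : ℝ) - 1) = (b : ℝ) + 3 by push_cast; ring] at hJN
  have hB' : (2 : ℝ) ≤ B := by exact_mod_cast hB
  have hJ' : 3 * (B : ℝ) ≤ J := by exact_mod_cast hJ
  have hNs : N ≤ s + 1 := by omega
  have hNfl : N ≤ ⌊B⌋₊ := by omega
  have hNB : (N : ℝ) ≤ B := by
    have : (N : ℝ≥0) ≤ B := le_trans (by exact_mod_cast hNfl) (Nat.floor_le zero_le)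
    exact_mod_cast this
  have hN1 : 1 ≤ N := by
    have : 2 ≤ ⌊B⌋₊ := Nat.le_floor (by exact_mod_cast hB)
    omega
  have hJ0 : (0 : ℝ) < J := by linarith
  -- Large enough that ignorance of the code costs more than ε, and such that n₀ < J / (14 ε) gives
  -- n₀ p ≤ 1/2.
  obtain ⟨p, hp⟩ : ∃ p : ℝ≥0, (p : ℝ) = 7 * ε / J := ⟨⟨7 * ε / J, by positivity⟩, rfl⟩
  have hpε : (p : ℝ) * J = 7 * ε := by rw [hp]; field_simp
  have hp2 : (p : ℝ) ≤ 1 / 2 := by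
    rw [hp, div_le_iff₀ hJ0]; linarith
  have hp1 : p ≤ 1 := by rw [← NNReal.coe_le_coe, NNReal.coe_one]; linarith
  set M₀ := lockInstance s b N cmin B J 0 (fun _ => 0) with hM₀
  have hP₀ : M₀.HasParameters cmin B J Tbar :=
    (lockInstance_hasParameters hN1 hNs hNB hB hJ zero_le_one hc hT).1
  refine ⟨M₀, hP₀, ?_⟩
  by_contra! hlt
  have htop : n M₀ ≠ ⊤ := by
    rintro h
    rw [h] at hlt
    simp at hlt
  obtain ⟨n₀, hn₀⟩ := ENat.ne_top_iff_exists.1 htop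
  have hn0p : (n₀ : ℝ) * p ≤ 1 / 2 := by
    rw [← hn₀, ← ENNReal.ofReal_coe_nnreal, ← ENNReal.ofReal_div_of_pos hε0] at hlt
    have h1 : (14 : ℝ≥0∞) * ((n₀ : ℕ∞) : ℝ≥0∞) = ENNReal.ofReal (14 * n₀) := by
      rw [ENNReal.ofReal_mul (by norm_num)]; simp
    rw [h1, ENNReal.ofReal_lt_ofReal_iff (by positivity), lt_div_iff₀ hε0] at hlt
    rw [hp, mul_div_assoc', div_le_iff₀ hJ0]
    linarith
  have key := card_mul_le_of_isCorrect alg (M₀ := M₀)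
    (M₁ := fun c : Fin N → Fin (b + 3) => lockInstance s b N cmin B J p c)
    (fun _ => rfl) (fun _ => rfl) (by rw [hn₀]; exact hn M₀ hP₀)
    (fun c => hn _ (lockInstance_hasParameters hN1 hNs hNB hB hJ hp1 hc hT).1)
    (c := 2) (g := ENNReal.ofReal (2 / 3 * ((b : ℝ) + 3) ^ N)) (β := 0) (fun π t ht => ?_)
    (fun d => ⟨fun _ => 0, by simp, fun c => ?_⟩)
  · have hcard : (Fintype.card (Fin N → Fin (b + 3)) : ℝ≥0∞) = ENNReal.ofReal (((b : ℝ) + 3) ^ N) := by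
      rw [Fintype.card_fun, Fintype.card_fin, Fintype.card_fin, ← ENNReal.ofReal_natCast]
      push_cast; rfl
    have hC : (0 : ℝ) < ((b : ℝ) + 3) ^ N := by positivity
    have hq : 0 ≤ 1 - δ := by linarith
    rw [hcard, show (2 : ℝ≥0∞) = ENNReal.ofReal 2 by simp, add_zero,
      ← ENNReal.ofReal_mul hC.le, ← ENNReal.ofReal_mul (by norm_num),
      ← ENNReal.ofReal_mul (by norm_num), ← ENNReal.ofReal_add (by positivity) (by positivity),
      ← ENNReal.ofReal_add (by positivity) (by positivity),
      ENNReal.ofReal_le_ofReal_iff (by positivity)] at key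
    -- After division by the number of codes: 3(1 - δ) ≤ 2/3 + 2, against δ < 1/12.
    nlinarith
  · rw [← ENNReal.ofReal_natCast]
    exact ENNReal.ofReal_le_ofReal (card_le_of_lock_isEpsOptimal hN1 hNs hNB hB hJ hp2 hpε hε0 hc
      hJN π t ht)
  · rw [zero_add]
    have htr : ∀ a, M₀.trans 0 a = PMF.pure none := by
      intro a
      rw [hM₀, lockInstance_trans_init, twoPoint_zero, ite_self]
    -- The base learner never leaves the initial state, so the code, on which the instances differ
    -- inside the lock, is never seen.
    refine stopMass_le_two_mul (M := M₀) (M' := lockInstance s b N cmin B J p c) rfl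
      (R := {0}) rfl (fun x hx a y h => ?_) hp1 hn0p (fun x hx a o => ?_) d _
    · rw [Set.mem_singleton_iff.1 hx, htr] at h
      simp at h
    · rw [Set.mem_singleton_iff.1 hx, htr, lockInstance_trans_init]
      split_ifs
      · exact mul_le_of_le_one_left' (by exact_mod_cast tsub_le_self)
      · exact one_sub_mul_pure_le_twoPoint hp1 _ _ _

end SSP
end

/-! ### Heap-shaped trees and their optimal values -/

noncomputable section

/-- The depth of the node `x` in the `q`-ary heap, where the children of `x` are `q * x + 1, …,
q * x + q`. -/
def heapDepth (q : ℕ) : ℕ → ℕ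
  | 0 => 0
  | x + 1 => heapDepth q (x / q) + 1
decreasing_by exact Nat.lt_succ_of_le (Nat.div_le_self x q)

/-- The first node of depth `d` in the `q`-ary heap. -/
def heapStart (q : ℕ) : ℕ → ℕ
  | 0 => 0
  | d + 1 => q * heapStart q d + 1

theorem heapDepth_child {q x a : ℕ} (h1 : 1 ≤ a) (ha : a ≤ q) :
    heapDepth q (q * x + a) = heapDepth q x + 1 := by
  obtain ⟨a, rfl⟩ := Nat.exists_eq_add_of_le' h1
  rw [← add_assoc, heapDepth, Nat.mul_add_div (by omega), Nat.div_eq_of_lt (by omega), add_zero]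

/-- The heap is numbered level by level. In the induction, start(d) ≤ ⌊x / q⌋ is the same as q ·
start(d) ≤ x. -/
theorem le_heapDepth_iff {q : ℕ} (hq : 0 < q) (d x : ℕ) :
    d ≤ heapDepth q x ↔ heapStart q d ≤ x := by
  induction d generalizing x with
  | zero => simp [heapStart]
  | succ d ih =>
    rcases x with _ | x
    · simp [heapDepth, heapStart]
    · rw [heapDepth, heapStart, Nat.succ_le_succ_iff, Nat.succ_le_succ_iff, ih,
        Nat.le_div_iff_mul_le hq, mul_comm]

theorem heapStart_succ (q d : ℕ) : heapStart q (d + 1) = heapStart q d + q ^ d := by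
  induction d with
  | zero => simp [heapStart]
  | succ d ih =>
    have h1 : heapStart q (d + 1) = q * heapStart q d + 1 := rfl
    have h2 : heapStart q (d + 1 + 1) = q * heapStart q (d + 1) + 1 := rfl
    rw [h2, pow_succ]
    nlinarith

theorem two_mul_heapStart_le {q : ℕ} (hq : 3 ≤ q) (d : ℕ) : 2 * heapStart q d ≤ q ^ d := by
  induction d with
  | zero => simp [heapStart]
  | succ d ih =>
    rw [heapStart_succ, pow_succ]
    nlinarith

/-- A heap with `S` nodes has a level close to the bottom, at most a constant fraction of the nodes lie
above it, and a constant fraction lie on it. -/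
theorem exists_heap_level {q S : ℕ} (hq : 3 ≤ q) (hS : 2 ≤ S) :
    ∃ D, 1 ≤ D ∧ 2 * heapStart q D ≤ S ∧ q ^ (D - 1) ≤ S ∧
      S ≤ 3 * (min S (heapStart q (D + 1)) - heapStart q D) := by
  have hex : ∃ D, S < 2 * heapStart q (D + 1) := by
    refine ⟨S, ?_⟩
    rw [heapStart_succ]
    have := Nat.lt_pow_self (n := S) (show 1 < q by omega)
    omega
  classical
  -- Minimality gives 2 · start(D) ≤ S. If S ≤ start(D + 1), at least S / 2 nodes remain on level D.
  -- Otherwise the level is full: its q^D ≥ 2 · start(D) nodes are two thirds of start(D + 1) > S /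
  -- 2.
  obtain ⟨D, hD, hmin⟩ : ∃ D, S < 2 * heapStart q (D + 1) ∧
      ∀ d < D, ¬ S < 2 * heapStart q (d + 1) :=
    ⟨Nat.find hex, Nat.find_spec hex, fun d hd => Nat.find_min hex hd⟩
  have hD1 : 1 ≤ D := by
    by_contra h
    have h0 : D = 0 := by omega
    rw [h0] at hD
    simp [heapStart] at hD
    omega
  obtain ⟨d, rfl⟩ := Nat.exists_eq_add_of_le' hD1
  have h1 := hmin d (by omega)
  have h2 := heapStart_succ q d
  have h3 := heapStart_succ q (d + 1)
  have h4 := two_mul_heapStart_le hq (d + 1)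
  exact ⟨d + 1, by omega, by omega, by simp only [Nat.add_sub_cancel]; omega, by omega⟩

namespace SSP

/-- The child of `x` in the `(b + 3)`-ary heap that action `a ≠ 0` leads to, truncated to the
available states. -/
def heapChild (s b : ℕ) (x : Fin (s + 4)) (a : Fin (b + 4)) : Fin (s + 4) :=
  stateOf s (min ((b + 3) * x.val + a.val) (s + 3))

/-- The exit probability of leaf-action pairs, which is larger by the factor `1 + η` at `k`. -/
def exitRate {s b : ℕ} (T η : ℝ≥0) (k : Fin (s + 4) × Fin (b + 4)) (x : Fin (s + 4))
    (a : Fin (b + 4)) : ℝ≥0 :=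
  if (x, a) = k then (1 + η) / T else 1 / T

/-- A tree of depth `D` with step cost `cmin`; a leaf is left with the probability given
by `exitRate`, at cost `B / T` per step. -/
def treeInstance (s b D : ℕ) (cmin B J T η : ℝ≥0) (k : Fin (s + 4) × Fin (b + 4)) :
    SSP (s + 4) (b + 4) where
  cost x a := if a = 0 then J else if heapDepth (b + 3) x.val < D then cmin else B / T
  trans x a :=
    if a = 0 then PMF.pure none
    else if heapDepth (b + 3) x.val < D then PMF.pure (some (heapChild s b x a))
    else twoPoint (exitRate T η k x a) none (some x)
  init := 0

/-- The number of steps from a state to the leaves. -/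
def treeLevel (s b D : ℕ) (x : Fin (s + 4)) : ℕ := D - heapDepth (b + 3) x.val

/-- The leaf `i` can be reached from `x`. -/
def Reaches (s b D : ℕ) (i x : Fin (s + 4)) : Prop :=
  Relation.ReflTransGen
    (fun x y => heapDepth (b + 3) x.val < D ∧ ∃ a : Fin (b + 4), a ≠ 0 ∧ y = heapChild s b x a) x i

section tree

variable {s b D : ℕ} {cmin B J T η : ℝ≥0} {k : Fin (s + 4) × Fin (b + 4)}

/-- Truncation does no harm: the last state already has depth at least D by `hs`, so a truncated
child is still a leaf. -/
theorem treeLevel_child (hs : heapStart (b + 3) D ≤ s + 3) {x : Fin (s + 4)} {a : Fin (b + 4)}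
    (ha : a ≠ 0) : treeLevel s b D (heapChild s b x a) = treeLevel s b D x - 1 := by
  have ha1 : 1 ≤ a.val := Nat.one_le_iff_ne_zero.2 fun h => ha (Fin.ext h)
  have hd := heapDepth_child (x := x.val) ha1 (show a.val ≤ b + 3 by omega)
  have hq : 0 < b + 3 := by omega
  unfold treeLevel heapChild
  rw [stateOf_val (by omega)]
  rcases le_total ((b + 3) * x.val + a.val) (s + 3) with h | h
  · rw [min_eq_left h, hd]; omega
  · rw [min_eq_right h]
    have h1 := (le_heapDepth_iff hq D (s + 3)).2 hs
    have h2 := (le_heapDepth_iff hq D _).2 (hs.trans h)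
    omega

theorem treeLevel_leaf {x : Fin (s + 4)} (hx : ¬ heapDepth (b + 3) x.val < D) :
    treeLevel s b D x = 0 := by
  unfold treeLevel; omega

theorem treeLevel_init : treeLevel s b D 0 = D := by simp [treeLevel, heapDepth]

theorem treeLevel_le (x : Fin (s + 4)) : treeLevel s b D x ≤ D := Nat.sub_le _ _

theorem reaches_child_imp {i x : Fin (s + 4)} (hx : heapDepth (b + 3) x.val < D)
    {a : Fin (b + 4)} (ha : a ≠ 0) (h : Reaches s b D i (heapChild s b x a)) : Reaches s b D i x :=
  Relation.ReflTransGen.head ⟨hx, a, ha, rfl⟩ h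

theorem Reaches.exists_child {i x : Fin (s + 4)} (hx : heapDepth (b + 3) x.val < D)
    (hi : ¬ heapDepth (b + 3) i.val < D) (h : Reaches s b D i x) :
    ∃ a : Fin (b + 4), a ≠ 0 ∧ Reaches s b D i (heapChild s b x a) := by
  rcases Relation.ReflTransGen.cases_head h with rfl | ⟨y, ⟨_, a, ha, rfl⟩, hy⟩
  · exact absurd hx hi
  · exact ⟨a, ha, hy⟩

theorem Reaches.eq_of_leaf {i x : Fin (s + 4)} (hx : ¬ heapDepth (b + 3) x.val < D)
    (h : Reaches s b D i x) : x = i := by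
  rcases Relation.ReflTransGen.cases_head h with rfl | ⟨y, ⟨h', _⟩, _⟩
  · rfl
  · exact absurd h' hx

/-- Climb to the parent: node y + 1 is child number y % q + 1 of y / q, and no truncation occurs
below S. -/
theorem reaches_init (i : ℕ) (hi : i < s + 4) (hiD : i < heapStart (b + 3) (D + 1)) :
    Reaches s b D (stateOf s i) 0 := by
  induction i using Nat.strong_induction_on with
  | _ i ih =>
    rcases i with _ | y
    · exact Relation.ReflTransGen.refl
    · have hq : 0 < b + 3 := by omega
      have hdiv := Nat.div_add_mod y (b + 3)
      have hmod := Nat.mod_lt y hq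
      have hle : y / (b + 3) ≤ y := Nat.div_le_self _ _
      have hstart : y / (b + 3) < heapStart (b + 3) D := by
        rw [heapStart] at hiD
        exact Nat.div_lt_of_lt_mul (by omega)
      have hparent : heapDepth (b + 3) (y / (b + 3)) < D := by
        rw [← not_le, le_heapDepth_iff hq]; omega
      refine Relation.ReflTransGen.tail (ih (y / (b + 3)) (by omega) (by omega) ?_) ?_
      · rw [heapStart_succ]; omega
      · rw [stateOf_val (by omega)]
        refine ⟨hparent, ⟨y % (b + 3) + 1, by omega⟩, by simp [Fin.ext_iff], ?_⟩
        rw [heapChild, stateOf_val (by omega)]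
        congr 1
        simp only
        rw [min_eq_left (by omega)]
        omega

theorem treeInstance_cost_terminal (x : Fin (s + 4)) :
    (treeInstance s b D cmin B J T η k).cost x 0 = J := by simp [treeInstance]

theorem treeInstance_cost_inner {x : Fin (s + 4)} (hx : heapDepth (b + 3) x.val < D)
    {a : Fin (b + 4)} (ha : a ≠ 0) : (treeInstance s b D cmin B J T η k).cost x a = cmin := by
  simp [treeInstance, ha, hx]

theorem treeInstance_cost_leaf {x : Fin (s + 4)} (hx : ¬ heapDepth (b + 3) x.val < D)
    {a : Fin (b + 4)} (ha : a ≠ 0) : (treeInstance s b D cmin B J T η k).cost x a = B / T := by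
  simp [treeInstance, ha, hx]

theorem treeInstance_nextR_terminal (x : Fin (s + 4)) (φ : Fin (s + 4) → ℝ) :
    (treeInstance s b D cmin B J T η k).nextR x 0 φ = 0 :=
  nextR_of_trans_eq_pure _ (o := none) (by simp [treeInstance]) φ

theorem treeInstance_nextR_inner {x : Fin (s + 4)} (hx : heapDepth (b + 3) x.val < D)
    {a : Fin (b + 4)} (ha : a ≠ 0) (φ : Fin (s + 4) → ℝ) :
    (treeInstance s b D cmin B J T η k).nextR x a φ = φ (heapChild s b x a) :=
  nextR_of_trans_eq_pure _ (o := some (heapChild s b x a)) (by simp [treeInstance, ha, hx]) φ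

theorem exitRate_le_one (hT : 1 + η ≤ T) (x : Fin (s + 4)) (a : Fin (b + 4)) :
    exitRate T η k x a ≤ 1 := by
  have h1 : (1 : ℝ≥0) ≤ T := le_trans le_self_add hT
  unfold exitRate
  split_ifs
  · exact div_le_one_of_le₀ hT zero_le
  · exact div_le_one_of_le₀ h1 zero_le

theorem treeInstance_nextR_leaf (hT : 1 + η ≤ T) {x : Fin (s + 4)}
    (hx : ¬ heapDepth (b + 3) x.val < D) {a : Fin (b + 4)} (ha : a ≠ 0) (φ : Fin (s + 4) → ℝ) :
    (treeInstance s b D cmin B J T η k).nextR x a φ = (1 - exitRate T η k x a) * φ x := by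
  have := nextR_of_trans_eq_twoPoint (treeInstance s b D cmin B J T η k) (x := x) (a := a)
    (o := none) (o' := some x) (exitRate_le_one (k := k) hT x a)
    (by simp only [treeInstance]; rw [if_neg ha, if_neg hx]) φ
  simpa using this

theorem one_le_exitRate_mul (hT : 0 < T) (x : Fin (s + 4)) (a : Fin (b + 4)) :
    (1 : ℝ) ≤ exitRate T η k x a * T := by
  have hT' : (T : ℝ) ≠ 0 := by exact_mod_cast hT.ne'
  unfold exitRate
  split_ifs
  · push_cast; rw [div_mul_cancel₀ _ hT']; linarith [η.coe_nonneg]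
  · push_cast; rw [div_mul_cancel₀ _ hT']

theorem exitRate_self_mul (hT : 0 < T) : (exitRate T η k k.1 k.2 : ℝ) * T = 1 + η := by
  have hT' : (T : ℝ) ≠ 0 := by exact_mod_cast hT.ne'
  rw [exitRate, if_pos rfl]
  push_cast; rw [div_mul_cancel₀ _ hT']

theorem exitRate_of_ne_mul (hT : 0 < T) {x : Fin (s + 4)} {a : Fin (b + 4)} (h : (x, a) ≠ k) :
    (exitRate T η k x a : ℝ) * T = 1 := by
  have hT' : (T : ℝ) ≠ 0 := by exact_mod_cast hT.ne'
  rw [exitRate, if_neg h]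
  push_cast; rw [div_mul_cancel₀ _ hT']

/-- Expected hitting times in the tree under an arbitrary policy. -/
theorem treeInstance_hitting_bellman (hs : heapStart (b + 3) D ≤ s + 3) (hT : 1 + η ≤ T)
    (x : Fin (s + 4)) (a : Fin (b + 4)) :
    1 + (treeInstance s b D cmin B J T η k).nextR x a
      (fun x => (T : ℝ) + treeLevel s b D x) ≤ (T : ℝ) + treeLevel s b D x := by
  have h1 : (1 : ℝ≥0) ≤ T := le_trans le_self_add hT
  have h1' : (1 : ℝ) ≤ T := by exact_mod_cast h1
  by_cases ha : a = 0
  · subst ha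
    rw [treeInstance_nextR_terminal]
    linarith [(Nat.cast_nonneg _ : (0 : ℝ) ≤ treeLevel s b D x)]
  by_cases hx : heapDepth (b + 3) x.val < D
  · rw [treeInstance_nextR_inner hx ha, treeLevel_child hs ha, Nat.cast_sub]
    · push_cast; linarith
    · unfold treeLevel; omega
  · rw [treeInstance_nextR_leaf hT hx ha, treeLevel_leaf hx]
    have := one_le_exitRate_mul (η := η) (k := k) (lt_of_lt_of_le one_pos h1) x a
    push_cast
    linarith

theorem treeInstance_hittingTime_lt_top (hs : heapStart (b + 3) D ≤ s + 3) (hT : 1 + η ≤ T)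
    (π : MarkovPolicy (s + 4) (b + 4)) (x : Fin (s + 4)) :
    (treeInstance s b D cmin B J T η k).hittingTime π x < ⊤ :=
  lt_of_le_of_lt (hittingTime_le_of_bellman _ (u := fun x => (T : ℝ) + treeLevel s b D x)
    (fun x => by positivity) (treeInstance_hitting_bellman hs hT) π x) ENNReal.ofReal_lt_top

open Classical in
theorem treeInstance_hasParameters (hs : heapStart (b + 3) D ≤ s + 3) (hD : 1 ≤ D)
    (hB : 2 ≤ B) (hJ : 3 * B ≤ J) (hBT : B ≤ T) (hcT : cmin * T ≤ B) (hcD : cmin * D ≤ B)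
    (hc : cmin ≤ 1) (hη : η ≤ 1) (hk : ¬ heapDepth (b + 3) k.1.val < D) (hk0 : k.2 ≠ 0)
    {Tbar : ℝ≥0∞} (hTbar : ENNReal.ofReal (T + D) ≤ Tbar) :
    (treeInstance s b D cmin B J T η k).HasParameters cmin B J Tbar ∧
      (Reaches s b D k.1 0 → (treeInstance s b D cmin B J T η k).optValue 0 =
        ENNReal.ofReal (cmin * D + B / (1 + η))) := by
  have hB' : (2 : ℝ) ≤ B := by exact_mod_cast hB
  have hJ' : 3 * (B : ℝ) ≤ J := by exact_mod_cast hJ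
  have hBT' : (B : ℝ) ≤ T := by exact_mod_cast hBT
  have hη' : (η : ℝ) ≤ 1 := by exact_mod_cast hη
  have hη0 : (0 : ℝ) ≤ η := η.coe_nonneg
  have hc' : (cmin : ℝ) ≤ 1 := by exact_mod_cast hc
  have hc0 : (0 : ℝ) ≤ cmin := cmin.coe_nonneg
  have hcD' : (cmin : ℝ) * D ≤ B := by exact_mod_cast hcD
  have hTp : 0 < T := by
    rw [← NNReal.coe_lt_coe, NNReal.coe_zero]; linarith
  have hTp' : (0 : ℝ) < T := by exact_mod_cast hTp
  have hT : 1 + η ≤ T := by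
    rw [← NNReal.coe_le_coe]; push_cast; linarith
  obtain ⟨v, hv⟩ : ∃ v : ℝ, v = B / (1 + η) := ⟨_, rfl⟩
  have hv1 : v * (1 + η) = B := by rw [hv]; field_simp
  have hvB : v ≤ B := by rw [hv]; exact div_le_self (by linarith) (by linarith)
  have hv2 : (B : ℝ) / 2 ≤ v := by rw [hv]; gcongr; linarith
  -- The optimal cost that remains to be paid at a leaf: reduced exactly where the distinguished
  -- leaf is still reachable.
  obtain ⟨W, hW⟩ : ∃ W : Fin (s + 4) → ℝ, W = fun x => if Reaches s b D k.1 x then v else B :=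
    ⟨_, rfl⟩
  have hWv : ∀ x, v ≤ W x := fun x => by rw [hW]; dsimp only; split_ifs <;> linarith
  have hWB : ∀ x, W x ≤ B := fun x => by rw [hW]; dsimp only; split_ifs <;> linarith
  have hWchild : ∀ {x : Fin (s + 4)} {a : Fin (b + 4)}, heapDepth (b + 3) x.val < D → a ≠ 0 →
      W x ≤ W (heapChild s b x a) := by
    intro x a hx ha
    by_cases h : Reaches s b D k.1 x
    · refine le_trans (le_of_eq ?_) (hWv _)
      rw [hW]; simp [h]
    · have h' : ¬ Reaches s b D k.1 (heapChild s b x a) := fun h' => h (reaches_child_imp hx ha h')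
      rw [hW]; simp [h, h']
  have hlevel : ∀ x, (cmin : ℝ) * treeLevel s b D x ≤ B := fun x => by
    refine le_trans ?_ hcD'
    gcongr
    exact treeLevel_le x
  have hlchild : ∀ {x : Fin (s + 4)} {a : Fin (b + 4)}, heapDepth (b + 3) x.val < D → a ≠ 0 →
      (cmin : ℝ) * treeLevel s b D x = cmin + cmin * treeLevel s b D (heapChild s b x a) := by
    intro x a hx ha
    rw [treeLevel_child hs ha, Nat.cast_sub (by unfold treeLevel; omega)]
    push_cast; ring
  have hcost : (B : ℝ) / T * T = B := div_mul_cancel₀ _ hTp'.ne'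
  set f : Fin (s + 4) → Fin (b + 4) := fun x =>
    if heapDepth (b + 3) x.val < D then
      if h : ∃ a : Fin (b + 4), a ≠ 0 ∧ Reaches s b D k.1 (heapChild s b x a) then h.choose else 1
    else k.2 with hf
  have hf0 : ∀ x, f x ≠ 0 := by
    intro x; simp only [hf]; split_ifs with h1 h2
    · exact h2.choose_spec.1
    · simp
    · exact hk0
  have hWf : ∀ x, heapDepth (b + 3) x.val < D → W (heapChild s b x (f x)) ≤ W x := by
    intro x hx
    by_cases h : Reaches s b D k.1 x
    · have h2 := h.exists_child hx hk
      have h3 : Reaches s b D k.1 (heapChild s b x (f x)) := by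
        simp only [hf, if_pos hx, dif_pos h2]
        exact h2.choose_spec.2
      rw [hW]; simp [h, h3]
    · refine (hWB _).trans (le_of_eq ?_)
      rw [hW]; simp [h]
  have hterm : (treeInstance s b D cmin B J T η k).HasTerminalAction J := by
    refine ⟨0, fun x => by simp [treeInstance], fun x a ha => ?_⟩
    simp only [treeInstance, ha, if_false]
    split_ifs
    · exact hc
    · exact div_le_one_of_le₀ hBT zero_le
  have hleast : IsLeast {c | ∃ x a, (treeInstance s b D cmin B J T η k).cost x a = c} cmin := by
    refine IsLeast.of_le_of_mem (fun x a => ?_) 0 1 ?_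
    · simp only [treeInstance]
      split_ifs
      · rw [← NNReal.coe_le_coe]; linarith
      · exact le_rfl
      · rwa [le_div_iff₀ hTp]
    · exact treeInstance_cost_inner (by simpa [heapDepth] using Nat.pos_of_ne_zero (by omega)) (by simp)
  have hleafW : ∀ x, ¬ heapDepth (b + 3) x.val < D → x ≠ k.1 → W x = B := by
    intro x hx hxk
    have : ¬ Reaches s b D k.1 x := fun h => hxk (h.eq_of_leaf hx)
    rw [hW]; simp [this]
  have hkW : W k.1 = v := by
    have : Reaches s b D k.1 k.1 := Relation.ReflTransGen.refl
    rw [hW]; simp [this]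
  have h := hasParameters_of_bellman (treeInstance s b D cmin B J T η k) (Tbar := Tbar) (B := B)
    hterm hleast f (w := fun x => cmin * treeLevel s b D x + W x)
    (u := fun x => (T : ℝ) + treeLevel s b D x)
    (fun x => add_nonneg (by positivity) (le_trans (by linarith) (hWv x))) (fun x => by positivity)
    (fun x a => ?_) (fun x => ?_) (fun x => treeInstance_hitting_bellman hs hT x (f x))
    ⟨k.1, ?_⟩ (fun x => by have := hWB x; have := hlevel x; linarith)
    (fun x => le_trans (ENNReal.ofReal_le_ofReal (by gcongr; exact treeLevel_le x)) hTbar)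
  · refine ⟨h.1, fun hr => ?_⟩
    rw [h.2, treeLevel_init, hW, ← hv]
    simp [hr]
  · by_cases ha : a = 0
    · subst ha
      rw [treeInstance_cost_terminal, treeInstance_nextR_terminal]
      have := hWB x
      have := hlevel x
      linarith
    by_cases hx : heapDepth (b + 3) x.val < D
    · rw [treeInstance_cost_inner hx ha, treeInstance_nextR_inner hx ha, hlchild hx ha]
      linarith [hWchild hx ha]
    · rw [treeInstance_cost_leaf hx ha, treeInstance_nextR_leaf hT hx ha, treeLevel_leaf hx]
      push_cast
      rw [mul_zero, zero_add]
      have hle : (exitRate T η k x a : ℝ) * W x ≤ B / T := by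
        rw [le_div_iff₀ hTp']
        by_cases hxk : (x, a) = k
        · have h1 := exitRate_self_mul (η := η) (k := k) hTp
          have hx1 : x = k.1 := by rw [← hxk]
          have ha1 : a = k.2 := by rw [← hxk]
          rw [hx1, ha1, hkW]
          nlinarith
        · have h1 := exitRate_of_ne_mul (η := η) hTp hxk
          have := hWB x
          nlinarith
      linarith
  · by_cases hx : heapDepth (b + 3) x.val < D
    · rw [treeInstance_cost_inner hx (hf0 x), treeInstance_nextR_inner hx (hf0 x),
        hlchild hx (hf0 x)]
      linarith [hWf x hx]
    · rw [treeInstance_cost_leaf hx (hf0 x), treeInstance_nextR_leaf hT hx (hf0 x),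
        treeLevel_leaf hx]
      push_cast
      rw [mul_zero, zero_add]
      have hle : (B : ℝ) / T ≤ exitRate T η k x (f x) * W x := by
        rw [div_le_iff₀ hTp']
        have hfx : f x = k.2 := by simp only [hf, if_neg hx]
        by_cases hxk : x = k.1
        · have h1 := exitRate_self_mul (η := η) (k := k) hTp
          rw [hfx, hxk, hkW]
          nlinarith
        · have h1 := one_le_exitRate_mul (η := η) (k := k) hTp x (f x)
          rw [hleafW x hx hxk]
          nlinarith
      linarith
  · rw [treeLevel_leaf hk, hkW]
    push_cast
    linarith

end tree

end SSP
end

/-! ### Near-optimal policies and likelihood ratios in the tree -/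

noncomputable section

namespace SSP

section tree

variable {s b D : ℕ} {cmin B J T η : ℝ≥0} {k : Fin (s + 4) × Fin (b + 4)}

theorem exitRate_zero (x : Fin (s + 4)) (a : Fin (b + 4)) : exitRate T 0 k x a = 1 / T := by
  simp [exitRate]

theorem one_div_le_exitRate (x : Fin (s + 4)) (a : Fin (b + 4)) : 1 / T ≤ exitRate T η k x a := by
  unfold exitRate
  split_ifs
  · gcongr; exact le_self_add
  · exact le_rfl

/-- At η = 0 no pair is distinguished, so one base instance can be compared with each alternative at
its own pair. -/
theorem treeInstance_zero_eq (k k' : Fin (s + 4) × Fin (b + 4)) :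
    treeInstance s b D cmin B J T 0 k = treeInstance s b D cmin B J T 0 k' := by
  simp [treeInstance, exitRate_zero]

/-- The indicator of a state-action pair. -/
def pairInd (k : Fin (s + 4) × Fin (b + 4)) (x : Fin (s + 4)) (a : Fin (b + 4)) : ℝ≥0∞ :=
  if (x, a) = k then 1 else 0

/-- A nearly optimal policy plays the distinguished pair often. -/
theorem half_le_total_of_isEpsOptimal (hs : heapStart (b + 3) D ≤ s + 3) (hB : 2 ≤ B)
    (hJ : 3 * B ≤ J) (hBT : B ≤ T) (hcD : cmin * D ≤ B) {ε : ℝ} (hε : 0 < ε)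
    (hη : η ≤ 1 / 16) (hηε : (η : ℝ) * B = 4 * ε)
    (hopt : (treeInstance s b D cmin B J T η k).optValue 0 =
      ENNReal.ofReal (cmin * D + B / (1 + η))) (k' : Fin (s + 4) × Fin (b + 4))
    {π : MarkovPolicy (s + 4) (b + 4)}
    (hπ : (treeInstance s b D cmin B J T η k).IsEpsOptimal ε π) :
    ENNReal.ofReal (T / 2) ≤ (treeInstance s b D cmin B J T 0 k').total π 0 (pairInd k) := by
  have hB' : (2 : ℝ) ≤ B := by exact_mod_cast hB
  have hJ' : 3 * (B : ℝ) ≤ J := by exact_mod_cast hJ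
  have hBT' : (B : ℝ) ≤ T := by exact_mod_cast hBT
  have hcD' : (cmin : ℝ) * D ≤ B := by exact_mod_cast hcD
  have hη' : (η : ℝ) ≤ 1 / 16 := by
    have h : (η : ℝ) ≤ ((1 / 16 : ℝ≥0) : ℝ) := NNReal.coe_le_coe.2 hη
    simpa using h
  have hη0 : (0 : ℝ) ≤ η := η.coe_nonneg
  have hTp : 0 < T := by
    rw [← NNReal.coe_lt_coe, NNReal.coe_zero]; linarith
  have hTp' : (0 : ℝ) < T := by exact_mod_cast hTp
  have hT : 1 + η ≤ T := by
    rw [← NNReal.coe_le_coe]; push_cast; linarith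
  have hcost : (B : ℝ) / T * T = B := div_mul_cancel₀ _ hTp'.ne'
  -- The saving per play of `k` relative to the potential B + cmin · level of the base instance.
  obtain ⟨z, hz⟩ : ∃ z : ℝ, z = η * (B / T) := ⟨_, rfl⟩
  have hz0 : 0 ≤ z := by rw [hz]; positivity
  have hzT : z * T = 4 * ε := by rw [hz, mul_assoc, hcost, hηε]
  have hφ0 : ∀ x : Fin (s + 4), 0 ≤ (B : ℝ) + cmin * treeLevel s b D x := fun x => by positivity
  have he0 : ∀ (x : Fin (s + 4)) (a : Fin (b + 4)), 0 ≤ if (x, a) = k then z else 0 :=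
    fun x a => by split_ifs <;> linarith
  have i1 := le_total_of_bellman (treeInstance s b D cmin B J T η k) (π := π) (s := 0)
    (g := fun _ _ => 0) (e := fun x a => ENNReal.ofReal (if (x, a) = k then z else 0))
    (r := fun x a => ((treeInstance s b D cmin B J T η k).cost x a : ℝ≥0∞))
    (φ := fun x => ENNReal.ofReal (B + cmin * treeLevel s b D x))
    (treeInstance_hittingTime_lt_top hs hT π 0) (fun _ => ENNReal.ofReal_ne_top)
    (fun x a => by
      rw [nextE_ofReal _ x a hφ0, add_zero, ← ENNReal.ofReal_coe_nnreal,
        ← ENNReal.ofReal_add (NNReal.coe_nonneg _) (he0 x a),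
        ← ENNReal.ofReal_add (add_nonneg (NNReal.coe_nonneg _) (he0 x a)) (nextR_nonneg _ x a hφ0)]
      apply ENNReal.ofReal_le_ofReal
      by_cases ha : a = 0
      · subst ha
        rw [treeInstance_cost_terminal, treeInstance_nextR_terminal]
        have h1 : (cmin : ℝ) * treeLevel s b D x ≤ cmin * D := by gcongr; exact treeLevel_le x
        have := he0 x 0
        linarith
      by_cases hx : heapDepth (b + 3) x.val < D
      · rw [treeInstance_cost_inner hx ha, treeInstance_nextR_inner hx ha, treeLevel_child hs ha,
          Nat.cast_sub (by unfold treeLevel; omega)]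
        have := he0 x a
        push_cast
        linarith
      · rw [treeInstance_cost_leaf hx ha, treeInstance_nextR_leaf hT hx ha, treeLevel_leaf hx]
        push_cast
        rw [mul_zero, add_zero]
        split_ifs with hk
        · have h1 := exitRate_self_mul (η := η) (k := k) hTp
          have hx1 : x = k.1 := by rw [← hk]
          have ha1 : a = k.2 := by rw [← hk]
          rw [← hx1, ← ha1] at h1
          have h2 : (exitRate T η k x a : ℝ) * B = (1 + η) * (B / T) := by
            rw [← h1, mul_assoc, mul_comm (T : ℝ), hcost]
          rw [hz]; linarith
        · have h1 := exitRate_of_ne_mul (η := η) hTp hk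
          have h2 : (exitRate T η k x a : ℝ) * B = 1 * (B / T) := by
            rw [← h1, mul_assoc, mul_comm (T : ℝ), hcost]
          linarith)
  have h0 : (treeInstance s b D cmin B J T η k).total π 0 (fun _ _ => 0) = 0 := by simp [total]
  rw [h0, add_zero, ← value_eq_total, treeLevel_init] at i1
  -- The base instance leaves the pair `k` less often, so it is visited at least as much there.
  have i2 : (treeInstance s b D cmin B J T η k).total π 0
      (fun x a => ENNReal.ofReal (if (x, a) = k then z else 0)) ≤
      ENNReal.ofReal z * (treeInstance s b D cmin B J T 0 k').total π 0 (pairInd k) := by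
    refine (total_le_total (M' := treeInstance s b D cmin B J T 0 k') (fun x a y => ?_) π 0
      _).trans (le_of_eq ?_)
    · simp only [treeInstance]
      split_ifs <;> first | exact le_rfl | skip
      rw [twoPoint_apply, twoPoint_apply, exitRate_zero]
      simp only [reduceCtorEq, if_false, ENNReal.coe_zero, zero_add]
      gcongr
      split_ifs
      · have := one_div_le_exitRate (T := T) (η := η) (k := k) x a
        gcongr
      · exact le_rfl
    · unfold total
      rw [← ENNReal.tsum_mul_left]
      refine tsum_congr fun t => ?_
      rw [Finset.mul_sum]
      refine Finset.sum_congr rfl fun x _ => ?_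
      rw [Finset.mul_sum]
      refine Finset.sum_congr rfl fun a _ => ?_
      by_cases hk : (x, a) = k
      · simp only [pairInd, if_pos hk]; ring
      · simp [pairInd, hk]
  -- Fewer than T / 2 plays would save less than z T / 2 = 2ε, whereas B - B / (1 + η) ≥ (15/16) ·
  -- 4ε > 3ε has to be saved up to the tolerance ε.
  by_contra! hlt
  change (treeInstance s b D cmin B J T η k).value π 0 ≤
    (treeInstance s b D cmin B J T η k).optValue 0 + _ at hπ
  rw [hopt] at hπ
  have h1 := i1.trans (add_le_add hπ (i2.trans (mul_le_mul_right hlt.le _)))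
  have hv0 : 0 ≤ (cmin : ℝ) * D + B / (1 + η) := by positivity
  rw [← ENNReal.ofReal_add hv0 hε.le, ← ENNReal.ofReal_mul hz0,
    ← ENNReal.ofReal_add (by linarith) (by positivity),
    ENNReal.ofReal_le_ofReal_iff (by positivity)] at h1
  obtain ⟨v, hv⟩ : ∃ v : ℝ, v = B / (1 + η) := ⟨_, rfl⟩
  have hv1 : v * (1 + η) = B := by rw [hv]; field_simp
  rw [← hv] at h1
  have h2 : (B : ℝ) * (15 / 16) ≤ v := by
    rw [hv, le_div_iff₀ (by linarith)]
    nlinarith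
  nlinarith

/-- In the base instance a leaf is left with probability 1 / T per play, so the constant T solves
the Bellman inequality for counting the plays of all leaf pairs together. -/
theorem card_le_two_of_half_le_total (hT1 : 1 ≤ T) (k' : Fin (s + 4) × Fin (b + 4))
    (π : MarkovPolicy (s + 4) (b + 4)) (t : Finset (Fin (s + 4) × Fin (b + 4)))
    (hleaf : ∀ k ∈ t, ¬ heapDepth (b + 3) k.1.val < D ∧ k.2 ≠ 0)
    (ht : ∀ k ∈ t, ENNReal.ofReal (T / 2) ≤
      (treeInstance s b D cmin B J T 0 k').total π 0 (pairInd k)) : t.card ≤ 2 := by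
  have hT1' : (1 : ℝ) ≤ T := by exact_mod_cast hT1
  have hsum : ∑ k ∈ t, (treeInstance s b D cmin B J T 0 k').total π 0 (pairInd k) =
      (treeInstance s b D cmin B J T 0 k').total π 0 (fun x a => ∑ k ∈ t, pairInd k x a) := by
    unfold total
    rw [← Summable.tsum_finsetSum fun _ _ => ENNReal.summable]
    refine tsum_congr fun n => ?_
    rw [Finset.sum_comm]
    refine Finset.sum_congr rfl fun x _ => ?_
    rw [Finset.sum_comm]
    refine Finset.sum_congr rfl fun a _ => ?_
    rw [Finset.mul_sum]
  have hle : (treeInstance s b D cmin B J T 0 k').total π 0 (fun x a => ∑ k ∈ t, pairInd k x a) ≤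
      ENNReal.ofReal T := by
    refine total_le_of_bellman _ (w := fun _ => ENNReal.ofReal T) (fun n x => ?_) 0
    refine sum_stdSimplex_mul_le _ fun a => ?_
    rw [nextE_ofReal _ x a (φ := fun _ => (T : ℝ)) fun _ => T.coe_nonneg]
    have hind : ∑ k ∈ t, pairInd k x a = if (x, a) ∈ t then 1 else 0 := by
      simp [pairInd]
    rw [hind]
    by_cases hmem : (x, a) ∈ t
    · obtain ⟨hx, ha⟩ := hleaf _ hmem
      rw [if_pos hmem, treeInstance_nextR_leaf (by simpa using hT1) hx ha, exitRate_zero,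
        ← ENNReal.ofReal_one, ← ENNReal.ofReal_add zero_le_one]
      · apply ENNReal.ofReal_le_ofReal
        push_cast
        have : 1 / (T : ℝ) * T = 1 := div_mul_cancel₀ _ (by linarith)
        linarith
      · push_cast
        have : 1 / (T : ℝ) * T = 1 := div_mul_cancel₀ _ (by linarith)
        linarith
    · rw [if_neg hmem, zero_add]
      apply ENNReal.ofReal_le_ofReal
      by_cases ha : a = 0
      · subst ha; rw [treeInstance_nextR_terminal]; exact T.coe_nonneg
      by_cases hx : heapDepth (b + 3) x.val < D
      · rw [treeInstance_nextR_inner hx ha]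
      · rw [treeInstance_nextR_leaf (by simpa using hT1) hx ha]
        have := (exitRate T 0 k' x a).coe_nonneg
        nlinarith
  have h1 : (t.card : ℝ≥0∞) * ENNReal.ofReal (T / 2) ≤ ENNReal.ofReal T := by
    calc (t.card : ℝ≥0∞) * ENNReal.ofReal (T / 2) = ∑ _k ∈ t, ENNReal.ofReal (T / 2) := by simp
      _ ≤ _ := Finset.sum_le_sum ht
      _ ≤ _ := hsum.le.trans hle
  rw [← ENNReal.ofReal_natCast, ← ENNReal.ofReal_mul (by positivity),
    ENNReal.ofReal_le_ofReal_iff (by positivity)] at h1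
  have h2 : (t.card : ℝ) ≤ 2 := by nlinarith
  exact_mod_cast h2

/-- The likelihood ratio of the next state for exit probabilities `1 / T` and `(1 + η) / T`. -/
def exitRatio (s : ℕ) (T η : ℝ≥0) : Option (Fin (s + 4)) → ℝ≥0
  | none => (1 + η)⁻¹
  | some _ => (1 - 1 / T) / (1 - (1 + η) / T)

/-- The strict inequality keeps the probability of staying under the alternative positive, as the
second ratio needs. -/
theorem treeInstance_trans_zero_eq (hT : 1 + η < T)
    (hk : ¬ heapDepth (b + 3) k.1.val < D) (hk0 : k.2 ≠ 0) (o : Option (Fin (s + 4))) :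
    (treeInstance s b D cmin B J T 0 k).trans k.1 k.2 o =
      exitRatio s T η o * (treeInstance s b D cmin B J T η k).trans k.1 k.2 o := by
  have hT1 : (1 : ℝ≥0) ≤ T := le_trans le_self_add hT.le
  have hTp : 0 < T := lt_of_lt_of_le one_pos hT1
  have h1 : 1 / T ≤ 1 := div_le_one_of_le₀ hT1 zero_le
  have h2 : (1 + η) / T < 1 := by rwa [div_lt_one hTp]
  have h3 : 1 - (1 + η) / T ≠ 0 := (tsub_pos_of_lt h2).ne'
  simp only [treeInstance, if_neg hk0, if_neg hk]
  rw [exitRate_zero, exitRate, if_pos rfl, twoPoint_apply, twoPoint_apply, min_eq_left h1,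
    min_eq_left h2.le, ← ENNReal.coe_add, ← ENNReal.coe_add, ← ENNReal.coe_mul]
  congr 1
  rcases o with _ | y
  · simp only [if_true, reduceCtorEq, if_false, add_zero, exitRatio]
    field_simp
  · simp only [reduceCtorEq, if_false, zero_add, exitRatio]
    split_ifs
    · rw [div_mul_cancel₀ _ h3]
    · simp

/-- The mean of the ratio under the base law is one plus the χ²-divergence of the two exit laws,
which is at most 3η² / T since T ≥ 2 and η ≤ 1/16 keep the denominator above 1/3. -/
theorem tsum_treeInstance_trans_mul_le {r : ℝ≥0} (hT : 2 ≤ T) (hη : η ≤ 1 / 16)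
    (hr : (r : ℝ) = (1 + 3 * (η : ℝ) ^ 2 / T)⁻¹)
    (hk : ¬ heapDepth (b + 3) k.1.val < D) (hk0 : k.2 ≠ 0) :
    ∑' o, (treeInstance s b D cmin B J T 0 k).trans k.1 k.2 o * (exitRatio s T η o * r) ≤ 1 := by
  have hη' : (η : ℝ) ≤ 1 / 16 := by
    have h : (η : ℝ) ≤ ((1 / 16 : ℝ≥0) : ℝ) := NNReal.coe_le_coe.2 hη
    simpa using h
  have hT' : (2 : ℝ) ≤ T := by exact_mod_cast hT
  have hη0 : (0 : ℝ) ≤ η := η.coe_nonneg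
  have hTη : 1 + η ≤ T := by rw [← NNReal.coe_le_coe]; push_cast; linarith
  have hT1 : (1 : ℝ≥0) ≤ T := le_trans le_self_add hTη
  have h1 : 1 / T ≤ 1 := div_le_one_of_le₀ hT1 zero_le
  have h2 : (1 + η) / T ≤ 1 := div_le_one_of_le₀ hTη zero_le
  simp only [treeInstance, if_neg hk0, if_neg hk]
  rw [tsum_fintype, Fintype.sum_option]
  simp only [exitRate_zero, twoPoint_apply, min_eq_left h1, exitRatio, reduceCtorEq, if_false,
    if_true, ENNReal.coe_zero, add_zero, zero_add, Option.some.injEq]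
  rw [Finset.sum_eq_single k.1 (fun y _ hy => by simp [hy]) (by simp), if_pos rfl,
    ← ENNReal.coe_mul, ← ENNReal.coe_mul, ← ENNReal.coe_mul, ← ENNReal.coe_mul, ← ENNReal.coe_add,
    ← ENNReal.coe_one, ENNReal.coe_le_coe, ← NNReal.coe_le_coe]
  push_cast [NNReal.coe_sub h1, NNReal.coe_sub h2]
  rw [hr]
  obtain ⟨x, hx⟩ : ∃ x : ℝ, x = 1 / T := ⟨_, rfl⟩
  have hx0 : 0 < x := by rw [hx]; positivity
  have hx2 : x ≤ 1 / 2 := by rw [hx]; gcongr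
  have e1 : (1 + (η : ℝ)) / T = (1 + η) * x := by rw [hx]; ring
  have e2 : 3 * (η : ℝ) ^ 2 / T = 3 * η ^ 2 * x := by rw [hx]; ring
  rw [e1, e2, ← hx]
  have hd : 1 / 3 ≤ 1 - (1 + (η : ℝ)) * x := by nlinarith
  have hd0 : 0 < 1 - (1 + (η : ℝ)) * x := by linarith
  have hkey : x * (1 + (η : ℝ))⁻¹ + (1 - x) * ((1 - x) / (1 - (1 + η) * x)) ≤ 1 + 3 * η ^ 2 * x := by
    have : x * (1 + (η : ℝ))⁻¹ + (1 - x) * ((1 - x) / (1 - (1 + η) * x)) =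
        1 + η ^ 2 * x / ((1 + η) * (1 - (1 + η) * x)) := by
      obtain ⟨d, hd'⟩ : ∃ d : ℝ, d = 1 - (1 + η) * x := ⟨_, rfl⟩
      rw [← hd'] at hd0 ⊢
      field_simp
      rw [hd']
      ring
    rw [this]
    have h3 : (η : ℝ) ^ 2 * x / ((1 + η) * (1 - (1 + η) * x)) ≤ 3 * η ^ 2 * x := by
      rw [div_le_iff₀ (by positivity)]
      have h4 : 1 / 3 ≤ (1 + (η : ℝ)) * (1 - (1 + η) * x) := by nlinarith
      have h5 : 0 ≤ (η : ℝ) ^ 2 * x := by positivity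
      nlinarith
    linarith
  have hpos : 0 < 1 + 3 * (η : ℝ) ^ 2 * x := by positivity
  calc x * ((1 + (η : ℝ))⁻¹ * (1 + 3 * η ^ 2 * x)⁻¹) +
        (1 - x) * ((1 - x) / (1 - (1 + η) * x) * (1 + 3 * η ^ 2 * x)⁻¹)
      = (x * (1 + (η : ℝ))⁻¹ + (1 - x) * ((1 - x) / (1 - (1 + η) * x))) *
        (1 + 3 * η ^ 2 * x)⁻¹ := by ring
    _ ≤ (1 + 3 * η ^ 2 * x) * (1 + 3 * η ^ 2 * x)⁻¹ := by gcongr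
    _ = 1 := mul_inv_cancel₀ hpos.ne'

end tree

/-- Arithmetic-geometric mean inequality; `y` shifts weight between the squared likelihood ratio and
the constant. -/
theorem le_exp_mul_sq_add_exp (y x : ℝ) :
    x ≤ Real.exp (-y) / 2 * x * x + Real.exp y / 2 := by
  have h1 : Real.exp y = Real.exp (y / 2) ^ 2 := by rw [← Real.exp_nat_mul]; congr 1; push_cast; ring
  have h2 : Real.exp (-y) = Real.exp (-(y / 2)) ^ 2 := by
    rw [← Real.exp_nat_mul]; congr 1; push_cast; ring
  have h3 : Real.exp (y / 2) * Real.exp (-(y / 2)) = 1 := by rw [← Real.exp_add]; simp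
  rw [h1, h2]
  have h4 : (Real.exp (-(y / 2)) * x - Real.exp (y / 2)) ^ 2 = Real.exp (-(y / 2)) ^ 2 * x * x -
      2 * x * (Real.exp (y / 2) * Real.exp (-(y / 2))) + Real.exp (y / 2) ^ 2 := by ring
  rw [h3] at h4
  linarith [sq_nonneg (Real.exp (-(y / 2)) * x - Real.exp (y / 2))]

end SSP
end

/-! ### The bound that is quadratic in 1 / ε -/

noncomputable section

theorem four_le_log {δ : ℝ} (hδ0 : 0 < δ) (hδ : δ < 1 / (2 * Real.exp 4)) :
    4 ≤ Real.log (1 / δ) := by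
  rw [Real.le_log_iff_exp_le (by positivity), le_div_iff₀ hδ0]
  rw [lt_div_iff₀ (by positivity)] at hδ
  nlinarith [Real.exp_pos 4]

/-- The real inequality that turns the bound on failure probabilities into one on `n`. -/
theorem card_le_mul_of_failure_le {δ K x : ℝ} (hδ0 : 0 < δ) (hδ : δ < 1 / 12)
    (hL : 4 ≤ Real.log (1 / δ)) (hK : 4 ≤ K)
    (h : K * (1 - δ) + Real.exp (3 * Real.log (1 / δ) / 4) / 2 * (K * (1 - δ)) ≤
      2 + (K * (Real.exp (-(3 * Real.log (1 / δ) / 4)) / 2 * Real.exp (Real.log (1 / δ) / 2)) + x) +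
        Real.exp (3 * Real.log (1 / δ) / 4) / 2 * K) : K ≤ 25 * x := by
  obtain ⟨L, hLdef⟩ : ∃ L, L = Real.log (1 / δ) := ⟨_, rfl⟩
  rw [← hLdef] at h hL
  have hδL : δ = Real.exp (-L) := by
    rw [hLdef, one_div, Real.log_inv, neg_neg, Real.exp_log hδ0]
  have e1 : Real.exp (-(3 * L / 4)) * Real.exp (L / 2) = Real.exp (-(L / 4)) := by
    rw [← Real.exp_add]; congr 1; ring
  have e2 : Real.exp (3 * L / 4) * δ = Real.exp (-(L / 4)) := by
    rw [hδL, ← Real.exp_add]; congr 1; ring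
  -- The exponent 3L / 4 balances both error terms: each becomes K exp(-L / 4) / 2, together at most
  -- 0.37 K because L ≥ 4.
  have e3 : Real.exp (-(L / 4)) ≤ 37 / 100 := by
    have h1 : Real.exp (-(L / 4)) ≤ Real.exp (-1) := Real.exp_le_exp.2 (by linarith)
    have h2 := Real.exp_neg_one_lt_d9
    linarith
  have h1 : Real.exp (3 * L / 4) / 2 * (K * (1 - δ)) =
      Real.exp (3 * L / 4) / 2 * K - K * (Real.exp (3 * L / 4) * δ) / 2 := by ring
  have h2 : Real.exp (-(3 * L / 4)) / 2 * Real.exp (L / 2) =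
      (Real.exp (-(3 * L / 4)) * Real.exp (L / 2)) / 2 := by ring
  rw [h1, h2, e1, e2] at h
  -- What remains is K (11/12 - 37/100) ≤ 2 + x with 2 ≤ K / 2.
  nlinarith

namespace SSP

/-- A lower bound on the sample complexity that is quadratic in the inverse accuracy. -/
theorem exists_mul_le_sampleComplexity {S A : ℕ} {cmin B J T : ℝ≥0} {Tbar : ℝ≥0∞} {ε δ : ℝ}
    (hS : 4 ≤ S) (hA : 4 ≤ A) (hB : 2 ≤ B) (hJ : 3 * B ≤ J) (hc : cmin ≤ 1) (hBT : B ≤ T)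
    (hcT : cmin * T ≤ B)
    (hdepth : ∀ D : ℕ, (D : ℝ) ≤ Real.logb ((A : ℝ) - 1) S + 1 →
      cmin * D ≤ B ∧ ENNReal.ofReal (T + D) ≤ Tbar)
    (hε0 : 0 < ε) (hε : ε < 1 / 32) (hδ0 : 0 < δ) (hδ : δ < 1 / 12) (hL : 4 ≤ Real.log (1 / δ))
    {Ω : Type*} [MeasurableSpace Ω] {alg : BPIAlgorithm S A Ω} {n : SSP S A → ℕ∞}
    (hn : alg.IsCorrect ε δ {M | M.HasParameters cmin B J Tbar} n) :
    ∃ M : SSP S A, M.HasParameters cmin B J Tbar ∧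
      ENNReal.ofReal (T * (B : ℝ) ^ 2 * S * A / ε ^ 2 * Real.log (1 / δ)) ≤
        9600 * ((n M : ℕ∞) : ℝ≥0∞) := by
  obtain ⟨s, rfl⟩ := Nat.exists_eq_add_of_le' hS
  obtain ⟨b, rfl⟩ := Nat.exists_eq_add_of_le' hA
  obtain ⟨D, hD1, hDs, hDpow, hm⟩ := exists_heap_level (q := b + 3) (S := s + 4) (by omega) (by omega)
  obtain ⟨m, hmdef⟩ : ∃ m, m = min (s + 4) (heapStart (b + 3) (D + 1)) - heapStart (b + 3) D :=
    ⟨_, rfl⟩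
  rw [← hmdef] at hm
  have hB' : (2 : ℝ) ≤ B := by exact_mod_cast hB
  have hBT' : (B : ℝ) ≤ T := by exact_mod_cast hBT
  have hDlog : (D : ℝ) ≤ Real.logb (((b + 4 : ℕ) : ℝ) - 1) ((s + 4 : ℕ) : ℝ) + 1 := by
    have h1 : ((D - 1 : ℕ) : ℝ) ≤ Real.logb (((b + 4 : ℕ) : ℝ) - 1) ((s + 4 : ℕ) : ℝ) := by
      rw [Real.le_logb_iff_rpow_le (by push_cast; linarith [(Nat.cast_nonneg b : (0 : ℝ) ≤ b)])
        (by positivity), Real.rpow_natCast,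
        show ((b + 4 : ℕ) : ℝ) - 1 = ((b + 3 : ℕ) : ℝ) by push_cast; ring]
      exact_mod_cast hDpow
    rw [Nat.cast_sub hD1] at h1
    push_cast at h1 ⊢
    linarith
  obtain ⟨hcD, hTD⟩ := hdepth D hDlog
  obtain ⟨η, hη⟩ : ∃ η : ℝ≥0, (η : ℝ) = 4 * ε / B := ⟨⟨4 * ε / B, by positivity⟩, rfl⟩
  have hηε : (η : ℝ) * B = 4 * ε := by rw [hη]; field_simp
  have hη16' : (η : ℝ) ≤ 1 / 16 := by
    rw [hη, div_le_iff₀ (by linarith)]; linarith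
  have hη16 : η ≤ 1 / 16 := by rw [← NNReal.coe_le_coe]; push_cast; linarith
  have hη0 : (0 : ℝ) < η := by rw [hη]; positivity
  have hη1 : η ≤ 1 := by rw [← NNReal.coe_le_coe]; push_cast; linarith
  have hT2 : 2 ≤ T := hB.trans hBT
  have hT2' : (2 : ℝ) ≤ T := by exact_mod_cast hT2
  have hTη : 1 + η < T := by rw [← NNReal.coe_lt_coe]; push_cast; linarith
  have hs : heapStart (b + 3) D ≤ s + 3 := by omega
  let pr : Fin m × Fin (b + 3) → Fin (s + 4) × Fin (b + 4) := fun k =>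
    (stateOf s (heapStart (b + 3) D + k.1), k.2.succ)
  have hidx : ∀ i : Fin m, heapStart (b + 3) D + i.val < s + 4 ∧
      heapStart (b + 3) D + i.val < heapStart (b + 3) (D + 1) := fun i => by
    have := i.isLt
    omega
  have hpr : Function.Injective pr := by
    rintro ⟨i, a⟩ ⟨j, a'⟩ h
    simp only [pr, Prod.mk.injEq, Fin.succ_inj] at h
    have h1 := congrArg Fin.val h.1
    rw [stateOf_val (hidx i).1, stateOf_val (hidx j).1] at h1
    rw [h.2, Fin.ext (by omega : i.val = j.val)]
  have hleaf : ∀ k, ¬ heapDepth (b + 3) (pr k).1.val < D := by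
    intro k
    simp only [pr]
    rw [not_lt, stateOf_val (hidx k.1).1, le_heapDepth_iff (by omega)]
    omega
  have hne : ∀ k, (pr k).2 ≠ 0 := fun k => Fin.succ_ne_zero _
  have hreach : ∀ k, Reaches s b D (pr k).1 0 := fun k =>
    reaches_init _ (hidx k.1).1 (hidx k.1).2
  have hpar : ∀ k (η' : ℝ≥0), η' ≤ 1 →
      (treeInstance s b D cmin B J T η' (pr k)).HasParameters cmin B J Tbar ∧
      (treeInstance s b D cmin B J T η' (pr k)).optValue 0 =
        ENNReal.ofReal (cmin * D + B / (1 + η')) := fun k η' h => by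
    have h1 := treeInstance_hasParameters hs hD1 hB hJ hBT hcT hcD hc h (hleaf k) (hne k) hTD
    exact ⟨h1.1, h1.2 (hreach k)⟩
  let k₀ : Fin m × Fin (b + 3) := (⟨0, by omega⟩, 0)
  set M₀ := treeInstance s b D cmin B J T 0 (pr k₀) with hM₀
  have hP₀ : M₀.HasParameters cmin B J Tbar := (hpar k₀ 0 zero_le_one).1
  refine ⟨M₀, hP₀, ?_⟩
  rcases eq_or_ne (n M₀) ⊤ with htop | htop
  · rw [htop]; simp
  obtain ⟨n₀, hn₀⟩ := ENat.ne_top_iff_exists.1 htop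
  obtain ⟨L, hLdef⟩ : ∃ L, L = Real.log (1 / δ) := ⟨_, rfl⟩
  have hL0 : 0 < L := by rw [hLdef]; linarith
  obtain ⟨χ, hχ⟩ : ∃ χ : ℝ, χ = 3 * (η : ℝ) ^ 2 / T := ⟨_, rfl⟩
  have hχ0 : 0 < χ := by rw [hχ]; positivity
  obtain ⟨r, hr⟩ : ∃ r : ℝ≥0, (r : ℝ) = (1 + χ)⁻¹ := ⟨⟨(1 + χ)⁻¹, by positivity⟩, rfl⟩
  -- The threshold of plays: up to m' plays of a pair, (1 + χ)^j ≤ exp(L / 2).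
  obtain ⟨m', hm'⟩ : ∃ m' : ℝ, m' = L / (2 * χ) := ⟨_, rfl⟩
  have hm'0 : 0 < m' := by rw [hm']; positivity
  have key := card_mul_le_of_isCorrect alg (M₀ := M₀)
    (M₁ := fun k => treeInstance s b D cmin B J T η (pr k))
    (fun _ => rfl) (fun _ => rfl) (by rw [hn₀]; exact hn M₀ hP₀)
    (fun k => hn _ (hpar k η hη1).1) (c := ENNReal.ofReal (Real.exp (3 * L / 4) / 2)) (g := 2)
    (β := Fintype.card (Fin m × Fin (b + 3)) * (ENNReal.ofReal (Real.exp (-(3 * L / 4)) / 2) *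
      ENNReal.ofReal (Real.exp (L / 2))) + n₀ / ENNReal.ofReal m')
    (fun π t ht => ?_)
    (fun d => ⟨fun k => ENNReal.ofReal (Real.exp (-(3 * L / 4)) / 2) *
      ENNReal.ofReal (Real.exp (L / 2)) +
      (∑' h, M₀.run d n₀ h * M₀.playCount (pr k) h) / ENNReal.ofReal m', ?_, fun k => ?_⟩)
  -- m ≥ S / 3 leaves and A - 1 ≥ 3A / 4 actions give at least SA / 4 alternatives.
  · have hKle : (s + 4) * (b + 4) ≤ 4 * (m * (b + 3)) := by nlinarith
    have hKle' : ((s + 4 : ℕ) : ℝ) * ((b + 4 : ℕ) : ℝ) ≤ 4 * ((m * (b + 3) : ℕ) : ℝ) := by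
      exact_mod_cast hKle
    have hK4 : (4 : ℝ) ≤ ((m * (b + 3) : ℕ) : ℝ) := by
      have : 4 ≤ m * (b + 3) := by nlinarith
      exact_mod_cast this
    rw [Fintype.card_prod, Fintype.card_fin, Fintype.card_fin] at key
    generalize m * (b + 3) = K at key hKle' hK4
    have hq : 0 ≤ 1 - δ := by linarith
    rw [show (2 : ℝ≥0∞) = ENNReal.ofReal 2 by simp, ← ENNReal.ofReal_natCast K,
      ← ENNReal.ofReal_natCast n₀, ← ENNReal.ofReal_mul (by positivity),
      ← ENNReal.ofReal_mul (by positivity), ← ENNReal.ofReal_mul (by positivity),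
      ← ENNReal.ofReal_mul (by positivity), ← ENNReal.ofReal_mul (by positivity),
      ← ENNReal.ofReal_div_of_pos hm'0, ← ENNReal.ofReal_add (by positivity) (by positivity),
      ← ENNReal.ofReal_add (by positivity) (by positivity),
      ← ENNReal.ofReal_add (by positivity) (by positivity),
      ← ENNReal.ofReal_add (by positivity) (by positivity),
      ENNReal.ofReal_le_ofReal_iff (by positivity)] at key
    rw [hLdef] at key
    have h1 := card_le_mul_of_failure_le hδ0 hδ hL hK4 key
    rw [mul_div_assoc', le_div_iff₀ hm'0] at h1
    -- m' = L T / (6 η²) with η = 4ε / B; together with the factors 4 and 25 this makes 96 · 4 · 25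
    -- = 9600.
    have hm'' : m' * (96 * ε ^ 2) = L * T * B ^ 2 := by
      have h2 : χ * T = 3 * η ^ 2 := by rw [hχ]; field_simp
      have h3 : m' * (2 * χ) = L := by rw [hm']; field_simp
      have h4 : (η : ℝ) ^ 2 * B ^ 2 = 16 * ε ^ 2 := by
        rw [← mul_pow, hηε]; ring
      rw [← h3]
      linear_combination (-6 * m') * h4 - 2 * m' * B ^ 2 * h2
    rw [← hn₀, ← hLdef, show (9600 : ℝ≥0∞) * ((n₀ : ℕ∞) : ℝ≥0∞) = ENNReal.ofReal (9600 * n₀) by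
      rw [ENNReal.ofReal_mul (by norm_num)]; simp]
    apply ENNReal.ofReal_le_ofReal
    rw [div_mul_eq_mul_div, div_le_iff₀ (by positivity)]
    calc (T : ℝ) * B ^ 2 * (s + 4 : ℕ) * (b + 4 : ℕ) * L
        = m' * (96 * ε ^ 2) * ((s + 4 : ℕ) * (b + 4 : ℕ)) := by rw [hm'']; ring
      _ ≤ m' * (96 * ε ^ 2) * (4 * K) := by gcongr
      _ = 384 * ε ^ 2 * (K * m') := by ring
      _ ≤ 384 * ε ^ 2 * (25 * n₀) := by gcongr
      _ = 9600 * n₀ * ε ^ 2 := by ring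
  · have h1 := card_le_two_of_half_le_total (cmin := cmin) (B := B) (J := J) (T := T) (D := D)
      (hT2.trans' (by norm_num)) (pr k₀) π (t.map ⟨pr, hpr⟩) (fun k hk => ?_) (fun k hk => ?_)
    · rw [Finset.card_map] at h1
      exact_mod_cast h1
    · obtain ⟨j, _, rfl⟩ := Finset.mem_map.1 hk
      exact ⟨hleaf j, hne j⟩
    · obtain ⟨j, hj, rfl⟩ := Finset.mem_map.1 hk
      exact half_le_total_of_isEpsOptimal hs hB hJ hBT hcD hε0 hη16 hηε (hpar j η hη1).2 (pr k₀)
        (ht j hj)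
  · rw [Finset.sum_add_distrib, Finset.sum_const, Finset.card_univ, nsmul_eq_mul]
    simp only [div_eq_mul_inv]
    rw [← Finset.sum_mul]
    gcongr
    exact M₀.sum_tsum_run_mul_playCount_le hpr d n₀
  · have heq : M₀ = treeInstance s b D cmin B J T 0 (pr k) := treeInstance_zero_eq _ _
    rw [heq]
    refine stopMass_le_of_likelihood (M := treeInstance s b D cmin B J T 0 (pr k))
      (M' := treeInstance s b D cmin B J T η (pr k)) rfl (k := pr k) (ℓ := exitRatio s T η) (r := r)
      (treeInstance_trans_zero_eq hTη (hleaf k) (hne k)) (fun x a hxa => ?_)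
      (tsum_treeInstance_trans_mul_le hT2 hη16 (by rw [hr, hχ]) (hleaf k) (hne k))
      (by simpa using hm'0) ENNReal.ofReal_ne_top (fun x => ?_) (fun j hj => ?_) d n₀ _
    · simp only [treeInstance, exitRate, if_neg hxa]
    · rw [← ENNReal.ofReal_coe_nnreal, ← ENNReal.ofReal_mul (by positivity),
        ← ENNReal.ofReal_mul (by positivity), ← ENNReal.ofReal_add (by positivity) (by positivity)]
      exact ENNReal.ofReal_le_ofReal (le_exp_mul_sq_add_exp _ _)
    · rw [← ENNReal.ofReal_natCast, ENNReal.ofReal_le_ofReal_iff hm'0.le, hm',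
        le_div_iff₀ (by positivity)] at hj
      rw [← ENNReal.ofReal_coe_nnreal, hr, ← ENNReal.ofReal_pow (by positivity),
        ← ENNReal.ofReal_mul (by positivity), ← ENNReal.ofReal_one]
      apply ENNReal.ofReal_le_ofReal
      rw [inv_pow, ← div_eq_mul_inv, le_div_iff₀ (by positivity), one_mul]
      calc (1 + χ) ^ j ≤ Real.exp χ ^ j := by
            gcongr
            linarith [Real.add_one_le_exp χ]
        _ = Real.exp (j * χ) := (Real.exp_nat_mul χ j).symm
        _ ≤ Real.exp (L / 2) := Real.exp_le_exp.2 (by linarith)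

end SSP
end

/-! ### Assembly of the bounds -/

/-- The stated bound in terms of the parameters of the class. -/
theorem SSP.HasParameters.bound_le {S A : ℕ} {M : SSP S A} {cmin B J T : ℝ≥0} {Tbar : ℝ≥0∞}
    {ε δ : ℝ} (hM : M.HasParameters cmin B J Tbar)
    (hT : (T : ℝ≥0∞) = min ((B : ℝ≥0∞) / (cmin : ℝ≥0∞)) (Tbar / 2)) (hε : 0 < ε) :
    min (M.Bstar / (cmin : ℝ≥0∞)) Tbar * M.Bstar ^ 2 * (S : ℝ≥0∞) * (A : ℝ≥0∞) /
        ENNReal.ofReal (ε ^ 2) * ENNReal.ofReal (Real.log (1 / δ)) ≤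
      8 * ENNReal.ofReal (T * (B : ℝ) ^ 2 * S * A / ε ^ 2 * Real.log (1 / δ)) := by
  have h1 : min (M.Bstar / (cmin : ℝ≥0∞)) Tbar ≤ 2 * T := by
    have h2 : Tbar = 2 * (Tbar / 2) := (ENNReal.mul_div_cancel (by simp) (by simp)).symm
    have h3 : M.Bstar / (cmin : ℝ≥0∞) ≤ 2 * (B / cmin) := by
      rw [← mul_div_assoc]
      exact ENNReal.div_le_div_right hM.Bstar_le _
    rw [hT]
    rcases le_total ((B : ℝ≥0∞) / (cmin : ℝ≥0∞)) (Tbar / 2) with h | h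
    · rw [min_eq_left h]
      exact (min_le_left _ _).trans h3
    · rw [min_eq_right h, ← h2]
      exact min_le_right _ _
  calc min (M.Bstar / (cmin : ℝ≥0∞)) Tbar * M.Bstar ^ 2 * (S : ℝ≥0∞) * (A : ℝ≥0∞) /
        ENNReal.ofReal (ε ^ 2) * ENNReal.ofReal (Real.log (1 / δ))
      ≤ 2 * (T : ℝ≥0∞) * (2 * (B : ℝ≥0∞)) ^ 2 * (S : ℝ≥0∞) * (A : ℝ≥0∞) /
        ENNReal.ofReal (ε ^ 2) * ENNReal.ofReal (Real.log (1 / δ)) := by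
        gcongr
        exact hM.Bstar_le
    _ = 8 * ENNReal.ofReal (T * (B : ℝ) ^ 2 * S * A / ε ^ 2 * Real.log (1 / δ)) := by
        rw [ENNReal.ofReal_mul (by positivity), ENNReal.ofReal_div_of_pos (by positivity),
          ENNReal.ofReal_mul (by positivity), ENNReal.ofReal_mul (by positivity),
          ENNReal.ofReal_mul (by positivity), ENNReal.ofReal_pow (p := (B : ℝ)) (by positivity),
          ENNReal.ofReal_coe_nnreal, ENNReal.ofReal_coe_nnreal, ENNReal.ofReal_natCast,
          ENNReal.ofReal_natCast]
        simp only [div_eq_mul_inv]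
        ring

theorem mainTheorem6 :
    ∃ κ : ℝ, 0 < κ ∧
      ∀ (S A : ℕ) (cmin B J : ℝ≥0) (Tbar : ℝ≥0∞) (ε δ : ℝ),
        4 ≤ S → 4 ≤ A → 2 ≤ B → 3 * B ≤ J →
        (J : ℝ) - (min ⌊B⌋₊ (S - 3) : ℕ) ≤ ((A : ℝ) - 1) ^ (min ⌊B⌋₊ (S - 3)) / 2 →
        ENNReal.ofReal (max (B : ℝ) (Real.logb ((A : ℝ) - 1) S + 1)) ≤
          min ((B : ℝ≥0∞) / (cmin : ℝ≥0∞)) (Tbar / 2) →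
        0 < ε → ε < 1 / 32 → 0 < δ → δ < 1 / (2 * Real.exp 4) →
        ∀ (Ω : Type*) [MeasurableSpace Ω] (alg : BPIAlgorithm S A Ω) (n : SSP S A → ℕ∞),
          alg.IsCorrect ε δ {M | M.HasParameters cmin B J Tbar} n →
          ∃ M : SSP S A, M.HasParameters cmin B J Tbar ∧
            ENNReal.ofReal κ *
                (min (M.Bstar / (cmin : ℝ≥0∞)) Tbar * M.Bstar ^ 2 * (S : ℝ≥0∞) * (A : ℝ≥0∞) /
                      ENNReal.ofReal (ε ^ 2) * ENNReal.ofReal (Real.log (1 / δ)) +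
                  (J : ℝ≥0∞) / ENNReal.ofReal ε) ≤
              ((n M : ℕ∞) : ℝ≥0∞) := by
  refine ⟨1 / 200000, by norm_num, ?_⟩
  intro S A cmin B J Tbar ε δ hS hA hB hJ hJN hmax hε0 hε hδ0 hδ Ω _ alg n hn
  have hδ12 := delta_lt hδ
  have hL := four_le_log hδ0 hδ
  have hB0 : (B : ℝ≥0∞) ≠ 0 := by
    have : (0 : ℝ≥0) < B := lt_of_lt_of_le two_pos hB
    exact_mod_cast this.ne'
  -- Since B is positive and finite, the minimum is infinite exactly when `cmin = 0` and `Tbar = ⊤`.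
  rcases eq_or_ne (min ((B : ℝ≥0∞) / (cmin : ℝ≥0∞)) (Tbar / 2)) ⊤ with htop | htop
  · rw [min_eq_top] at htop
    have hc : cmin = 0 := by
      by_contra hc
      exact ENNReal.div_ne_top ENNReal.coe_ne_top (by exact_mod_cast hc) htop.1
    have hTbar : Tbar = ⊤ := by
      by_contra hT
      exact ENNReal.div_ne_top hT (by simp) htop.2
    subst hc hTbar
    obtain ⟨M, hM, hMn⟩ := SSP.exists_sampleComplexity_eq_top hS hA hB hJ hε0 hε hδ12 hn
    exact ⟨M, hM, by rw [hMn]; simp⟩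
  obtain ⟨T, hT⟩ : ∃ T : ℝ≥0, (T : ℝ≥0∞) = min ((B : ℝ≥0∞) / (cmin : ℝ≥0∞)) (Tbar / 2) :=
    ⟨_, ENNReal.coe_toNNReal htop⟩
  have hle : ∀ x : ℝ≥0, (x : ℝ) ≤ max (B : ℝ) (Real.logb ((A : ℝ) - 1) S + 1) → x ≤ T := by
    intro x hx
    rw [← ENNReal.coe_le_coe, hT, ← ENNReal.ofReal_coe_nnreal]
    exact (ENNReal.ofReal_le_ofReal hx).trans hmax
  have hmul : ∀ x : ℝ≥0, x ≤ T → cmin * x ≤ B := by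
    intro x hx
    have h1 : (x : ℝ≥0∞) ≤ B / cmin := by
      refine le_trans ?_ (min_le_left _ (Tbar / 2))
      rw [← hT]; exact_mod_cast hx
    have h2 := ENNReal.mul_le_of_le_div' h1
    exact_mod_cast h2
  have hTbar : ∀ x : ℝ≥0, x ≤ T → ENNReal.ofReal (T + x) ≤ Tbar := by
    intro x hx
    have h1 : (T : ℝ≥0∞) ≤ Tbar / 2 := by rw [hT]; exact min_le_right _ _
    have h2 : (x : ℝ≥0∞) ≤ Tbar / 2 := le_trans (by exact_mod_cast hx) h1
    rw [ENNReal.ofReal_add T.coe_nonneg x.coe_nonneg, ENNReal.ofReal_coe_nnreal,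
      ENNReal.ofReal_coe_nnreal, ← ENNReal.add_halves Tbar]
    exact add_le_add h1 h2
  have hBT : B ≤ T := hle B (le_max_left _ _)
  have hBT' : (B : ℝ) ≤ T := by exact_mod_cast hBT
  have hc : cmin ≤ 1 := by
    have h1 := hmul B hBT
    exact le_of_mul_le_mul_right (by rwa [one_mul]) (lt_of_lt_of_le two_pos hB)
  -- The halving of `Tbar` makes room for the way down the tree: T + D ≤ 2T ≤ `Tbar`.
  have hdepth : ∀ D : ℕ, (D : ℝ) ≤ Real.logb ((A : ℝ) - 1) S + 1 →
      cmin * D ≤ B ∧ ENNReal.ofReal (T + D) ≤ Tbar := fun D hD => by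
    have h1 : (D : ℝ≥0) ≤ T := hle D (by rw [NNReal.coe_natCast]; exact hD.trans (le_max_right _ _))
    have h2 := hTbar D h1
    rw [NNReal.coe_natCast] at h2
    exact ⟨hmul D h1, h2⟩
  have h2B : ENNReal.ofReal (2 * B) ≤ Tbar := by
    refine le_trans (ENNReal.ofReal_le_ofReal ?_) (hTbar B hBT)
    linarith
  obtain ⟨M, hM, hMn⟩ := SSP.exists_mul_le_sampleComplexity hS hA hB hJ hc hBT (hmul T le_rfl)
    hdepth hε0 hε hδ0 hδ12 hL hn
  obtain ⟨M', hM', hMn'⟩ := SSP.exists_div_le_sampleComplexity hS hA hB hJ hJN hc h2B hε0 hε hδ12 hn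
  have hbound : ∀ {M : SSP S A}, M.HasParameters cmin B J Tbar → _ := fun {M} hM =>
    hM.bound_le (δ := δ) hT hε0
  have hfinal : ∀ x y : ℝ≥0∞, x ≤ 200000 * y → ENNReal.ofReal (1 / 200000) * x ≤ y := by
    intro x y hxy
    calc ENNReal.ofReal (1 / 200000) * x ≤ ENNReal.ofReal (1 / 200000) * (200000 * y) := by gcongr
      _ = ENNReal.ofReal (1 / 200000 * 200000) * y := by
          rw [ENNReal.ofReal_mul (by norm_num), mul_assoc]; simp
      _ = y := by norm_num
  -- The larger term selects the instance. The factor 8 bounds the passage from `Bstar` and `Tbar`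
  -- to B and T, so the worst constant is 2 · 8 · 9600 = 153600.
  rcases le_total (8 * ENNReal.ofReal (T * (B : ℝ) ^ 2 * S * A / ε ^ 2 * Real.log (1 / δ)))
    ((J : ℝ≥0∞) / ENNReal.ofReal ε) with h | h
  · refine ⟨M', hM', hfinal _ _ ?_⟩
    calc _ ≤ (J : ℝ≥0∞) / ENNReal.ofReal ε + (J : ℝ≥0∞) / ENNReal.ofReal ε :=
          add_le_add ((hbound hM').trans h) le_rfl
      _ = 2 * ((J : ℝ≥0∞) / ENNReal.ofReal ε) := (two_mul _).symm
      _ ≤ 2 * (14 * ((n M' : ℕ∞) : ℝ≥0∞)) := by gcongr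
      _ = 28 * ((n M' : ℕ∞) : ℝ≥0∞) := by rw [← mul_assoc]; norm_num
      _ ≤ 200000 * ((n M' : ℕ∞) : ℝ≥0∞) := by gcongr; norm_num
  · refine ⟨M, hM, hfinal _ _ ?_⟩
    calc _ ≤ 8 * ENNReal.ofReal (T * (B : ℝ) ^ 2 * S * A / ε ^ 2 * Real.log (1 / δ)) +
          8 * ENNReal.ofReal (T * (B : ℝ) ^ 2 * S * A / ε ^ 2 * Real.log (1 / δ)) :=
          add_le_add (hbound hM) h
      _ = 16 * ENNReal.ofReal (T * (B : ℝ) ^ 2 * S * A / ε ^ 2 * Real.log (1 / δ)) := by ring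
      _ ≤ 16 * (9600 * ((n M : ℕ∞) : ℝ≥0∞)) := by gcongr
      _ = 153600 * ((n M : ℕ∞) : ℝ≥0∞) := by rw [← mul_assoc]; norm_num
      _ ≤ 200000 * ((n M : ℕ∞) : ℝ≥0∞) := by gcongr; norm_num
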